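/- Let $M$ be a compact connected Riemann surface with an anti-holomorphic involution $\sigma$. A real holomorphic bundle $(\mathcal E,\widetilde\sigma)$ over $(M,\sigma)$ is a holomorphic vector bundle $\mathcal E\to M$ with an anti-holomorphic involution $\widetilde\sigma:\mathcal E\to\mathcal E$ that covers $\sigma$ and is $\mathbb C$-antilinear on the fibres. The slope of a non-zero bundle is $\mu=\deg/\mathrm{rk}$, where $\deg\mathcal E=\int_M c_1(\mathcal E)$. A holomorphic bundle $\mathcal E$ is semistable (resp. stable, for $\mathcal E\neq 0$) if $\mu(\mathcal F)\le\mu(\mathcal E)$ (resp. $\mu(\mathcal F)<\mu(\mathcal E)$) for every holomorphic subbundle $\mathcal F\ne 0,\mathcal E$; a non-zero real bundle is stable as a real bundle if $\mu(\mathcal F)<\mu(\mathcal E)$ for every such $\mathcal F$ with $\widetilde\sigma(\mathcal F)=\mathcal F$. For a holomorphic bundle $\mathcal E$ that is semistable, $\mathrm{gr}(\mathcal E)=\bigoplus_i \mathcal E_i/\mathcal E_{i-1}$ denotes the graded bundle of a Jordan–Hölder filtration $0=\mathcal E_0\subset\dots\subset\mathcal E_n=\mathcal E$ (holomorphic subbundles,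 with successive quotients stable of slope $\mu(\mathcal E)$). For a real bundle $(\mathcal E,\widetilde\sigma)$ that is semistable as a holomorphic bundle, a real Jordan–Hölder filtration is a filtration by $\widetilde\sigma$-invariant holomorphic subbundles whose successive quotients, with the induced real structures, are stable as real bundles and have slope $\mu(\mathcal E)$; its graded bundle is denoted $\mathrm{gr}(\mathcal E,\widetilde\sigma)$, a graded real bundle. (A Jordan–Hölder filtration by $\widetilde\sigma$-invariant subbundles is in particular a real one.) Two graded (real) bundles are isomorphic if their pieces are isomorphic as holomorphic (real) bundles after a permutation of the indices. **Proposition.** Let $(\mathcal E,\widetilde\sigma)$ and $(\mathcal E',\widetilde\sigma')$ be real holomorphic bundles over $(M,\sigma)$ whose underlying holomorphic bundles are semistable, and assume that, for some Jordan–Hölder filtrations of $\mathcal E$ and $\mathcal E'$, the graded bundles $\mathrm{gr}(\mathcal E)$ and $\mathrm{gr}(\mathcal E')$ are isomorphic as graded bundles. Then $(\mathcal E,\widetilde\sigma)$ and $(\mathcal E',\widetilde\sigma')$ have real Jordan–Hölder filtrations, and for any choice of these, $\mathrm{gr}(\mathcal E,\widetilde\sigma)$ and $\mathrm{gr}(\mathcal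 E',\widetilde\sigma')$ are isomorphic as graded real bundles. Moreover, whenever a bijection $e$ between the indices of their pieces is such that the $i$-th piece of $\mathrm{gr}(\mathcal E,\widetilde\sigma)$ is isomorphic to the $e(i)$-th piece of $\mathrm{gr}(\mathcal E',\widetilde\sigma')$ as a holomorphic bundle for all $i$, these pieces are also isomorphic as real bundles for all $i$. -/

import Mathlib

open scoped Manifold ContDiff Topology

universe u v

noncomputable section

/-- The function `f` is holomorphic near the point `x` of the Riemann surface `M`. -/
def HolFunAt {M : Type v} [TopologicalSpace M] [ChartedSpace ℂ M] (f : M → ℂ) (x : M) : Prop :=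
  ContMDiffAt 𝓘(ℂ) 𝓘(ℂ) ω f x

/-- An anti-holomorphic involution `σ` of a Riemann surface. -/
structure AntiholInvolution (M : Type v) [TopologicalSpace M] [ChartedSpace ℂ M] where
  toFun : M → M
  involutive : ∀ x, toFun (toFun x) = x
  continuous : Continuous toFun
  /-- Read in a chart near `σ x`, the complex conjugate of `σ` is holomorphic near `x`. -/
  antihol : ∀ x, HolFunAt (fun y => starRingEnd ℂ (chartAt ℂ (toFun x) (toFun y))) x

instance {M : Type v} [TopologicalSpace M] [ChartedSpace ℂ M] :
    CoeFun (AntiholInvolution M) (fun _ => M → M) := ⟨AntiholInvolution.toFun⟩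

/-- A holomorphic vector bundle of rank `rk` on `M`, given by its fibres and its local holomorphic
sections: `HolAt s x` says that the section `s` is holomorphic near `x` (values of `s` away
from `x` are irrelevant). Near every point there is a local trivialisation, that is, a basis `b y`
of the fibres such that a section is holomorphic exactly when its coefficients in `b` are. -/
structure HolBundle (M : Type v) [TopologicalSpace M] [ChartedSpace ℂ M] where
  Fib : M → Type u
  [instAdd : ∀ x, AddCommGroup (Fib x)]
  [instMod : ∀ x, Module ℂ (Fib x)]
  rk : ℕ
  HolAt : (∀ x, Fib x) → M → Prop
  exists_frame : ∀ x, ∃ b : ∀ y, Module.Basis (Fin rk) ℂ (Fib y),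
    ∀ᶠ y in 𝓝 x, ∀ s : ∀ z, Fib z,
      HolAt s y ↔ ∀ i, HolFunAt (fun z => (b z).repr (s z) i) y

attribute [instance] HolBundle.instAdd HolBundle.instMod

section Helpers

variable {M : Type v} [TopologicalSpace M] [ChartedSpace ℂ M]

namespace HolFunAt

theorem congr {f g : M → ℂ} {x : M} (hf : HolFunAt f x) (h : f =ᶠ[𝓝 x] g) : HolFunAt g x :=
  ContMDiffAt.congr_of_eventuallyEq hf h.symm

theorem const (c : ℂ) (x : M) : HolFunAt (fun _ => c) x := contMDiffAt_const

theorem mul {f g : M → ℂ} {x : M} (hf : HolFunAt f x) (hg : HolFunAt g x) :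
    HolFunAt (fun y => f y * g y) x := by
  have h : ContDiff ℂ ω (fun p : ℂ × ℂ => p.1 * p.2) := contDiff_fst.mul contDiff_snd
  exact (h.contMDiff.contMDiffAt (x := (f x, g x))).comp x (ContMDiffAt.prodMk_space hf hg)

theorem add {f g : M → ℂ} {x : M} (hf : HolFunAt f x) (hg : HolFunAt g x) :
    HolFunAt (fun y => f y + g y) x := by
  have h : ContDiff ℂ ω (fun p : ℂ × ℂ => p.1 + p.2) := contDiff_fst.add contDiff_snd
  exact (h.contMDiff.contMDiffAt (x := (f x, g x))).comp x (ContMDiffAt.prodMk_space hf hg)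

theorem inv {f : M → ℂ} {x : M} (hf : HolFunAt f x) (h0 : f x ≠ 0) :
    HolFunAt (fun y => (f y)⁻¹) x := by
  have h : ContDiffAt ℂ ω (fun z : ℂ => z⁻¹) (f x) := contDiffAt_inv ℂ h0
  exact ContMDiffAt.comp x h.contMDiffAt hf

theorem sum {ι : Type*} (S : Finset ι) {f : ι → M → ℂ} {x : M} (hf : ∀ i ∈ S, HolFunAt (f i) x) :
    HolFunAt (fun y => ∑ i ∈ S, f i y) x := by
  classical
  induction S using Finset.induction_on with
  | empty => simpa using const 0 x
  | insert a S ha ih =>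
    simp only [Finset.sum_insert ha]
    exact (hf a (by simp)).add (ih fun i hi => hf i (by simp [hi]))

theorem prod {ι : Type*} (S : Finset ι) {f : ι → M → ℂ} {x : M}
    (hf : ∀ i ∈ S, HolFunAt (f i) x) : HolFunAt (fun y => ∏ i ∈ S, f i y) x := by
  classical
  induction S using Finset.induction_on with
  | empty => simpa using const 1 x
  | insert a S ha ih =>
    simp only [Finset.prod_insert ha]
    exact (hf a (by simp)).mul (ih fun i hi => hf i (by simp [hi]))

theorem det {ι : Type*} [Fintype ι] [DecidableEq ι] {A : M → Matrix ι ι ℂ} {x : M}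
    (hA : ∀ i j, HolFunAt (fun y => A y i j) x) : HolFunAt (fun y => (A y).det) x := by
  simp only [Matrix.det_apply']
  exact sum _ fun p _ => (const _ x).mul (prod _ fun i _ => hA _ _)

end HolFunAt

/-- The basis `c` of `V` if `c` is linearly independent, and an arbitrary basis otherwise. -/
def basisOr {V : Type u} [AddCommGroup V] [Module ℂ V] {ι : Type*} [Fintype ι]
    [FiniteDimensional ℂ V] (hc : Module.finrank ℂ V = Fintype.card ι) (c : ι → V) :
    Module.Basis ι ℂ V := by
  classical
  exact if h : LinearIndependent ℂ c then basisOfLinearIndependentOfCardEqFinrank' c h hc.symm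
    else (Module.finBasisOfFinrankEq ℂ V hc).reindex (Fintype.equivFin ι).symm

theorem basisOr_apply {V : Type u} [AddCommGroup V] [Module ℂ V] {ι : Type*} [Fintype ι]
    [FiniteDimensional ℂ V] (hc : Module.finrank ℂ V = Fintype.card ι) {c : ι → V}
    (h : LinearIndependent ℂ c) (i : ι) : basisOr hc c i = c i := by
  simp [basisOr, h]

end Helpers

namespace HolBundle

variable {M : Type v} [TopologicalSpace M] [ChartedSpace ℂ M]

section Frames

variable (E : HolBundle.{u} M)

/-- `b` is a holomorphic local frame of `E` near `x`. -/
def IsFrameNear {ι : Type*} (b : ∀ y, Module.Basis ι ℂ (E.Fib y)) (x : M) : Prop :=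
  ∀ᶠ y in 𝓝 x, ∀ s : ∀ z, E.Fib z, E.HolAt s y ↔ ∀ i, HolFunAt (fun z => (b z).repr (s z) i) y

/-- A chosen holomorphic local frame near `x`. -/
def frame (x : M) : ∀ y, Module.Basis (Fin E.rk) ℂ (E.Fib y) := (E.exists_frame x).choose

theorem frame_isFrameNear (x : M) : E.IsFrameNear (E.frame x) x := (E.exists_frame x).choose_spec

instance (y : M) : FiniteDimensional ℂ (E.Fib y) := (E.frame y y).finiteDimensional_of_finite

theorem finrank_fib (y : M) : Module.finrank ℂ (E.Fib y) = E.rk := by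
  simpa using Module.finrank_eq_card_basis (E.frame y y)

variable {E}

theorem holAt_congr {s t : ∀ z, E.Fib z} {x : M} (hs : E.HolAt s x)
    (h : ∀ᶠ y in 𝓝 x, s y = t y) : E.HolAt t x := by
  have hb := (E.frame_isFrameNear x).self_of_nhds
  rw [hb] at hs ⊢
  exact fun i => (hs i).congr (h.mono fun y hy => by simp [hy])

theorem IsFrameNear.reindex {ι κ : Type*} {b : ∀ y, Module.Basis ι ℂ (E.Fib y)} {x : M}
    (hb : E.IsFrameNear b x) (e : ι ≃ κ) : E.IsFrameNear (fun y => (b y).reindex e) x := by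
  refine hb.mono fun y hy s => ?_
  rw [hy s]
  simp only [Module.Basis.repr_reindex_apply]
  exact ⟨fun h i => h _, fun h i => by simpa using h (e i)⟩

/-- Holomorphic sections that form a basis of one fibre form a local frame. -/
theorem exists_frame_of_linearIndependent {ι : Type*} [Fintype ι] (x : M)
    (c : ι → ∀ y, E.Fib y) (hc : ∀ᶠ y in 𝓝 x, ∀ i, E.HolAt (c i) y)
    (hli : LinearIndependent ℂ (fun i => c i x)) (hcard : E.rk = Fintype.card ι) :
    ∃ b : ∀ y, Module.Basis ι ℂ (E.Fib y), E.IsFrameNear b x ∧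
      ∀ᶠ y in 𝓝 x, ∀ i, b y i = c i y := by
  classical
  have e : Fin E.rk ≃ ι := Fintype.equivOfCardEq (by simpa using hcard)
  let a : ∀ y, Module.Basis ι ℂ (E.Fib y) := fun y => (E.frame x y).reindex e
  have ha : E.IsFrameNear a x := (E.frame_isFrameNear x).reindex e
  let C : M → Matrix ι ι ℂ := fun y => (a y).toMatrix (fun i => c i y)
  let b : ∀ y, Module.Basis ι ℂ (E.Fib y) := fun y =>
    basisOr ((E.finrank_fib y).trans hcard) (fun i => c i y)
  have hC : ∀ᶠ y in 𝓝 x, ∀ i j, HolFunAt (fun z => C z i j) y := by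
    filter_upwards [ha, hc] with y hy hcy i j
    exact (hy (c j)).1 (hcy j) i
  have hdet : ∀ᶠ y in 𝓝 x, HolFunAt (fun z => (C z).det) y := hC.mono fun y hy => HolFunAt.det hy
  have hne : ∀ᶠ y in 𝓝 x, (C y).det ≠ 0 := by
    refine (hdet.self_of_nhds.continuousAt).eventually_ne ?_
    have hx : (fun i => c i x) = b x := by
      funext i; exact (basisOr_apply _ hli i).symm
    have : IsUnit ((C x).det) := by
      simp only [C, hx]
      exact (Matrix.isUnit_iff_isUnit_det _).1 (by
        let _ := (a x).invertibleToMatrix (b x)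
        exact isUnit_of_invertible _)
    exact this.ne_zero
  have hbc : ∀ᶠ y in 𝓝 x, ∀ i, b y i = c i y := by
    filter_upwards [hne] with y hy i
    refine basisOr_apply _ ?_ i
    have hu : IsUnit ((a y).det fun i => c i y) := by
      rw [Module.Basis.det_apply]; exact isUnit_iff_ne_zero.2 hy
    exact ((Module.Basis.is_basis_iff_det (a y)).2 hu).1
  refine ⟨b, ?_, hbc⟩
  filter_upwards [ha, eventually_eventually_nhds.2 hbc, eventually_eventually_nhds.2 hne, hC,
    hdet, hne] with y hy hby hney hCy hdety hne0 s
  rw [hy s]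
  have hrep : ∀ᶠ z in 𝓝 y, (C z).mulVec ((b z).repr (s z)) = (a z).repr (s z) := by
    filter_upwards [hby] with z hz
    have : (fun i => c i z) = b z := by funext i; exact (hz i).symm
    simp only [C, this]
    exact Module.Basis.toMatrix_mulVec_repr _ _ _
  constructor
  · intro h i
    have hD : HolFunAt (fun z => ((C z).updateCol i ((a z).repr (s z))).det) y := by
      refine HolFunAt.det fun k l => ?_
      by_cases hl : l = i
      · subst hl; simpa using h k
      · simpa [Matrix.updateCol_ne hl] using hCy k l
    refine ((hdety.inv hne0).mul hD).congr ?_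
    filter_upwards [hrep, hney] with z hz hnez
    have h1 : (C z).cramer ((C z).mulVec ((b z).repr (s z))) = (C z).det • ((b z).repr (s z)) := by
      rw [Matrix.cramer_eq_adjugate_mulVec, Matrix.mulVec_mulVec, Matrix.adjugate_mul,
        Matrix.smul_mulVec, Matrix.one_mulVec]
    rw [hz] at h1
    have h2 := congrFun h1 i
    rw [Matrix.cramer_apply] at h2
    rw [h2]
    simp [hnez]
  · intro h i
    refine (HolFunAt.sum Finset.univ (f := fun j z => C z i j * (b z).repr (s z) j)
      fun j _ => (hCy i j).mul (h j)).congr ?_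
    filter_upwards [hrep] with z hz
    rw [← hz]; rfl

end Frames

/-- A holomorphic subbundle: a family of subspaces that is locally spanned by pointwise
linearly independent holomorphic sections. -/
structure Subbundle (E : HolBundle.{u} M) where
  carrier : ∀ x, Submodule ℂ (E.Fib x)
  rk : ℕ
  exists_sections : ∀ x, ∃ c : Fin rk → ∀ y, E.Fib y, ∀ᶠ y in 𝓝 x,
    (∀ i, E.HolAt (c i) y) ∧ LinearIndependent ℂ (fun i => c i y) ∧
      carrier y = Submodule.span ℂ (Set.range fun i => c i y)

namespace Subbundle

variable {E : HolBundle.{u} M} (F : E.Subbundle)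

theorem finrank_carrier (y : M) : Module.finrank ℂ (F.carrier y) = F.rk := by
  obtain ⟨c, hc⟩ := F.exists_sections y
  obtain ⟨-, hli, hsp⟩ := hc.self_of_nhds
  rw [hsp, finrank_span_eq_card hli, Fintype.card_fin]

theorem finrank_quotient (y : M) :
    Module.finrank ℂ (E.Fib y ⧸ F.carrier y) = E.rk - F.rk := by
  have h := (F.carrier y).finrank_quotient_add_finrank
  rw [F.finrank_carrier, E.finrank_fib] at h
  omega

/-- Near every point there is a local frame of `E` whose first part spans the subbundle. -/
theorem exists_adapted_frame (x : M) : ∃ b : ∀ y, Module.Basis (Fin F.rk ⊕ Fin (E.rk - F.rk)) ℂ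
    (E.Fib y), E.IsFrameNear b x ∧ ∀ᶠ y in 𝓝 x,
      F.carrier y = Submodule.span ℂ (Set.range fun i => b y (Sum.inl i)) := by
  classical
  obtain ⟨c, hc⟩ := F.exists_sections x
  obtain ⟨-, hli, -⟩ := hc.self_of_nhds
  have hfin : Fintype (Fin F.rk ⊕ Module.Basis.sumExtendIndex hli) :=
    @Fintype.ofFinite _ (Module.Finite.finite_basis (Module.Basis.sumExtend hli))
  have hJ : Fintype (Module.Basis.sumExtendIndex hli) :=
    Fintype.ofInjective (Sum.inr : _ → Fin F.rk ⊕ Module.Basis.sumExtendIndex hli)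
      Sum.inr_injective
  have hcd := Module.finrank_eq_nat_card_basis (Module.Basis.sumExtend hli)
  rw [E.finrank_fib, Nat.card_sum, Nat.card_fin, Nat.card_eq_fintype_card] at hcd
  let e : Module.Basis.sumExtendIndex hli ≃ Fin (E.rk - F.rk) :=
    Fintype.equivOfCardEq (by rw [Fintype.card_fin]; omega)
  let B : Module.Basis (Fin F.rk ⊕ Fin (E.rk - F.rk)) ℂ (E.Fib x) :=
    (Module.Basis.sumExtend hli).reindex ((Equiv.refl _).sumCongr e)
  have hBl : ∀ i, B (Sum.inl i) = c i x := by
    intro i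
    simp [B, Module.Basis.sumExtend]
    rfl
  let d : Fin F.rk ⊕ Fin (E.rk - F.rk) → ∀ y, E.Fib y :=
    Sum.elim c (fun j y => ∑ k, (E.frame x x).repr (B (Sum.inr j)) k • E.frame x y k)
  have hd : ∀ᶠ y in 𝓝 x, ∀ i, E.HolAt (d i) y := by
    filter_upwards [hc, E.frame_isFrameNear x] with y hy hfr i
    rcases i with i | j
    · exact hy.1 i
    · refine (hfr _).2 fun k => ?_
      have : (fun z => (E.frame x z).repr (d (Sum.inr j) z) k) =
          fun _ => (E.frame x x).repr (B (Sum.inr j)) k := by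
        funext z
        simp only [d, Sum.elim_inr]
        rw [Module.Basis.repr_sum_self]
      rw [this]
      exact HolFunAt.const _ _
  have hdx : (fun i => d i x) = B := by
    funext i
    rcases i with i | j
    · exact (hBl i).symm
    · simp only [d, Sum.elim_inr]
      exact (E.frame x x).sum_repr _
  obtain ⟨b, hb, hbd⟩ := exists_frame_of_linearIndependent x d hd
    (by rw [hdx]; exact B.linearIndependent)
    (by rw [Fintype.card_sum, Fintype.card_fin, Fintype.card_fin]; omega)
  refine ⟨b, hb, ?_⟩
  filter_upwards [hbd, hc] with y hy hcy
  rw [hcy.2.2]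
  congr 2
  funext i
  exact (hy (Sum.inl i)).symm

/-- A subbundle as a holomorphic bundle: its holomorphic sections are those of `E` with values
in it. -/
def toBundle : HolBundle.{u} M where
  Fib x := F.carrier x
  rk := F.rk
  HolAt s x := E.HolAt (fun y => (s y : E.Fib y)) x
  exists_frame x := by
    obtain ⟨b, hb, hsp⟩ := F.exists_adapted_frame x
    let c : ∀ y, Fin F.rk → F.carrier y := fun y => by
      classical
      exact fun i => if h : b y (Sum.inl i) ∈ F.carrier y then ⟨b y (Sum.inl i), h⟩ else 0
    have hfr : ∀ y, Module.finrank ℂ (F.carrier y) = Fintype.card (Fin F.rk) := fun y => by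
      rw [F.finrank_carrier, Fintype.card_fin]
    have hcb : ∀ᶠ y in 𝓝 x, ∀ i, (basisOr (hfr y) (c y) i : E.Fib y) = b y (Sum.inl i) := by
      filter_upwards [hsp] with y hy
      have hmem : ∀ i, b y (Sum.inl i) ∈ F.carrier y := fun i => by
        rw [hy]; exact Submodule.subset_span ⟨i, rfl⟩
      have hci : ∀ i, (c y i : E.Fib y) = b y (Sum.inl i) := fun i => by simp [c, hmem i]
      have hli : LinearIndependent ℂ (c y) := by
        refine LinearIndependent.of_comp (F.carrier y).subtype ?_
        have : (F.carrier y).subtype ∘ c y = fun i => b y (Sum.inl i) := by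
          funext i; exact hci i
        rw [this]
        exact (b y).linearIndependent.comp _ Sum.inl_injective
      intro i
      rw [basisOr_apply _ hli, hci]
    refine ⟨fun y => basisOr (hfr y) (c y), ?_⟩
    filter_upwards [hb, eventually_eventually_nhds.2 hcb] with y hy hcy s
    rw [hy]
    have key : ∀ᶠ z in 𝓝 y, ∀ i, (b z).repr (s z : E.Fib z) i =
        Sum.elim (fun k => (basisOr (hfr z) (c z)).repr (s z) k) (fun _ => 0) i := by
      filter_upwards [hcy] with z hz
      have h1 : (s z : E.Fib z) =
          ∑ k, (basisOr (hfr z) (c z)).repr (s z) k • b z (Sum.inl k) := by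
        have h0 := congrArg (F.carrier z).subtype ((basisOr (hfr z) (c z)).sum_repr (s z))
        rw [map_sum] at h0
        refine h0.symm.trans (Finset.sum_congr rfl fun k _ => ?_)
        rw [map_smul, Submodule.subtype_apply, hz]
      have h2 : (s z : E.Fib z) = ∑ i, Sum.elim
          (fun k => (basisOr (hfr z) (c z)).repr (s z) k) (fun _ => 0) i • b z i := by
        rw [Fintype.sum_sum_type]
        simpa using h1
      intro i
      conv_lhs => rw [h2]
      rw [Module.Basis.repr_sum_self]
    constructor
    · intro h k
      exact (h (Sum.inl k)).congr (key.mono fun z hz => hz (Sum.inl k))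
    · intro h i
      rcases i with k | j
      · exact (h k).congr (key.mono fun z hz => (hz (Sum.inl k)).symm)
      · exact (HolFunAt.const 0 y).congr (key.mono fun z hz => (hz (Sum.inr j)).symm)

/-- The quotient bundle `E / F`: its holomorphic sections are those that lift locally to
holomorphic sections of `E`. -/
def quotient : HolBundle.{u} M where
  Fib x := E.Fib x ⧸ F.carrier x
  rk := E.rk - F.rk
  HolAt s x := ∃ t : ∀ y, E.Fib y, E.HolAt t x ∧
    ∀ᶠ y in 𝓝 x, s y = Submodule.Quotient.mk (t y)
  exists_frame x := by
    obtain ⟨b, hb, hsp⟩ := F.exists_adapted_frame x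
    let c : ∀ y, Fin (E.rk - F.rk) → E.Fib y ⧸ F.carrier y := fun y j =>
      Submodule.Quotient.mk (b y (Sum.inr j))
    have hfr : ∀ y, Module.finrank ℂ (E.Fib y ⧸ F.carrier y) =
        Fintype.card (Fin (E.rk - F.rk)) := fun y => by
      rw [F.finrank_quotient, Fintype.card_fin]
    have hexp : ∀ᶠ y in 𝓝 x, ∀ v : E.Fib y, (Submodule.Quotient.mk v : E.Fib y ⧸ F.carrier y) =
        ∑ j, (b y).repr v (Sum.inr j) • c y j := by
      filter_upwards [hsp] with y hy v
      have hmem : ∀ i, b y (Sum.inl i) ∈ F.carrier y := fun i => by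
        rw [hy]; exact Submodule.subset_span ⟨i, rfl⟩
      have hz : ∀ i, (F.carrier y).mkQ (b y (Sum.inl i)) = 0 := fun i =>
        (Submodule.Quotient.mk_eq_zero _).2 (hmem i)
      have h1 : (F.carrier y).mkQ v = (F.carrier y).mkQ (∑ i, (b y).repr v i • b y i) := by
        rw [(b y).sum_repr]
      rw [map_sum, Fintype.sum_sum_type] at h1
      simp only [map_smul, hz, smul_zero, Finset.sum_const_zero, zero_add] at h1
      exact h1
    have hcb : ∀ᶠ y in 𝓝 x, ∀ j, basisOr (hfr y) (c y) j = c y j := by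
      filter_upwards [hexp] with y hy
      have htop : ⊤ ≤ Submodule.span ℂ (Set.range (c y)) := by
        rintro w -
        obtain ⟨v, rfl⟩ := Submodule.Quotient.mk_surjective _ w
        rw [hy v]
        exact Submodule.sum_mem _ fun j _ =>
          Submodule.smul_mem _ _ (Submodule.subset_span ⟨j, rfl⟩)
      exact fun j => basisOr_apply _
        (linearIndependent_of_top_le_span_of_card_eq_finrank htop (hfr y).symm) j
    refine ⟨fun y => basisOr (hfr y) (c y), ?_⟩
    filter_upwards [hb, eventually_eventually_nhds.2 hcb, eventually_eventually_nhds.2 hexp]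
      with y hy hcy hey s
    constructor
    · rintro ⟨t, ht, hst⟩ j
      refine ((hy t).1 ht (Sum.inr j)).congr ?_
      filter_upwards [hcy, hey, hst] with z hz hez hstz
      have : s z = ∑ k, (b z).repr (t z) (Sum.inr k) • basisOr (hfr z) (c z) k := by
        rw [hstz, hez]
        exact Finset.sum_congr rfl fun k _ => by rw [hz]
      rw [this, Module.Basis.repr_sum_self]
    · intro h
      refine ⟨fun z => ∑ j, (basisOr (hfr z) (c z)).repr (s z) j • b z (Sum.inr j), ?_, ?_⟩
      · refine (hy _).2 fun i => ?_
        have key : ∀ z, (b z).repr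
            (∑ j, (basisOr (hfr z) (c z)).repr (s z) j • b z (Sum.inr j)) i =
            Sum.elim (fun _ => 0) (fun j => (basisOr (hfr z) (c z)).repr (s z) j) i := by
          intro z
          have h2 : ∑ j, (basisOr (hfr z) (c z)).repr (s z) j • b z (Sum.inr j) =
              ∑ i, Sum.elim (fun _ => (0 : ℂ))
                (fun j => (basisOr (hfr z) (c z)).repr (s z) j) i • b z i := by
            rw [Fintype.sum_sum_type]
            simp
          rw [h2, Module.Basis.repr_sum_self]
        simp only [key]
        rcases i with k | j
        · exact HolFunAt.const 0 y
        · exact h j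
      · filter_upwards [hcy] with z hz
        conv_lhs => rw [← (basisOr (hfr z) (c z)).sum_repr (s z)]
        rw [← Submodule.mkQ_apply, map_sum]
        refine Finset.sum_congr rfl fun j _ => ?_
        rw [map_smul, hz]
        rfl

/-- A subbundle of `E` contained in the subbundle `B`, as a subbundle of `B`. -/
def restrict (A B : E.Subbundle) (h : A.carrier ≤ B.carrier) : B.toBundle.Subbundle where
  carrier x := (A.carrier x).submoduleOf (B.carrier x)
  rk := A.rk
  exists_sections x := by
    classical
    obtain ⟨c, hc⟩ := A.exists_sections x
    let d : Fin A.rk → ∀ y, B.carrier y := fun i y =>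
      if hy : c i y ∈ B.carrier y then ⟨c i y, hy⟩ else 0
    have hd : ∀ᶠ y in 𝓝 x, ∀ i, (d i y : E.Fib y) = c i y := by
      filter_upwards [hc] with y hy i
      have : c i y ∈ B.carrier y := h y (by rw [hy.2.2]; exact Submodule.subset_span ⟨i, rfl⟩)
      simp [d, this]
    refine ⟨d, ?_⟩
    filter_upwards [hc, hd, eventually_eventually_nhds.2 hd] with y hy hdy hdy'
    have hcomp : (B.carrier y).subtype ∘ (fun i => d i y) = fun i => c i y := by
      funext i; exact hdy i
    have h1 : ∀ i, E.HolAt (fun z => (d i z : E.Fib z)) y := fun i =>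
      holAt_congr (hy.1 i) (hdy'.mono fun z hz => (hz i).symm)
    have h2 : LinearIndependent ℂ (fun i => d i y) :=
      LinearIndependent.of_comp (B.carrier y).subtype (by rw [hcomp]; exact hy.2.1)
    have h3 : (A.carrier y).submoduleOf (B.carrier y) =
        Submodule.span ℂ (Set.range fun i => d i y) := by
      apply Submodule.map_injective_of_injective (B.carrier y).injective_subtype
      rw [Submodule.map_span, ← Set.range_comp, hcomp, ← hy.2.2, Submodule.submoduleOf,
        Submodule.map_comap_subtype]
      exact inf_eq_right.2 (h y)
    exact ⟨h1, h2, h3⟩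

/-- The bundle `B / A`, for subbundles `A ⊆ B` of `E`. -/
def subquotient (A B : E.Subbundle) (h : A.carrier ≤ B.carrier) : HolBundle.{u} M :=
  (A.restrict B h).quotient

end Subbundle

/-! ### Degree, slope, stability -/

/-- A smooth Hermitian metric on `E` (conjugate linear in the first variable). -/
structure HermitianMetric (E : HolBundle.{u} M) where
  form : ∀ x, E.Fib x →ₗ⋆[ℂ] E.Fib x →ₗ[ℂ] ℂ
  conj_symm : ∀ x v w, starRingEnd ℂ (form x v w) = form x w v
  pos : ∀ x v, v ≠ 0 → 0 < (form x v v).re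
  smooth : ∀ x s t, E.HolAt s x → E.HolAt t x →
    ContMDiffAt 𝓘(ℝ, ℂ) 𝓘(ℝ, ℂ) ∞ (fun y => form y (s y) (t y)) x

/-- The determinant of the Gram matrix of the metric in the frame `b`; it is a positive real
number. -/
def HermitianMetric.gramDet {E : HolBundle.{u} M} (h : E.HermitianMetric)
    (b : ∀ y, Module.Basis (Fin E.rk) ℂ (E.Fib y)) (y : M) : ℝ :=
  (Matrix.of fun i j => h.form y (b y i) (b y j)).det.re

/-- The first Chern form of the Chern connection of `(E, h)` is
`c₁ = (i / 2π) tr F = -(i / 2π) ∂∂̄ log det H`, with `H` the Gram matrix of `h` in a holomorphic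
local frame. In the holomorphic coordinate `z = x + i y` given by the chart at `p`, this is
`-(1 / 4π) Δ (log det H) dx ∧ dy`, and `chernDensity h p z` is the coefficient of `dx ∧ dy`. -/
def HermitianMetric.chernDensity {E : HolBundle.{u} M} (h : E.HermitianMetric) (p : M) (z : ℂ) :
    ℝ :=
  -(1 / (4 * Real.pi)) * Laplacian.laplacian
    (fun w : ℂ => Real.log (h.gramDet (E.frame ((chartAt ℂ p).symm z)) ((chartAt ℂ p).symm w))) z

/-- `E.IsDegree d` says that `d = ∫_M c₁(E, h)` for a Hermitian metric `h` on `E`, the integral of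
the 2-form being computed with a smooth partition of unity subordinate to holomorphic charts. -/
def IsDegree (E : HolBundle.{u} M) (d : ℝ) : Prop :=
  ∃ (h : E.HermitianMetric) (n : ℕ) (p : Fin n → M)
    (ρ : SmoothPartitionOfUnity (Fin n) 𝓘(ℝ, ℂ) M Set.univ),
    ρ.IsSubordinate (fun i => (chartAt ℂ (p i)).source) ∧
    d = ∑ i, ∫ z in (chartAt ℂ (p i)).target,
      ρ i ((chartAt ℂ (p i)).symm z) * h.chernDensity (p i) z

/-- The degree `∫_M c₁(E)`. On a compact Riemann surface the integral exists and does not depend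
on the metric or on the partition of unity. -/
def degree (E : HolBundle.{u} M) : ℝ := Classical.epsilon E.IsDegree

/-- The slope `deg E / rk E` of a non-zero bundle. -/
def slope (E : HolBundle.{u} M) : ℝ := E.degree / E.rk

def IsStable (E : HolBundle.{u} M) : Prop :=
  0 < E.rk ∧ ∀ F : E.Subbundle, F.carrier ≠ ⊥ → F.carrier ≠ ⊤ → F.toBundle.slope < E.slope

def IsSemistable (E : HolBundle.{u} M) : Prop :=
  ∀ F : E.Subbundle, F.carrier ≠ ⊥ → F.carrier ≠ ⊤ → F.toBundle.slope ≤ E.slope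

/-- An isomorphism of holomorphic vector bundles. -/
structure Iso (E E' : HolBundle.{u} M) where
  toEquiv : ∀ x, E.Fib x ≃ₗ[ℂ] E'.Fib x
  hol : ∀ s x, E.HolAt s x ↔ E'.HolAt (fun y => toEquiv y (s y)) x

/-! ### Real structures -/

/-- A real structure on `E` over `(M, σ)`: an anti-holomorphic involution of `E` that covers `σ`
and is anti-linear on the fibres. Anti-holomorphic means that it transforms holomorphic
sections `s` into holomorphic sections `t = conj ∘ s ∘ σ`. -/
structure RealStructure (σ : AntiholInvolution M) (E : HolBundle.{u} M) where
  conj : ∀ x, E.Fib x →ₗ⋆[ℂ] E.Fib (σ x)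
  involutive : ∀ x v, (⟨σ (σ x), conj (σ x) (conj x v)⟩ : Σ y, E.Fib y) = ⟨x, v⟩
  antihol : ∀ (s t : ∀ y, E.Fib y) (x : M), (∀ y, t (σ y) = conj y (s y)) →
    E.HolAt s x → E.HolAt t (σ x)

/-- An isomorphism of real holomorphic vector bundles. -/
structure RealIso {σ : AntiholInvolution M} {E E' : HolBundle.{u} M} (τ : RealStructure σ E)
    (τ' : RealStructure σ E') extends Iso E E' where
  comm : ∀ x v, toEquiv (σ x) (τ.conj x v) = τ'.conj x (toEquiv x v)

namespace RealStructure

variable {σ : AntiholInvolution M} {E : HolBundle.{u} M} (τ : RealStructure σ E)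

theorem exists_conj_section (s : ∀ y, E.Fib y) :
    ∃ t : ∀ y, E.Fib y, ∀ y, t (σ y) = τ.conj y (s y) := by
  refine ⟨fun z => σ.involutive z ▸ τ.conj (σ z) (s (σ z)), fun y => ?_⟩
  have key : ∀ (w : M) (hw : w = y) (h : σ w = σ y),
      (h ▸ τ.conj w (s w) : E.Fib (σ y)) = τ.conj y (s y) := by
    rintro w rfl h; rfl
  exact key (σ (σ y)) (σ.involutive y) _

/-- The subbundle `F` is preserved by the real structure. -/
def Preserves (F : E.Subbundle) : Prop := ∀ x, ∀ v ∈ F.carrier x, τ.conj x v ∈ F.carrier (σ x)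

/-- The real structure induced on a preserved subbundle. -/
def sub (F : E.Subbundle) (hF : τ.Preserves F) : RealStructure σ F.toBundle where
  conj x :=
    { toFun := fun v => ⟨τ.conj x v.1, hF x v.1 v.2⟩
      map_add' := fun v w => Subtype.ext (map_add (τ.conj x) v.1 w.1)
      map_smul' := fun a v => Subtype.ext ((τ.conj x).map_smulₛₗ a v.1) }
  involutive x v := by
    have hinj : Function.Injective
        (fun q : Σ y, F.carrier y => (⟨q.1, q.2.1⟩ : Σ y, E.Fib y)) := by
      rintro ⟨y, v, hv⟩ ⟨z, w, hw⟩ h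
      obtain ⟨rfl, h⟩ := Sigma.mk.inj h
      obtain rfl := eq_of_heq h
      rfl
    exact hinj (τ.involutive x v.1)
  antihol s t x hst hs :=
    τ.antihol (fun y => (s y).1) (fun y => (t y).1) x (fun y => congrArg Subtype.val (hst y)) hs

/-- The real structure induced on the quotient by a preserved subbundle. -/
def quotient (F : E.Subbundle) (hF : τ.Preserves F) : RealStructure σ F.quotient where
  conj x := (F.carrier x).mapQ (F.carrier (σ x)) (τ.conj x) (fun v hv => hF x v hv)
  involutive x v := by
    obtain ⟨v, rfl⟩ := Submodule.Quotient.mk_surjective _ v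
    exact congrArg (fun q : Σ y, E.Fib y =>
      (⟨q.1, Submodule.Quotient.mk q.2⟩ : Σ y, E.Fib y ⧸ F.carrier y)) (τ.involutive x v)
  antihol s t x hst hs := by
    obtain ⟨a, ha, hsa⟩ := hs
    obtain ⟨a', ha'⟩ := τ.exists_conj_section a
    refine ⟨a', τ.antihol a a' x ha' ha, ?_⟩
    have hσ : Filter.Tendsto σ (𝓝 (σ x)) (𝓝 x) := by
      have := σ.continuous.tendsto (σ x)
      rwa [σ.involutive] at this
    filter_upwards [hσ.eventually hsa] with z hz
    have key : t (σ (σ z)) = Submodule.Quotient.mk (a' (σ (σ z))) := by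
      rw [hst, hz, ha']; rfl
    rwa [σ.involutive] at key

theorem preserves_restrict (A B : E.Subbundle) (h : A.carrier ≤ B.carrier) (hA : τ.Preserves A)
    (hB : τ.Preserves B) : (τ.sub B hB).Preserves (A.restrict B h) :=
  fun x v hv => hA x v.1 hv

/-- The real structure induced on `B / A`. -/
def subquotient (A B : E.Subbundle) (h : A.carrier ≤ B.carrier) (hA : τ.Preserves A)
    (hB : τ.Preserves B) : RealStructure σ (A.subquotient B h) :=
  (τ.sub B hB).quotient (A.restrict B h) (τ.preserves_restrict A B h hA hB)

/-- Stability in the category of real bundles: only subbundles preserved by the real structure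
are tested. -/
def IsRealStable : Prop :=
  0 < E.rk ∧ ∀ F : E.Subbundle, τ.Preserves F → F.carrier ≠ ⊥ → F.carrier ≠ ⊤ →
    F.toBundle.slope < E.slope

end RealStructure

/-! ### Jordan–Hölder filtrations -/

/-- A finite filtration `0 = E₀ ⊆ E₁ ⊆ ⋯ ⊆ Eₙ = E` by holomorphic subbundles. -/
structure Filtration (E : HolBundle.{u} M) where
  len : ℕ
  step : Fin (len + 1) → E.Subbundle
  bot : (step 0).carrier = ⊥
  top : (step (Fin.last len)).carrier = ⊤
  mono : ∀ i : Fin len, (step i.castSucc).carrier ≤ (step i.succ).carrier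

namespace Filtration

variable {E : HolBundle.{u} M} (P : E.Filtration)

/-- The successive quotients `Eᵢ₊₁ / Eᵢ`. -/
def gr (i : Fin P.len) : HolBundle.{u} M :=
  (P.step i.castSucc).subquotient (P.step i.succ) (P.mono i)

/-- The successive quotients are stable, with the same slope as `E`. -/
def IsJordanHolder : Prop := ∀ i, (P.gr i).IsStable ∧ (P.gr i).slope = E.slope

/-- All steps are preserved by the real structure. -/
def IsReal {σ : AntiholInvolution M} (τ : RealStructure σ E) : Prop :=
  ∀ i, τ.Preserves (P.step i)

/-- The induced real structures on the successive quotients. -/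
def grReal {σ : AntiholInvolution M} (τ : RealStructure σ E) (hP : P.IsReal τ) (i : Fin P.len) :
    RealStructure σ (P.gr i) :=
  τ.subquotient _ _ (P.mono i) (hP _) (hP _)

end Filtration

/-- A Jordan–Hölder filtration of a real bundle, in the category of real bundles: the steps are
preserved by the real structure, and the successive quotients, with the induced real structures,
are stable as real bundles and have the same slope as `E`. -/
structure RealJordanHolder {σ : AntiholInvolution M} {E : HolBundle.{u} M}
    (τ : RealStructure σ E) extends Filtration E where
  isReal : toFiltration.IsReal τ
  stable : ∀ i, (toFiltration.grReal τ isReal i).IsRealStable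
  slope_eq : ∀ i, (toFiltration.gr i).slope = E.slope

/-- The induced real structures on the graded pieces. -/
def RealJordanHolder.grReal {σ : AntiholInvolution M} {E : HolBundle.{u} M}
    {τ : RealStructure σ E} (R : RealJordanHolder τ) (i : Fin R.len) : RealStructure σ (R.gr i) :=
  R.toFiltration.grReal τ R.isReal i

/-- A Jordan–Hölder filtration whose steps are preserved by the real structure (so that the
successive quotients are both stable and real) is one in the category of real bundles. -/
def RealJordanHolder.ofIsJordanHolder {σ : AntiholInvolution M} {E : HolBundle.{u} M}
    {τ : RealStructure σ E} (P : E.Filtration) (hP : P.IsJordanHolder) (hτ : P.IsReal τ) :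
    RealJordanHolder τ where
  toFiltration := P
  isReal := hτ
  stable i := ⟨(hP i).1.1, fun F _ h h' => (hP i).1.2 F h h'⟩
  slope_eq i := (hP i).2

/-- Isomorphism of graded bundles. Since Jordan–Hölder gradings are only determined up to the order
of the pieces, this means that the pieces are isomorphic after a permutation of the indices. -/
def GradedIso {m n : ℕ} (G : Fin m → HolBundle.{u} M) (G' : Fin n → HolBundle.{u} M) : Prop :=
  ∃ e : Fin m ≃ Fin n, ∀ i, Nonempty (Iso (G i) (G' (e i)))

/-- Isomorphism of graded real bundles. -/
def GradedRealIso {σ : AntiholInvolution M} {m n : ℕ} {G : Fin m → HolBundle.{u} M}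
    {G' : Fin n → HolBundle.{u} M} (τ : ∀ i, RealStructure σ (G i))
    (τ' : ∀ i, RealStructure σ (G' i)) : Prop :=
  ∃ e : Fin m ≃ Fin n, ∀ i, Nonempty (RealIso (τ i) (τ' (e i)))

/-! ### Comparison with Mathlib's vector bundles -/

/-- The holomorphic bundle, in the sense used here, of a holomorphic vector bundle in the sense of
Mathlib. -/
def ofVectorBundle (F : Type*) [NormedAddCommGroup F] [NormedSpace ℂ F] [FiniteDimensional ℂ F]
    (V : M → Type u) [TopologicalSpace (Bundle.TotalSpace F V)] [∀ x, AddCommGroup (V x)]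
    [∀ x, Module ℂ (V x)] [∀ x, TopologicalSpace (V x)] [FiberBundle F V] [VectorBundle ℂ F V]
    [ContMDiffVectorBundle ω F V 𝓘(ℂ)] : HolBundle.{u} M where
  Fib := V
  rk := Module.finrank ℂ F
  HolAt s x := ContMDiffAt 𝓘(ℂ) (𝓘(ℂ).prod 𝓘(ℂ, F)) ω
    (fun y => Bundle.TotalSpace.mk' F y (s y)) x
  exists_frame x := by
    classical
    have : ContMDiffVectorBundle 1 F V 𝓘(ℂ) := ContMDiffVectorBundle.of_le (n := ω) le_top
    let e := trivializationAt F V x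
    let β := Module.finBasis ℂ F
    let b : ∀ y, Module.Basis (Fin (Module.finrank ℂ F)) ℂ (V y) := fun y =>
      if hy : y ∈ e.baseSet then e.basisAt β hy
      else (trivializationAt F V y).basisAt β (FiberBundle.mem_baseSet_trivializationAt F V y)
    refine ⟨b, ?_⟩
    have hx : x ∈ e.baseSet := FiberBundle.mem_baseSet_trivializationAt F V x
    filter_upwards [e.open_baseSet.mem_nhds hx] with y hy s
    rw [contMDiffAt_iff_localFrameCoeff (e := e) β hy]
    refine forall_congr' fun i => ?_
    have hev : (LinearMap.piApply (e.localFrameCoeff 𝓘(ℂ) β i)) s =ᶠ[𝓝 y]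
        fun z => (b z).repr (s z) i := by
      filter_upwards [e.open_baseSet.mem_nhds hy] with z hz
      simp [b, hz]
    exact ⟨fun h => HolFunAt.congr h hev, fun h => HolFunAt.congr h hev.symm⟩

end HolBundle

end

/-!
The proof compares multiplicities. For a fixed stable real bundle `(G, θ)` of the slope of `E`, the
number of pieces of a real Jordan–Hölder filtration of `(E, τ)` that are isomorphic to `(G, θ)` is
expressed through the pieces of an arbitrary holomorphic Jordan–Hölder filtration of `E`, without
reference to the real structure.

*Schur's lemma for real bundles.* If `f : E → E'` is a non-zero homomorphism of real bundles, then
`f + τ' f τ` or `i f + τ' (i f) τ` is non-zero, and it is compatible with the real structures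
(`RealStructure.exists_commutes`). Hence between stable real bundles of the same slope the existence
of any non-zero holomorphic homomorphism implies that the bundles are isomorphic as real bundles
(`RealStructure.IsRealStable.nonempty_realIso`). This upgrades holomorphic isomorphisms of pieces
to real ones.

*The lattice of subbundles of maximal slope.* The subbundles of a semistable bundle `E` with the
slope of `E`, together with the zero subbundle, form a modular lattice of finite length `MaxSlope`,
on which `τ` acts. Holomorphic Jordan–Hölder filtrations are maximal chains of this lattice, and
maximal chains of `τ`-invariant elements are real Jordan–Hölder filtrations; so these exist
(`IsSemistable.nonempty_realJordanHolder`). Give a prime quotient `B / A` (that is, `A ⋖ B`) its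
rank as weight if it has a non-zero homomorphism to `G`, and the weight zero otherwise. As
`B / (A ⊓ B) ≅ (A ⊔ B) / A`, transposed prime quotients have the same weight, so the total
weight of a maximal chain does not depend on the chain (`exists_weight`). A step of a real
Jordan–Hölder filtration is prime or is the sum of two conjugate prime steps
(`MaxSlope.exists_conj_of_real`), and by Schur's
lemma its weight is its rank if it is isomorphic to `(G, θ)` and zero otherwise
(`MaxSlope.weight_real_step`). Therefore the total weight of `E` is the multiplicity of `(G, θ)`
times the rank of `G` (`RealJordanHolder.weight_top`); computed along the given holomorphic
filtrations it is the same for `E` and `E'`, and so the multiplicities agree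
(`RealJordanHolder.card_eq`).

*The degree.* The Chern form of a Hermitian metric has local potentials, the logarithms of the Gram
determinants of local frames, and all properties of the degree follow from two facts about such
systems of potentials `U`. If `‖s‖ ^ 2 * exp U` is, for local holomorphic functions `s` that do not
vanish identically, a global function, then the integral of `∂∂̄ U` is zero if the function has no
zeros (`IsRatio.potInt_eq_zero`), and negative otherwise (`IsRatio.potInt_neg`). The latter is shown
by comparison with `∂∂̄ F (log φ)`, where `φ` is the global function and `F` is a convex function
that is constant near `-∞`; no residue computation is needed. It follows that the degree is well
defined (`HolBundle.degree_eq`), is additive in short exact sequences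
(`degree_add_of_exact`), does not decrease under homomorphisms that are generically isomorphisms
(`degree_of_generic_injective`), and is preserved by anti-holomorphic isomorphisms that cover `σ`
(`AntiHom.degree_eq`).

*Kernels and images.* The kernel and the image of a homomorphism are subbundles away from a discrete
set, and they extend across its points (`exists_saturation`, `Hom.exists_kernel_image`). The
resulting inequality of degrees, with its case of equality (`Hom.exists_kernel_image_degree`), gives
Schur's lemma, and also shows that sums and intersections of subbundles of maximal slope are again
subbundles of maximal slope (`IsSemistable.exists_inf_sup`).
-/

set_option linter.unusedSectionVars false

/-! ### Laplacians in the plane -/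

noncomputable section

open Laplacian InnerProductSpace

/-- The second derivative of a composition. -/
theorem fderiv_fderiv_comp {E : Type*} [NormedAddCommGroup E] [NormedSpace ℝ E] {u : E → ℝ}
    {T : ℂ → E} {z : ℂ} (hu : ContDiffAt ℝ 2 u (T z)) (hT : ContDiffAt ℝ 2 T z) (v w : ℂ) :
    fderiv ℝ (fderiv ℝ (u ∘ T)) z v w =
      fderiv ℝ (fderiv ℝ u) (T z) (fderiv ℝ T z v) (fderiv ℝ T z w) +
        fderiv ℝ u (T z) (fderiv ℝ (fderiv ℝ T) z v w) := by
  have hT1 : ∀ᶠ y in 𝓝 z, ContDiffAt ℝ 2 T y := hT.eventually (by simp)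
  have hu1 : ∀ᶠ y in 𝓝 z, ContDiffAt ℝ 2 u (T y) :=
    hT.continuousAt.eventually (hu.eventually (by simp))
  have h1 : fderiv ℝ (u ∘ T) =ᶠ[𝓝 z] fun y => (fderiv ℝ u (T y)).comp (fderiv ℝ T y) := by
    filter_upwards [hT1, hu1] with y hy hy'
    exact fderiv_comp y (hy'.differentiableAt (by simp)) (hy.differentiableAt (by simp))
  rw [h1.fderiv_eq]
  have hdu : DifferentiableAt ℝ (fderiv ℝ u) (T z) :=
    (hu.fderiv_right (m := 1) (by norm_num)).differentiableAt (by simp)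
  have hdT : DifferentiableAt ℝ (fderiv ℝ T) z :=
    (hT.fderiv_right (m := 1) (by norm_num)).differentiableAt (by simp)
  have hTd : DifferentiableAt ℝ T z := hT.differentiableAt (by simp)
  have h2 := (hdu.hasFDerivAt.comp z hTd.hasFDerivAt).clm_comp hdT.hasFDerivAt
  have h3 := h2.fderiv
  simp only [Function.comp_def] at h3
  rw [h3]
  simp
  ring

theorem laplacian_eq_fderiv (u : ℂ → ℝ) (z : ℂ) :
    Δ u z = fderiv ℝ (fderiv ℝ u) z 1 1 + fderiv ℝ (fderiv ℝ u) z Complex.I Complex.I := by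
  rw [laplacian_eq_iteratedFDeriv_complexPlane]
  simp [iteratedFDeriv_two_apply]

/-- A convex function of a function that is harmonic at a point is subharmonic there. -/
theorem laplacian_comp_nonneg {F : ℝ → ℝ} {w : ℂ → ℝ} {z : ℂ} (hF : ContDiffAt ℝ 2 F (w z))
    (hw : ContDiffAt ℝ 2 w z) (hF2 : ∀ t, 0 ≤ fderiv ℝ (fderiv ℝ F) (w z) t t)
    (h0 : Δ w z = 0) : 0 ≤ Δ (F ∘ w) z := by
  rw [laplacian_eq_fderiv] at *
  rw [fderiv_fderiv_comp hF hw, fderiv_fderiv_comp hF hw, add_add_add_comm, ← map_add, h0, map_zero,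
    add_zero]
  exact add_nonneg (hF2 _) (hF2 _)

/-- The Laplacian is conformally covariant. -/
theorem laplacian_comp_analytic {u : ℂ → ℝ} {S : ℂ → ℂ} {z : ℂ} (hu : ContDiffAt ℝ 2 u (S z))
    (hS : AnalyticAt ℂ S z) : Δ (u ∘ S) z = ‖deriv S z‖ ^ 2 * Δ u (S z) := by
  have hSC : ContDiffAt ℂ 2 S z := hS.contDiffAt
  have hSR : ContDiffAt ℝ 2 S z := hSC.restrict_scalars ℝ
  have hharm : fderiv ℝ (fderiv ℝ S) z 1 1 + fderiv ℝ (fderiv ℝ S) z Complex.I Complex.I = 0 := by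
    have := hS.harmonicAt.2.self_of_nhds
    rw [laplacian_eq_iteratedFDeriv_complexPlane] at this
    simpa [iteratedFDeriv_two_apply] using this
  have hd : ∀ v, fderiv ℝ S z v = v * deriv S z := by
    intro v
    have := (hS.differentiableAt.hasDerivAt.hasFDerivAt.restrictScalars ℝ).fderiv
    rw [this]
    simp
  rw [laplacian_eq_fderiv, laplacian_eq_fderiv, fderiv_fderiv_comp hu hSR,
    fderiv_fderiv_comp hu hSR, add_add_add_comm, ← map_add, hharm, map_zero, add_zero, hd, hd]
  generalize hB : fderiv ℝ (fderiv ℝ u) (S z) = B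
  have hsymm : ∀ v w, B v w = B w v := by
    intro v w
    rw [← hB]
    exact (hu.isSymmSndFDerivAt (by simp)).eq v w
  generalize deriv S z = c
  have e1 : (1 : ℂ) * c = c.re • (1 : ℂ) + c.im • Complex.I := by
    simp [Complex.re_add_im]
  have e2 : Complex.I * c = (-c.im) • (1 : ℂ) + c.re • Complex.I := by
    apply Complex.ext <;> simp
  rw [e1, e2, Complex.sq_norm, Complex.normSq_apply]
  simp only [map_add, map_smul, add_apply, smul_apply,
    smul_eq_mul]
  rw [hsymm Complex.I 1]
  ring

theorem laplacian_comp_conj {u : ℂ → ℝ} {z : ℂ} (hu : ContDiffAt ℝ 2 u (starRingEnd ℂ z)) :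
    Δ (u ∘ starRingEnd ℂ) z = Δ u (starRingEnd ℂ z) := by
  have hc : ContDiff ℝ ω (starRingEnd ℂ : ℂ → ℂ) := Complex.conjCLE.contDiff
  have hd : ∀ y, fderiv ℝ (starRingEnd ℂ : ℂ → ℂ) y = (Complex.conjCLE : ℂ →L[ℝ] ℂ) := fun y =>
    (Complex.conjCLE : ℂ →L[ℝ] ℂ).hasFDerivAt.fderiv
  have hd2 : fderiv ℝ (fderiv ℝ (starRingEnd ℂ : ℂ → ℂ)) z = 0 := by
    rw [show fderiv ℝ (starRingEnd ℂ : ℂ → ℂ) = fun _ => (Complex.conjCLE : ℂ →L[ℝ] ℂ) from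
      funext hd]
    simp
  have hc2 : ContDiffAt ℝ 2 (starRingEnd ℂ : ℂ → ℂ) z := (hc.of_le le_top).contDiffAt
  rw [laplacian_eq_fderiv, laplacian_eq_fderiv, fderiv_fderiv_comp hu hc2,
    fderiv_fderiv_comp hu hc2, hd2, hd]
  simp

theorem continuousOn_laplacian {u : ℂ → ℝ} {s : Set ℂ} (hs : IsOpen s)
    (hu : ContDiffOn ℝ 2 u s) : ContinuousOn (Δ u) s := by
  have h1 : ContDiffOn ℝ 1 (fderiv ℝ u) s := hu.fderiv_of_isOpen hs (by norm_num)
  have h2 : ContinuousOn (fderiv ℝ (fderiv ℝ u)) s := h1.continuousOn_fderiv_of_isOpen hs (by simp)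
  have : Δ u = fun z => fderiv ℝ (fderiv ℝ u) z 1 1 +
      fderiv ℝ (fderiv ℝ u) z Complex.I Complex.I := funext (laplacian_eq_fderiv u)
  rw [this]
  exact ((h2.clm_apply continuousOn_const).clm_apply continuousOn_const).add
    ((h2.clm_apply continuousOn_const).clm_apply continuousOn_const)

theorem integral_fderiv_eq_zero_of_hasCompactSupport {g : ℂ → ℝ} (hg : ContDiff ℝ 1 g)
    (hc : HasCompactSupport g) (v : ℂ) : ∫ z, fderiv ℝ g z v = 0 := by
  have hi : MeasureTheory.Integrable (fun z => fderiv ℝ g z v) :=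
    ((hg.continuous_fderiv (by simp)).clm_apply continuous_const).integrable_of_hasCompactSupport
      (hc.fderiv_apply ℝ v)
  have := integral_mul_fderiv_eq_neg_fderiv_mul_of_integrable (f := fun _ : ℂ => (1 : ℝ)) (g := g)
    (v := v) (μ := MeasureTheory.volume) (by simp) (by simpa using hi)
    (by simpa using hg.continuous.integrable_of_hasCompactSupport hc)
    (fun _ _ => differentiableAt_const _) (fun x _ => hg.differentiable (by simp) x)
  simpa using this

theorem integral_laplacian_eq_zero {u : ℂ → ℝ} (hu : ContDiff ℝ 2 u) (hc : HasCompactSupport u) :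
    ∫ z, Δ u z = 0 := by
  have hg : ∀ v : ℂ, ContDiff ℝ 1 (fun z => fderiv ℝ u z v) := fun v =>
    (hu.fderiv_right (by norm_num)).clm_apply contDiff_const
  have hgc : ∀ v : ℂ, HasCompactSupport (fun z => fderiv ℝ u z v) := fun v => hc.fderiv_apply ℝ v
  have key : ∀ v z, fderiv ℝ (fderiv ℝ u) z v v = fderiv ℝ (fun z => fderiv ℝ u z v) z v := by
    intro v z
    have hd : DifferentiableAt ℝ (fderiv ℝ u) z :=
      (hu.fderiv_right (m := 1) (by norm_num)).differentiable (by simp) z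
    rw [fderiv_clm_apply hd (differentiableAt_const _)]
    simp
  have hi : ∀ v : ℂ, MeasureTheory.Integrable fun z => fderiv ℝ (fun z => fderiv ℝ u z v) z v :=
    fun v => (((hg v).continuous_fderiv (by simp)).clm_apply
      continuous_const).integrable_of_hasCompactSupport ((hgc v).fderiv_apply ℝ v)
  simp only [laplacian_eq_fderiv, key]
  rw [MeasureTheory.integral_add (hi 1) (hi _),
    integral_fderiv_eq_zero_of_hasCompactSupport (hg _) (hgc _),
    integral_fderiv_eq_zero_of_hasCompactSupport (hg _) (hgc _), add_zero]

/-- A smooth convex function that vanishes on `(-∞, a]` and has slope `1` on `[a + 1, ∞)`. -/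
theorem exists_convex_truncation (a : ℝ) : ∃ F : ℝ → ℝ, ContDiff ℝ ∞ F ∧ (∀ s ≤ a, F s = 0) ∧
    (∃ C, ∀ s, a + 1 ≤ s → F s = s + C) ∧ (∀ s t, 0 ≤ fderiv ℝ (fderiv ℝ F) s t t) ∧
    ∀ s, a < s → 0 < F s := by
  have hc : Continuous fun t => Real.smoothTransition (t - a) :=
    Real.smoothTransition.continuous.comp (continuous_id.sub continuous_const)
  let F : ℝ → ℝ := fun s => ∫ t in a..s, Real.smoothTransition (t - a)
  have hF : ∀ s, HasDerivAt F (Real.smoothTransition (s - a)) s := fun s =>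
    intervalIntegral.integral_hasDerivAt_right (hc.intervalIntegrable _ _)
      (hc.stronglyMeasurableAtFilter _ _) hc.continuousAt
  have hdF : deriv F = fun s => Real.smoothTransition (s - a) := funext fun s => (hF s).deriv
  have hsm : ContDiff ℝ ∞ fun s => Real.smoothTransition (s - a) :=
    Real.smoothTransition.contDiff.comp (contDiff_id.sub contDiff_const)
  refine ⟨F, ?_, ?_, ⟨F (a + 1) - (a + 1), ?_⟩, ?_, ?_⟩
  · rw [contDiff_infty_iff_deriv]
    exact ⟨fun s => (hF s).differentiableAt, by rw [hdF]; exact hsm⟩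
  · intro s hs
    refine intervalIntegral.integral_zero_ae (Filter.Eventually.of_forall fun t ht => ?_)
    rw [Set.uIoc_of_ge hs] at ht
    exact Real.smoothTransition.zero_of_nonpos (by linarith [ht.2])
  · intro s hs
    have h1 : F s = F (a + 1) + ∫ t in (a + 1)..s, Real.smoothTransition (t - a) :=
      (intervalIntegral.integral_add_adjacent_intervals (hc.intervalIntegrable _ _)
        (hc.intervalIntegrable _ _)).symm
    have h2 : ∫ t in (a + 1)..s, Real.smoothTransition (t - a) = ∫ t in (a + 1)..s, (1 : ℝ) := by
      refine intervalIntegral.integral_congr fun t ht => ?_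
      rw [Set.uIcc_of_le hs] at ht
      exact Real.smoothTransition.one_of_one_le (by linarith [ht.1])
    rw [h1, h2]
    simp
    ring
  · intro s t
    have h1 : fderiv ℝ F = fun s => Real.smoothTransition (s - a) •
        (ContinuousLinearMap.id ℝ ℝ) := by
      funext s
      rw [(hF s).hasFDerivAt.fderiv]
      ext
      simp
    have hmono : Monotone fun s => Real.smoothTransition (s - a) := fun x y hxy =>
      Real.smoothTransition.monotone (by linarith)
    have h2 : HasDerivAt (fun s => Real.smoothTransition (s - a))
        (deriv (fun s => Real.smoothTransition (s - a)) s) s :=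
      (hsm.differentiable (by simp) s).hasDerivAt
    have h3 : 0 ≤ deriv (fun s => Real.smoothTransition (s - a)) s := hmono.deriv_nonneg
    have h4 := (h2.smul_const (ContinuousLinearMap.id ℝ ℝ)).hasFDerivAt.fderiv
    rw [h1, h4]
    simp only [ContinuousLinearMap.toSpanSingleton_apply, smul_apply,
      ContinuousLinearMap.id_apply, smul_eq_mul]
    nlinarith [mul_nonneg (mul_self_nonneg t) h3]
  · intro s hs
    refine intervalIntegral.intervalIntegral_pos_of_pos_on (hc.intervalIntegrable _ _) ?_ hs
    intro t ht
    exact Real.smoothTransition.pos_of_pos (by linarith [ht.1])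

end

/-! ### Holomorphic functions and conformal maps in charts -/

noncomputable section

open Laplacian InnerProductSpace

section Charts

variable {M : Type v} [TopologicalSpace M] [ChartedSpace ℂ M] [IsManifold 𝓘(ℂ) ω M]

/-- A Riemann surface is a real smooth manifold. -/
theorem isManifold_real : IsManifold 𝓘(ℝ, ℂ) ∞ M := by
  refine isManifold_of_contDiffOn _ _ _ fun e e' he he' => ?_
  have h := (contDiffGroupoid ω 𝓘(ℂ)).compatible he he'
  rw [contDiffGroupoid, mem_groupoid_of_pregroupoid] at h
  replace h : ContDiffOn ℂ ω _ _ := h.1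
  have h' := (h.restrict_scalars ℝ).of_le (le_top : (∞ : WithTop ℕ∞) ≤ ω)
  simpa using h'

theorem holFunAt_iff_analyticAt {f : M → ℂ} {x p : M} (hx : x ∈ (chartAt ℂ p).source) :
    HolFunAt f x ↔ AnalyticAt ℂ (f ∘ (chartAt ℂ p).symm) (chartAt ℂ p x) := by
  have h := contMDiffAt_iff_source_of_mem_source (I := 𝓘(ℂ)) (I' := 𝓘(ℂ)) (n := ω) (f := f)
    (x := p) (x' := x) (by simpa using hx)
  rw [HolFunAt, h]
  simp only [extChartAt, mfld_simps, contMDiffWithinAt_univ]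
  rw [contMDiffAt_iff_contDiffAt, ← contDiffWithinAt_univ,
    contDiffWithinAt_omega_iff_analyticWithinAt, analyticWithinAt_univ]

theorem smAt_iff {u : M → ℝ} {x p : M} (hx : x ∈ (chartAt ℂ p).source) :
    ContMDiffAt 𝓘(ℝ, ℂ) 𝓘(ℝ) ∞ u x ↔
      ContDiffAt ℝ ∞ (u ∘ (chartAt ℂ p).symm) (chartAt ℂ p x) := by
  have : IsManifold 𝓘(ℝ, ℂ) ∞ M := isManifold_real
  have h := contMDiffAt_iff_source_of_mem_source (I := 𝓘(ℝ, ℂ)) (I' := 𝓘(ℝ)) (n := ∞) (f := u)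
    (x := p) (x' := x) (by simpa using hx)
  rw [h]
  simp only [extChartAt, mfld_simps, contMDiffWithinAt_univ]
  rw [contMDiffAt_iff_contDiffAt]

theorem holFunAt_chart {p x : M} (hx : x ∈ (chartAt ℂ p).source) :
    HolFunAt (chartAt ℂ p) x := by
  rw [holFunAt_iff_analyticAt hx]
  refine analyticAt_id.congr ?_
  filter_upwards [(chartAt ℂ p).open_target.mem_nhds ((chartAt ℂ p).map_source hx)] with z hz
  simp [hz]

theorem HolFunAt.eventually {f : M → ℂ} {x : M} (hf : HolFunAt f x) :
    ∀ᶠ y in 𝓝 x, HolFunAt f y := by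
  have h := (holFunAt_iff_analyticAt (mem_chart_source ℂ x)).1 hf
  filter_upwards [((chartAt ℂ x).continuousAt (mem_chart_source ℂ x)).eventually
    h.eventually_analyticAt, (chartAt ℂ x).open_source.mem_nhds (mem_chart_source ℂ x)]
    with y hy hy'
  exact (holFunAt_iff_analyticAt hy').2 hy

theorem HolFunAt.restrict {f : M → ℂ} {x : M} (hf : HolFunAt f x) :
    ContMDiffAt 𝓘(ℝ, ℂ) 𝓘(ℝ, ℂ) ∞ f x := by
  have : IsManifold 𝓘(ℝ, ℂ) ∞ M := isManifold_real
  have hx := mem_chart_source ℂ x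
  have h := contMDiffAt_iff_source_of_mem_source (I := 𝓘(ℝ, ℂ)) (I' := 𝓘(ℝ, ℂ)) (n := ∞) (f := f)
    (x := x) (x' := x) (by simp)
  rw [h]
  simp only [extChartAt, mfld_simps, contMDiffWithinAt_univ]
  rw [contMDiffAt_iff_contDiffAt]
  have h2 : AnalyticAt ℂ (f ∘ (chartAt ℂ x).symm) (chartAt ℂ x x) :=
    (holFunAt_iff_analyticAt hx).1 hf
  exact (h2.contDiffAt (n := ∞)).restrict_scalars ℝ

end Charts

/-! ### Conformal maps of the plane -/

theorem AnalyticAt.conj_conj' {g : ℂ → ℂ} {z : ℂ} (hg : AnalyticAt ℂ g (starRingEnd ℂ z)) :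
    AnalyticAt ℂ (starRingEnd ℂ ∘ g ∘ starRingEnd ℂ) z := by
  rw [Complex.analyticAt_iff_eventually_differentiableAt] at hg ⊢
  have hc : Filter.Tendsto (starRingEnd ℂ) (𝓝 z) (𝓝 (starRingEnd ℂ z)) :=
    Complex.continuous_conj.tendsto z
  filter_upwards [hc.eventually hg] with w hw
  exact differentiableAt_conj_conj_iff.2 hw

/-- `S` is holomorphic or anti-holomorphic near `z`. -/
def ConformalAt' (S : ℂ → ℂ) (z : ℂ) : Prop :=
  AnalyticAt ℂ S z ∨ AnalyticAt ℂ (starRingEnd ℂ ∘ S) z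

theorem det_fderiv_analytic {S : ℂ → ℂ} {z : ℂ} (hS : AnalyticAt ℂ S z) :
    (fderiv ℝ S z).det = ‖deriv S z‖ ^ 2 := by
  have h : fderiv ℝ S z = _ :=
    (hS.differentiableAt.hasDerivAt.hasFDerivAt.restrictScalars ℝ).fderiv
  have h2 : ((fderiv ℝ S z : ℂ →L[ℝ] ℂ) : ℂ →ₗ[ℝ] ℂ) = Algebra.lmul ℝ ℂ (deriv S z) := by
    ext; simp [h, mul_comm]
  rw [ContinuousLinearMap.det, h2, ← Algebra.norm_apply, Algebra.norm_complex_eq, Complex.sq_norm]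
  rfl

theorem ConformalAt'.contDiffAt {S : ℂ → ℂ} {z : ℂ} (hS : ConformalAt' S z) {n : ℕ∞} :
    ContDiffAt ℝ n S z := by
  rcases hS with h | h
  · exact (h.contDiffAt (n := n)).restrict_scalars ℝ
  · have h2 := (h.contDiffAt (n := n)).restrict_scalars ℝ
    have h3 : ContDiff ℝ n (starRingEnd ℂ : ℂ → ℂ) := Complex.conjCLE.contDiff
    have := h3.contDiffAt.comp z h2
    simpa [Function.comp_def] using this

/-- Holomorphic and anti-holomorphic substitutions multiply the Laplacian by the same factor, the
absolute value of the Jacobian. This is what makes integrals over `M` independent of the charts, and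
invariant under anti-holomorphic involutions. -/
theorem ConformalAt'.laplacian_comp {u : ℂ → ℝ} {S : ℂ → ℂ} {z : ℂ} (hS : ConformalAt' S z)
    (hu : ContDiffAt ℝ 2 u (S z)) :
    Δ (u ∘ S) z = |(fderiv ℝ S z).det| * Δ u (S z) := by
  rcases hS with h | h
  · rw [laplacian_comp_analytic hu h, det_fderiv_analytic h, abs_of_nonneg (by positivity)]
  · have hcc : ∀ v : ℂ, starRingEnd ℂ ((starRingEnd ℂ ∘ S) v) = S v := by simp
    have h3 : ContDiff ℝ 2 (starRingEnd ℂ : ℂ → ℂ) := Complex.conjCLE.contDiff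
    have hu' : ContDiffAt ℝ 2 u (starRingEnd ℂ ((starRingEnd ℂ ∘ S) z)) := by rwa [hcc]
    have e : u ∘ S = (u ∘ starRingEnd ℂ) ∘ (starRingEnd ℂ ∘ S) := by
      funext v; simp
    have hd : |(fderiv ℝ S z).det| = ‖deriv (starRingEnd ℂ ∘ S) z‖ ^ 2 := by
      have hS' : DifferentiableAt ℝ S z :=
        ((ConformalAt'.contDiffAt (n := 1) (Or.inr h)).differentiableAt (by simp))
      have hc : fderiv ℝ (starRingEnd ℂ ∘ S) z =
          (Complex.conjCLE : ℂ →L[ℝ] ℂ).comp (fderiv ℝ S z) :=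
        ((Complex.conjCLE : ℂ →L[ℝ] ℂ).hasFDerivAt.comp z hS'.hasFDerivAt).fderiv
      have h1 := det_fderiv_analytic h
      rw [hc] at h1
      have h2 : ((Complex.conjCLE : ℂ →L[ℝ] ℂ).comp (fderiv ℝ S z)).det =
          -(fderiv ℝ S z).det := by
        rw [ContinuousLinearMap.det, ContinuousLinearMap.toLinearMap_comp, LinearMap.det_comp]
        have : LinearMap.det ((Complex.conjCLE : ℂ →L[ℝ] ℂ) : ℂ →ₗ[ℝ] ℂ) = -1 :=
          Complex.det_conjAe
        rw [this]
        simp [ContinuousLinearMap.det]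
      rw [← h1, h2, abs_of_nonpos]
      rw [h2] at h1
      have : (0:ℝ) ≤ ‖deriv (starRingEnd ℂ ∘ S) z‖ ^ 2 := by positivity
      linarith
    rw [e, laplacian_comp_analytic (hu'.comp _ h3.contDiffAt) h, laplacian_comp_conj hu', hcc, hd]

end

/-! ### Local potentials and their densities -/

noncomputable section

open Laplacian InnerProductSpace MeasureTheory

section Potentials

variable {M : Type v} [TopologicalSpace M] [ChartedSpace ℂ M]

/-- Read in one, equivalently any, chart, the function `w` is harmonic near `x`. -/
def HarmAt (w : M → ℝ) (x : M) : Prop :=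
  HarmonicAt (w ∘ (chartAt ℂ x).symm) (chartAt ℂ x x)

/-- A system of local potentials of a closed 2-form: `U x` is a smooth function near `x`, and the
differences of these functions are harmonic, so that `∂∂̄ U x` is a global form. -/
structure IsPotential (U : M → M → ℝ) : Prop where
  smooth : ∀ x, ∀ᶠ y in 𝓝 x, ContMDiffAt 𝓘(ℝ, ℂ) 𝓘(ℝ) ∞ (U x) y
  harm : ∀ x, ∀ᶠ y in 𝓝 x, HarmAt (U x - U y) y

/-- The coefficient, in the chart at `p`, of the 2-form with local potentials `U`. -/
def dens (U : M → M → ℝ) (p : M) (z : ℂ) : ℝ :=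
  Δ (U ((chartAt ℂ p).symm z) ∘ (chartAt ℂ p).symm) z

/-- The integral of the 2-form with local potentials `U`, computed with a partition of unity. -/
def potInt {n : ℕ} (p : Fin n → M) (ρ : SmoothPartitionOfUnity (Fin n) 𝓘(ℝ, ℂ) M Set.univ)
    (U : M → M → ℝ) : ℝ :=
  ∑ i, ∫ z in (chartAt ℂ (p i)).target, ρ i ((chartAt ℂ (p i)).symm z) * dens U (p i) z

/-- A continuous involution of `M` that is, near each point, holomorphic or anti-holomorphic. -/
structure IsConformalInvolution (T : M → M) : Prop where
  invol : ∀ x, T (T x) = x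
  cont : Continuous T
  conf : ∀ x, HolFunAt (fun y => chartAt ℂ (T x) (T y)) x ∨
    HolFunAt (fun y => starRingEnd ℂ (chartAt ℂ (T x) (T y))) x

variable [IsManifold 𝓘(ℂ) ω M]

theorem isConformalInvolution_id : IsConformalInvolution (id : M → M) :=
  ⟨fun _ => rfl, continuous_id, fun x => Or.inl (holFunAt_chart (mem_chart_source ℂ x))⟩

theorem AntiholInvolution.isConformalInvolution (σ : AntiholInvolution M) :
    IsConformalInvolution σ.toFun :=
  ⟨σ.involutive, σ.continuous, fun x => Or.inr (σ.antihol x)⟩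

theorem IsConformalInvolution.conformalAt {T : M → M} (hT : IsConformalInvolution T) {p q x : M}
    (hx : x ∈ (chartAt ℂ p).source) (hq : T x ∈ (chartAt ℂ q).source) :
    ConformalAt' (chartAt ℂ q ∘ T ∘ (chartAt ℂ p).symm) (chartAt ℂ p x) := by
  have hg : AnalyticAt ℂ (chartAt ℂ q ∘ (chartAt ℂ (T x)).symm) (chartAt ℂ (T x) (T x)) :=
    (holFunAt_iff_analyticAt (mem_chart_source ℂ (T x))).1 (holFunAt_chart hq)
  have hz : (chartAt ℂ p).symm (chartAt ℂ p x) = x := (chartAt ℂ p).left_inv hx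
  have hpc : ContinuousAt (chartAt ℂ p).symm (chartAt ℂ p x) :=
    (chartAt ℂ p).continuousAt_symm ((chartAt ℂ p).map_source hx)
  have hpc' : Filter.Tendsto (chartAt ℂ p).symm (𝓝 (chartAt ℂ p x)) (𝓝 x) := by
    have := hpc.tendsto
    rwa [hz] at this
  have hev : ∀ᶠ z in 𝓝 (chartAt ℂ p x), T ((chartAt ℂ p).symm z) ∈ (chartAt ℂ (T x)).source :=
    (hpc'.eventually ((hT.cont.tendsto x).eventually
      ((chartAt ℂ (T x)).open_source.mem_nhds (mem_chart_source ℂ (T x)))))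
  rcases hT.conf x with h | h
  · left
    have h1 := (holFunAt_iff_analyticAt hx).1 h
    refine (AnalyticAt.fun_comp (by simpa [hz] using hg) h1).congr ?_
    filter_upwards [hev] with z hz'
    simp [hz']
  · right
    have h1 := (holFunAt_iff_analyticAt hx).1 h
    have h2 : AnalyticAt ℂ (starRingEnd ℂ ∘ (chartAt ℂ q ∘ (chartAt ℂ (T x)).symm) ∘ starRingEnd ℂ)
        (starRingEnd ℂ (chartAt ℂ (T x) (T x))) := by
      apply AnalyticAt.conj_conj'
      simpa using hg
    refine (AnalyticAt.fun_comp (by simpa [hz] using h2) h1).congr ?_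
    filter_upwards [hev] with z hz'
    simp [hz']

theorem contDiffAt_comp_chart {w : M → ℝ} {p x : M} (hx : x ∈ (chartAt ℂ p).source)
    (hw : ContMDiffAt 𝓘(ℝ, ℂ) 𝓘(ℝ) ∞ w x) :
    ContDiffAt ℝ 2 (w ∘ (chartAt ℂ p).symm) (chartAt ℂ p x) :=
  mod_cast contDiffAt_infty.1 ((smAt_iff hx).1 hw) 2

theorem tendsto_chart_symm {p : M} {z : ℂ} (hz : z ∈ (chartAt ℂ p).target) :
    Filter.Tendsto (chartAt ℂ p).symm (𝓝 z) (𝓝 ((chartAt ℂ p).symm z)) :=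
  (chartAt ℂ p).continuousAt_symm hz

/-- Conformal covariance of the Laplacian, in charts. -/
theorem laplacian_chart_conformal {T : M → M} (hT : IsConformalInvolution T) {p q x : M}
    (hx : x ∈ (chartAt ℂ p).source) (hq : T x ∈ (chartAt ℂ q).source) {w : M → ℝ}
    (hw : ContDiffAt ℝ 2 (w ∘ (chartAt ℂ q).symm) (chartAt ℂ q (T x))) :
    Δ ((w ∘ T) ∘ (chartAt ℂ p).symm) (chartAt ℂ p x) =
      |(fderiv ℝ (chartAt ℂ q ∘ T ∘ (chartAt ℂ p).symm) (chartAt ℂ p x)).det| *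
        Δ (w ∘ (chartAt ℂ q).symm) (chartAt ℂ q (T x)) := by
  have hz : (chartAt ℂ p).symm (chartAt ℂ p x) = x := (chartAt ℂ p).left_inv hx
  have hS := hT.conformalAt hx hq
  have hSz : (chartAt ℂ q ∘ T ∘ (chartAt ℂ p).symm) (chartAt ℂ p x) = chartAt ℂ q (T x) := by
    simp [hz]
  have h1 := hS.laplacian_comp (u := w ∘ (chartAt ℂ q).symm) (by rwa [hSz])
  rw [hSz] at h1
  rw [← h1]
  refine (laplacian_congr_nhds ?_).self_of_nhds
  have hpc := tendsto_chart_symm ((chartAt ℂ p).map_source hx)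
  rw [hz] at hpc
  filter_upwards [hpc.eventually ((hT.cont.tendsto x).eventually
      ((chartAt ℂ q).open_source.mem_nhds hq))] with z hz'
  simp only [Function.comp_apply]
  rw [(chartAt ℂ q).left_inv hz']

/-- Harmonicity does not depend on the chart. -/
theorem HarmAt.of_chart {w : M → ℝ} {p x : M} (hx : x ∈ (chartAt ℂ p).source)
    (hw : HarmonicAt (w ∘ (chartAt ℂ p).symm) (chartAt ℂ p x)) {q : M}
    (hq : x ∈ (chartAt ℂ q).source) : HarmonicAt (w ∘ (chartAt ℂ q).symm) (chartAt ℂ q x) := by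
  have hev := hw.eventually
  have hzq := (chartAt ℂ q).map_source hq
  have ht : Filter.Tendsto (fun z => chartAt ℂ p ((chartAt ℂ q).symm z)) (𝓝 (chartAt ℂ q x))
      (𝓝 (chartAt ℂ p x)) := by
    have h1 := tendsto_chart_symm hzq
    rw [(chartAt ℂ q).left_inv hq] at h1
    exact ((chartAt ℂ p).continuousAt hx).tendsto.comp h1
  have hps : ∀ᶠ z in 𝓝 (chartAt ℂ q x), (chartAt ℂ q).symm z ∈ (chartAt ℂ p).source := by
    have h1 := tendsto_chart_symm hzq
    rw [(chartAt ℂ q).left_inv hq] at h1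
    exact h1.eventually ((chartAt ℂ p).open_source.mem_nhds hx)
  have hcd : ContDiffAt ℝ 2 (w ∘ (chartAt ℂ q).symm) (chartAt ℂ q x) := by
    have hS := (isConformalInvolution_id.conformalAt hq
      (show id x ∈ (chartAt ℂ p).source from hx)).contDiffAt (n := 2)
    have h2 : ContDiffAt ℝ 2 (w ∘ (chartAt ℂ p).symm)
        ((chartAt ℂ p ∘ id ∘ (chartAt ℂ q).symm) (chartAt ℂ q x)) := by
      simpa [(chartAt ℂ q).left_inv hq] using hw.1
    refine (h2.comp _ hS).congr_of_eventuallyEq ?_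
    filter_upwards [hps] with z hz
    simp [hz]
  refine ⟨hcd, ?_⟩
  filter_upwards [ht.eventually hev, hps, (chartAt ℂ q).open_target.mem_nhds hzq] with z hz hz' hzt
  have h3 := laplacian_chart_conformal isConformalInvolution_id (p := q) (q := p)
    (x := (chartAt ℂ q).symm z) ((chartAt ℂ q).map_target hzt) hz' (w := w) hz.1
  rw [(chartAt ℂ q).right_inv hzt] at h3
  have h4 : Δ (w ∘ (chartAt ℂ p).symm) (chartAt ℂ p (id ((chartAt ℂ q).symm z))) = 0 :=
    hz.2.self_of_nhds
  rw [h4, mul_zero] at h3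
  exact h3

theorem HarmAt.chart {w : M → ℝ} {x : M} (hw : HarmAt w x) {q : M}
    (hq : x ∈ (chartAt ℂ q).source) : HarmonicAt (w ∘ (chartAt ℂ q).symm) (chartAt ℂ q x) :=
  HarmAt.of_chart (mem_chart_source ℂ x) hw hq

theorem HarmAt.congr {w w' : M → ℝ} {x : M} (hw : HarmAt w x) (h : w =ᶠ[𝓝 x] w') :
    HarmAt w' x := by
  refine (harmonicAt_congr_nhds ?_).1 hw
  have h1 := tendsto_chart_symm (mem_chart_target ℂ x)
  rw [(chartAt ℂ x).left_inv (mem_chart_source ℂ x)] at h1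
  exact h1.eventually h

theorem HarmAt.add {w w' : M → ℝ} {x : M} (hw : HarmAt w x) (hw' : HarmAt w' x) :
    HarmAt (w + w') x := HarmonicAt.add hw hw'

theorem HarmAt.sub {w w' : M → ℝ} {x : M} (hw : HarmAt w x) (hw' : HarmAt w' x) :
    HarmAt (w - w') x := HarmonicAt.sub hw hw'

theorem HarmAt.zero (x : M) : HarmAt (0 : M → ℝ) x := harmonicAt_const (0 : ℝ)

theorem HarmAt.eventually {w : M → ℝ} {x : M} (hw : HarmAt w x) : ∀ᶠ y in 𝓝 x, HarmAt w y := by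
  have h := HarmonicAt.eventually hw
  filter_upwards [((chartAt ℂ x).continuousAt (mem_chart_source ℂ x)).eventually h,
    (chartAt ℂ x).open_source.mem_nhds (mem_chart_source ℂ x)] with y hy hy'
  exact HarmAt.of_chart hy' hy (mem_chart_source ℂ y)

theorem HarmAt.log_norm_sq {g : M → ℂ} {x : M} (hg : HolFunAt g x) (h0 : g x ≠ 0) :
    HarmAt (fun y => Real.log (‖g y‖ ^ 2)) x := by
  have hx := mem_chart_source ℂ x
  have h1 := AnalyticAt.harmonicAt_log_norm ((holFunAt_iff_analyticAt hx).1 hg)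
    (by simpa using h0)
  have h2 := h1.const_smul (c := (2 : ℝ))
  refine (harmonicAt_congr_nhds ?_).1 h2
  filter_upwards with z
  simp [Real.log_pow]

theorem HarmAt.comp_conformal {T : M → M} (hT : IsConformalInvolution T) {w : M → ℝ} {x : M}
    (hw : HarmAt w (T x)) : HarmAt (w ∘ T) x := by
  have hx := mem_chart_source ℂ x
  have hTx := mem_chart_source ℂ (T x)
  have hpc := tendsto_chart_symm (mem_chart_target ℂ x)
  rw [(chartAt ℂ x).left_inv hx] at hpc
  have hTc := (hT.cont.tendsto x).comp hpc
  have hsrc := hTc.eventually ((chartAt ℂ (T x)).open_source.mem_nhds hTx)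
  refine ⟨?_, ?_⟩
  · have hS := (hT.conformalAt hx hTx).contDiffAt (n := 2)
    have h2 : ContDiffAt ℝ 2 (w ∘ (chartAt ℂ (T x)).symm)
        ((chartAt ℂ (T x) ∘ T ∘ (chartAt ℂ x).symm) (chartAt ℂ x x)) := by
      simpa using hw.1
    refine (h2.comp _ hS).congr_of_eventuallyEq ?_
    filter_upwards [hsrc] with z hz
    exact congrArg w ((chartAt ℂ (T x)).left_inv hz).symm
  · filter_upwards [hTc.eventually hw.eventually, (chartAt ℂ x).open_target.mem_nhds
      (mem_chart_target ℂ x)] with z hz hzt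
    have h3 := laplacian_chart_conformal hT (p := x) (x := (chartAt ℂ x).symm z)
      ((chartAt ℂ x).map_target hzt) (mem_chart_source ℂ _) (w := w) hz.1
    rw [(chartAt ℂ x).right_inv hzt] at h3
    have h4 := hz.2.self_of_nhds
    simp only [Function.comp_apply] at h4
    rw [h4] at h3
    simpa using h3

/-! ### The form of a system of potentials -/

/-- Near `x` the form is given by the single potential `U x`. -/
theorem IsPotential.dens_eventuallyEq {U : M → M → ℝ} (hU : IsPotential U) {p x : M}
    (hx : x ∈ (chartAt ℂ p).source) :
    dens U p =ᶠ[𝓝 (chartAt ℂ p x)] Δ (U x ∘ (chartAt ℂ p).symm) := by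
  have hpc := tendsto_chart_symm ((chartAt ℂ p).map_source hx)
  rw [(chartAt ℂ p).left_inv hx] at hpc
  filter_upwards [hpc.eventually (hU.harm x), hpc.eventually (hU.smooth x),
    (chartAt ℂ p).open_target.mem_nhds ((chartAt ℂ p).map_source hx)] with z hz hz2 hzt
  have hsrc := (chartAt ℂ p).map_target hzt
  have h1 := (hz.chart hsrc).2.self_of_nhds
  have h2 := contDiffAt_comp_chart hsrc hz2
  have h3 := contDiffAt_comp_chart hsrc (hU.smooth ((chartAt ℂ p).symm z)).self_of_nhds
  rw [(chartAt ℂ p).right_inv hzt] at h1 h2 h3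
  have h4 := ContDiffAt.laplacian_sub h2 h3
  have h5 : Δ ((U x - U ((chartAt ℂ p).symm z)) ∘ (chartAt ℂ p).symm) z = 0 := h1
  have h6 : (U x - U ((chartAt ℂ p).symm z)) ∘ (chartAt ℂ p).symm =
    U x ∘ (chartAt ℂ p).symm - U ((chartAt ℂ p).symm z) ∘ (chartAt ℂ p).symm := rfl
  rw [h6, h4] at h5
  rw [dens]
  linarith

theorem IsPotential.continuousOn_dens {U : M → M → ℝ} (hU : IsPotential U) (p : M) :
    ContinuousOn (dens U p) (chartAt ℂ p).target := by
  intro z hz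
  apply ContinuousAt.continuousWithinAt
  have hsrc := (chartAt ℂ p).map_target hz
  have h := hU.dens_eventuallyEq hsrc
  rw [(chartAt ℂ p).right_inv hz] at h
  refine ContinuousAt.congr ?_ h.symm
  have hc := contDiffAt_comp_chart hsrc (hU.smooth _).self_of_nhds
  rw [(chartAt ℂ p).right_inv hz] at hc
  obtain ⟨s, hs, hcs⟩ := hc.contDiffOn (m := 2) le_rfl (by simp)
  obtain ⟨t, hts, ht, hzt⟩ := mem_nhds_iff.1 (by simpa using hs : s ∈ 𝓝 z)
  exact (continuousOn_laplacian ht (hcs.mono hts)).continuousAt (ht.mem_nhds hzt)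

theorem IsPotential.comp_conformal {U : M → M → ℝ} (hU : IsPotential U) {T : M → M}
    (hT : IsConformalInvolution T) : IsPotential (fun x => U (T x) ∘ T) where
  smooth x := by
    filter_upwards [(hT.cont.tendsto x).eventually (hU.smooth (T x))] with y hy
    rw [smAt_iff (mem_chart_source ℂ y)]
    have hTy := mem_chart_source ℂ (T y)
    have h1 := (smAt_iff hTy).1 hy
    have hS := (hT.conformalAt (mem_chart_source ℂ y) hTy).contDiffAt (n := ⊤)
    have h2 : ContDiffAt ℝ ∞ (U (T x) ∘ (chartAt ℂ (T y)).symm)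
        ((chartAt ℂ (T y) ∘ T ∘ (chartAt ℂ y).symm) (chartAt ℂ y y)) := by
      simpa using h1
    refine (h2.comp _ hS).congr_of_eventuallyEq ?_
    have hpc := tendsto_chart_symm (mem_chart_target ℂ y)
    rw [(chartAt ℂ y).left_inv (mem_chart_source ℂ y)] at hpc
    have hTc := (hT.cont.tendsto y).comp hpc
    filter_upwards [hTc.eventually ((chartAt ℂ (T y)).open_source.mem_nhds hTy)] with z hz
    exact congrArg (U (T x)) ((chartAt ℂ (T y)).left_inv hz).symm
  harm x := by
    filter_upwards [(hT.cont.tendsto x).eventually (hU.harm (T x))] with y hy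
    exact HarmAt.comp_conformal hT hy

theorem IsPotential.dens_conformal {U : M → M → ℝ} (hU : IsPotential U) {T : M → M}
    (hT : IsConformalInvolution T) {p q : M} {z : ℂ} (hz : z ∈ (chartAt ℂ p).target)
    (hq : T ((chartAt ℂ p).symm z) ∈ (chartAt ℂ q).source) :
    dens (fun x => U (T x) ∘ T) p z =
      |(fderiv ℝ (chartAt ℂ q ∘ T ∘ (chartAt ℂ p).symm) z).det| *
        dens U q (chartAt ℂ q (T ((chartAt ℂ p).symm z))) := by
  have h := laplacian_chart_conformal hT ((chartAt ℂ p).map_target hz) hq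
    (w := U (T ((chartAt ℂ p).symm z)))
    (contDiffAt_comp_chart hq (hU.smooth _).self_of_nhds)
  rw [(chartAt ℂ p).right_inv hz] at h
  rw [dens, h, dens, (chartAt ℂ q).left_inv hq]

end Potentials

end

/-! ### Integration of potentials -/

noncomputable section

open Laplacian InnerProductSpace MeasureTheory

section Integration

variable {M : Type v} [TopologicalSpace M] [ChartedSpace ℂ M] [IsManifold 𝓘(ℂ) ω M]

/-- Change of variables between charts. -/
theorem setIntegral_chart_conformal {U : M → M → ℝ} (hU : IsPotential U) {T : M → M}
    (hT : IsConformalInvolution T) (p q : M) (χ : M → ℝ)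
    (h1 : ∀ x ∈ (chartAt ℂ p).source, T x ∉ (chartAt ℂ q).source →
      χ x * dens (fun x => U (T x) ∘ T) p (chartAt ℂ p x) = 0)
    (h2 : ∀ x ∈ (chartAt ℂ q).source, T x ∉ (chartAt ℂ p).source →
      χ (T x) * dens U q (chartAt ℂ q x) = 0) :
    ∫ z in (chartAt ℂ p).target, χ ((chartAt ℂ p).symm z) * dens (fun x => U (T x) ∘ T) p z =
      ∫ z in (chartAt ℂ q).target, χ (T ((chartAt ℂ q).symm z)) * dens U q z := by
  set S : ℂ → ℂ := chartAt ℂ q ∘ T ∘ (chartAt ℂ p).symm with hS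
  set O : Set ℂ := (chartAt ℂ p).target ∩ (chartAt ℂ p).symm ⁻¹' (T ⁻¹' (chartAt ℂ q).source)
    with hO
  set O' : Set ℂ := (chartAt ℂ q).target ∩ (chartAt ℂ q).symm ⁻¹' (T ⁻¹' (chartAt ℂ p).source)
    with hO'
  have hOo : IsOpen O := (chartAt ℂ p).isOpen_inter_preimage_symm
    ((chartAt ℂ q).open_source.preimage hT.cont)
  have hOo' : IsOpen O' := (chartAt ℂ q).isOpen_inter_preimage_symm
    ((chartAt ℂ p).open_source.preimage hT.cont)
  have himg : S '' O = O' := by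
    ext w
    constructor
    · rintro ⟨z, ⟨hz, hz'⟩, rfl⟩
      refine ⟨(chartAt ℂ q).map_source hz', ?_⟩
      simp only [hS, Set.mem_preimage, Function.comp_apply]
      rw [(chartAt ℂ q).left_inv hz', hT.invol]
      exact (chartAt ℂ p).map_target hz
    · rintro ⟨hw, hw'⟩
      refine ⟨chartAt ℂ p (T ((chartAt ℂ q).symm w)), ⟨(chartAt ℂ p).map_source hw', ?_⟩, ?_⟩
      · simp only [Set.mem_preimage]
        rw [(chartAt ℂ p).left_inv hw', hT.invol]
        exact (chartAt ℂ q).map_target hw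
      · simp only [hS, Function.comp_apply]
        rw [(chartAt ℂ p).left_inv hw', hT.invol, (chartAt ℂ q).right_inv hw]
  have hinj : Set.InjOn S O := by
    rintro z ⟨hz, hz'⟩ w ⟨hw, hw'⟩ h
    have h3 := (chartAt ℂ q).injOn hz' hw' h
    have h4 := congrArg T h3
    rw [hT.invol, hT.invol] at h4
    exact (chartAt ℂ p).symm.injOn hz hw h4
  have hder : ∀ z ∈ O, HasFDerivWithinAt S (fderiv ℝ S z) O z := by
    rintro z ⟨hz, hz'⟩
    have h := (hT.conformalAt ((chartAt ℂ p).map_target hz) hz').contDiffAt (n := 1)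
    rw [(chartAt ℂ p).right_inv hz] at h
    exact (h.differentiableAt (by simp)).hasFDerivAt.hasFDerivWithinAt
  have hsub : O ⊆ (chartAt ℂ p).target := Set.inter_subset_left
  have hsub' : O' ⊆ (chartAt ℂ q).target := Set.inter_subset_left
  rw [setIntegral_eq_of_subset_of_forall_sdiff_eq_zero (chartAt ℂ p).open_target.measurableSet hsub
      (f := fun z => χ ((chartAt ℂ p).symm z) * dens (fun x => U (T x) ∘ T) p z),
    setIntegral_eq_of_subset_of_forall_sdiff_eq_zero (chartAt ℂ q).open_target.measurableSet hsub'
      (f := fun z => χ (T ((chartAt ℂ q).symm z)) * dens U q z), ← himg,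
    integral_image_eq_integral_abs_det_fderiv_smul volume hOo.measurableSet hder hinj]
  · refine setIntegral_congr_fun hOo.measurableSet ?_
    rintro z ⟨hz, hz'⟩
    simp only [smul_eq_mul]
    rw [hU.dens_conformal hT hz hz', hS]
    simp only [Function.comp_apply]
    rw [(chartAt ℂ q).left_inv hz', hT.invol]
    ring
  · rintro w ⟨hw, hw'⟩
    have h := h2 ((chartAt ℂ q).symm w) ((chartAt ℂ q).map_target hw) (fun h => hw' ⟨hw, h⟩)
    rwa [(chartAt ℂ q).right_inv hw] at h
  · rintro z ⟨hz, hz'⟩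
    have h := h1 ((chartAt ℂ p).symm z) ((chartAt ℂ p).map_target hz) (fun h => hz' ⟨hz, h⟩)
    rwa [(chartAt ℂ p).right_inv hz] at h

variable [CompactSpace M] [T2Space M]

theorem integrableOn_chart {p : M} {χ : M → ℝ} (hχ : Continuous χ)
    (hs : tsupport χ ⊆ (chartAt ℂ p).source) {f : ℂ → ℝ}
    (hf : ContinuousOn f (chartAt ℂ p).target) :
    IntegrableOn (fun z => χ ((chartAt ℂ p).symm z) * f z) (chartAt ℂ p).target := by
  have hK : IsCompact (chartAt ℂ p '' tsupport χ) :=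
    (isClosed_tsupport χ).isCompact.image_of_continuousOn ((chartAt ℂ p).continuousOn.mono hs)
  have hKt : chartAt ℂ p '' tsupport χ ⊆ (chartAt ℂ p).target := by
    rintro _ ⟨x, hx, rfl⟩
    exact (chartAt ℂ p).map_source (hs hx)
  have hcont : ContinuousOn (fun z => χ ((chartAt ℂ p).symm z) * f z) (chartAt ℂ p).target :=
    (hχ.comp_continuousOn (chartAt ℂ p).continuousOn_symm).mul hf
  refine IntegrableOn.of_forall_sdiff_eq_zero ((hcont.mono hKt).integrableOn_compact hK)
    (chartAt ℂ p).open_target.measurableSet ?_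
  rintro z ⟨hz, hz'⟩
  have : χ ((chartAt ℂ p).symm z) = 0 := by
    by_contra h
    exact hz' ⟨_, subset_tsupport _ h, (chartAt ℂ p).right_inv hz⟩
  simp [this]

variable {n m : ℕ} {p : Fin n → M} {ρ : SmoothPartitionOfUnity (Fin n) 𝓘(ℝ, ℂ) M Set.univ}
  {q : Fin m → M} {θ : SmoothPartitionOfUnity (Fin m) 𝓘(ℝ, ℂ) M Set.univ}

theorem partition_sum (θ : SmoothPartitionOfUnity (Fin m) 𝓘(ℝ, ℂ) M Set.univ) (x : M) :
    ∑ j, θ j x = 1 := by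
  rw [← finsum_eq_sum_of_fintype]
  exact θ.sum_eq_one (Set.mem_univ x)

theorem mem_source_of_ne_zero (hθ : θ.IsSubordinate fun i => (chartAt ℂ (q i)).source) {j : Fin m}
    {x : M} (h : θ j x ≠ 0) : x ∈ (chartAt ℂ (q j)).source :=
  hθ j (subset_tsupport _ h)

theorem integrableOn_dens (hρ : ρ.IsSubordinate fun i => (chartAt ℂ (p i)).source) (i : Fin n)
    {U : M → M → ℝ} (hU : IsPotential U) {χ : M → ℝ} (hχ : Continuous χ) :
    IntegrableOn (fun z => ρ i ((chartAt ℂ (p i)).symm z) * χ ((chartAt ℂ (p i)).symm z) *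
      dens U (p i) z) (chartAt ℂ (p i)).target :=
  integrableOn_chart (χ := fun x => ρ i x * χ x) ((ρ i).contMDiff.continuous.mul hχ)
    ((tsupport_mul_subset_left).trans (hρ i)) (hU.continuousOn_dens _)

theorem integrableOn_dens' (hρ : ρ.IsSubordinate fun i => (chartAt ℂ (p i)).source) (i : Fin n)
    {U : M → M → ℝ} (hU : IsPotential U) :
    IntegrableOn (fun z => ρ i ((chartAt ℂ (p i)).symm z) * dens U (p i) z)
      (chartAt ℂ (p i)).target := by
  simpa using integrableOn_dens hρ i hU (χ := fun _ => 1) continuous_const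

/-- The integral does not depend on the partition of unity, and is invariant under conformal
involutions of the surface. -/
theorem potInt_conformal (hρ : ρ.IsSubordinate fun i => (chartAt ℂ (p i)).source)
    (hθ : θ.IsSubordinate fun i => (chartAt ℂ (q i)).source) {U : M → M → ℝ} (hU : IsPotential U)
    {T : M → M} (hT : IsConformalInvolution T) :
    potInt p ρ (fun x => U (T x) ∘ T) = potInt q θ U := by
  have hV := hU.comp_conformal hT
  have e1 : potInt p ρ (fun x => U (T x) ∘ T) = ∑ i, ∑ j, ∫ z in (chartAt ℂ (p i)).target,
      (ρ i ((chartAt ℂ (p i)).symm z) * θ j (T ((chartAt ℂ (p i)).symm z))) *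
        dens (fun x => U (T x) ∘ T) (p i) z := by
    refine Finset.sum_congr rfl fun i _ => ?_
    rw [← integral_finsetSum _ fun j _ => integrableOn_dens hρ i hV
      (χ := fun x => θ j (T x)) ((θ j).contMDiff.continuous.comp hT.cont)]
    refine integral_congr_ae (Filter.Eventually.of_forall fun z => ?_)
    simp only
    rw [← Finset.sum_mul, ← Finset.mul_sum, partition_sum, mul_one]
  have e2 : potInt q θ U = ∑ j, ∑ i, ∫ z in (chartAt ℂ (q j)).target,
      (θ j ((chartAt ℂ (q j)).symm z) * ρ i (T ((chartAt ℂ (q j)).symm z))) *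
        dens U (q j) z := by
    refine Finset.sum_congr rfl fun j _ => ?_
    rw [← integral_finsetSum _ fun i _ => integrableOn_dens hθ j hU
      (χ := fun x => ρ i (T x)) ((ρ i).contMDiff.continuous.comp hT.cont)]
    refine integral_congr_ae (Filter.Eventually.of_forall fun z => ?_)
    simp only
    rw [← Finset.sum_mul, ← Finset.mul_sum, partition_sum, mul_one]
  rw [e1, e2, Finset.sum_comm]
  refine Finset.sum_congr rfl fun j _ => Finset.sum_congr rfl fun i _ => ?_
  rw [setIntegral_chart_conformal hU hT (p i) (q j) (fun x => ρ i x * θ j (T x))]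
  · simp only [hT.invol, mul_comm]
  · intro x _ hx
    have : θ j (T x) = 0 := by
      by_contra h
      exact hx (mem_source_of_ne_zero hθ h)
    simp [this]
  · intro x _ hx
    have : ρ i (T x) = 0 := by
      by_contra h
      exact hx (mem_source_of_ne_zero hρ h)
    simp [this]

/-- The integral does not depend on the charts and the partition of unity. -/
theorem potInt_eq (hρ : ρ.IsSubordinate fun i => (chartAt ℂ (p i)).source)
    (hθ : θ.IsSubordinate fun i => (chartAt ℂ (q i)).source) {U : M → M → ℝ}
    (hU : IsPotential U) : potInt p ρ U = potInt q θ U :=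
  potInt_conformal hρ hθ hU isConformalInvolution_id

theorem IsPotential.add {U V : M → M → ℝ} (hU : IsPotential U) (hV : IsPotential V) :
    IsPotential (U + V) where
  smooth x := by
    filter_upwards [hU.smooth x, hV.smooth x] with y h1 h2 using h1.add h2
  harm x := by
    filter_upwards [hU.harm x, hV.harm x] with y h1 h2
    have := h1.add h2
    simpa [add_sub_add_comm] using this

theorem IsPotential.sub {U V : M → M → ℝ} (hU : IsPotential U) (hV : IsPotential V) :
    IsPotential (U - V) where
  smooth x := by
    filter_upwards [hU.smooth x, hV.smooth x] with y h1 h2 using h1.sub h2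
  harm x := by
    filter_upwards [hU.harm x, hV.harm x] with y h1 h2
    have := h1.sub h2
    simpa [sub_sub_sub_comm] using this

theorem IsPotential.of_smooth {w : M → ℝ} (hw : ContMDiff 𝓘(ℝ, ℂ) 𝓘(ℝ) ∞ w) :
    IsPotential fun _ => w where
  smooth _ := Filter.Eventually.of_forall fun y => hw y
  harm _ := Filter.Eventually.of_forall fun y => by
    rw [sub_self]; exact HarmAt.zero y

theorem IsPotential.dens_sub {U V : M → M → ℝ} (hU : IsPotential U) (hV : IsPotential V) {p : M}
    {z : ℂ} (hz : z ∈ (chartAt ℂ p).target) :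
    dens (U - V) p z = dens U p z - dens V p z := by
  have h1 := contDiffAt_comp_chart ((chartAt ℂ p).map_target hz) (hU.smooth _).self_of_nhds
  have h2 := contDiffAt_comp_chart ((chartAt ℂ p).map_target hz) (hV.smooth _).self_of_nhds
  rw [(chartAt ℂ p).right_inv hz] at h1 h2
  exact ContDiffAt.laplacian_sub h1 h2

theorem potInt_sub (hρ : ρ.IsSubordinate fun i => (chartAt ℂ (p i)).source) {U V : M → M → ℝ}
    (hU : IsPotential U) (hV : IsPotential V) :
    potInt p ρ (U - V) = potInt p ρ U - potInt p ρ V := by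
  rw [potInt, potInt, potInt, ← Finset.sum_sub_distrib]
  refine Finset.sum_congr rfl fun i _ => ?_
  rw [← integral_sub (integrableOn_dens' hρ i hU) (integrableOn_dens' hρ i hV)]
  refine setIntegral_congr_fun (chartAt ℂ (p i)).open_target.measurableSet fun z hz => ?_
  rw [hU.dens_sub hV hz]
  ring

theorem potInt_zero : potInt p ρ (0 : M → M → ℝ) = 0 := by
  refine Finset.sum_eq_zero fun i _ => ?_
  have : ∀ z, dens (0 : M → M → ℝ) (p i) z = 0 := fun z => by
    have : ((0 : M → M → ℝ) ((chartAt ℂ (p i)).symm z) ∘ (chartAt ℂ (p i)).symm) = fun _ => 0 := rfl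
    rw [dens, this, laplacian_const]
    rfl
  simp [this]

theorem potInt_add (hρ : ρ.IsSubordinate fun i => (chartAt ℂ (p i)).source) {U V : M → M → ℝ}
    (hU : IsPotential U) (hV : IsPotential V) :
    potInt p ρ (U + V) = potInt p ρ U + potInt p ρ V := by
  have := potInt_sub hρ (hU.add hV) hV
  rw [add_sub_cancel_right] at this
  linarith

/-- Stokes' theorem for a function supported in one chart. -/
theorem potInt_eq_zero_of_tsupport (hρ : ρ.IsSubordinate fun i => (chartAt ℂ (p i)).source)
    {w : M → ℝ} (hw : ContMDiff 𝓘(ℝ, ℂ) 𝓘(ℝ) ∞ w) {a : M}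
    (ha : tsupport w ⊆ (chartAt ℂ a).source) : potInt p ρ (fun _ => w) = 0 := by
  have hU := IsPotential.of_smooth hw
  have hd0 : ∀ (b x : M), x ∈ (chartAt ℂ b).source → x ∉ tsupport w →
      dens (fun _ => w) b (chartAt ℂ b x) = 0 := by
    intro b x hb hx
    have hpc := tendsto_chart_symm ((chartAt ℂ b).map_source hb)
    rw [(chartAt ℂ b).left_inv hb] at hpc
    have h1 : w ∘ (chartAt ℂ b).symm =ᶠ[𝓝 (chartAt ℂ b x)] fun _ => 0 := by
      filter_upwards [hpc.eventually (((isClosed_tsupport w).isOpen_compl.mem_nhds hx))] with z hz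
      exact image_eq_zero_of_notMem_tsupport (f := w) hz
    have h2 := (laplacian_congr_nhds h1).self_of_nhds
    rw [laplacian_const] at h2
    exact h2
  let K := chartAt ℂ a '' tsupport w
  have hK : IsCompact K :=
    (isClosed_tsupport w).isCompact.image_of_continuousOn ((chartAt ℂ a).continuousOn.mono ha)
  have hKt : K ⊆ (chartAt ℂ a).target := by
    rintro _ ⟨x, hx, rfl⟩
    exact (chartAt ℂ a).map_source (ha hx)
  let f : ℂ → ℝ := (chartAt ℂ a).target.indicator (w ∘ (chartAt ℂ a).symm)
  have hf0 : ∀ z ∉ K, f z = 0 := by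
    intro z hz
    by_cases hzt : z ∈ (chartAt ℂ a).target
    · simp only [f, Set.indicator_of_mem hzt, Function.comp_apply]
      by_contra h
      exact hz ⟨_, subset_tsupport _ h, (chartAt ℂ a).right_inv hzt⟩
    · exact Set.indicator_of_notMem hzt _
  have hfc : HasCompactSupport f := HasCompactSupport.intro hK hf0
  have hft : ∀ z ∈ (chartAt ℂ a).target, f =ᶠ[𝓝 z] w ∘ (chartAt ℂ a).symm := fun z hz => by
    filter_upwards [(chartAt ℂ a).open_target.mem_nhds hz] with y hy
    exact Set.indicator_of_mem hy _
  have hfs : ContDiff ℝ 2 f := by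
    rw [contDiff_iff_contDiffAt]
    intro z
    by_cases hz : z ∈ (chartAt ℂ a).target
    · have h := contDiffAt_comp_chart ((chartAt ℂ a).map_target hz) (hw ((chartAt ℂ a).symm z))
      rw [(chartAt ℂ a).right_inv hz] at h
      exact h.congr_of_eventuallyEq (hft z hz)
    · have : f =ᶠ[𝓝 z] fun _ => 0 := by
        filter_upwards [hK.isClosed.isOpen_compl.mem_nhds fun h => hz (hKt h)] with y hy
        exact hf0 y hy
      exact contDiffAt_const.congr_of_eventuallyEq this
  have hfd : ∀ z ∈ (chartAt ℂ a).target, Δ f z = dens (fun _ => w) a z := fun z hz =>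
    (laplacian_congr_nhds (hft z hz)).self_of_nhds
  have hfd0 : ∀ z ∉ (chartAt ℂ a).target, Δ f z = 0 := fun z hz => by
    have : f =ᶠ[𝓝 z] fun _ => 0 := by
      filter_upwards [hK.isClosed.isOpen_compl.mem_nhds fun h => hz (hKt h)] with y hy
      exact hf0 y hy
    have h2 := (laplacian_congr_nhds this).self_of_nhds
    rw [laplacian_const] at h2
    exact h2
  have hdt : ∫ z in (chartAt ℂ a).target, dens (fun _ => w) a z = 0 := by
    rw [← setIntegral_congr_fun (chartAt ℂ a).open_target.measurableSet hfd,
      setIntegral_eq_integral_of_forall_compl_eq_zero hfd0]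
    exact integral_laplacian_eq_zero hfs hfc
  have hint : ∀ i, IntegrableOn (fun z => ρ i ((chartAt ℂ a).symm z) * dens (fun _ => w) a z)
      (chartAt ℂ a).target := by
    intro i
    have hc : ContinuousOn (fun z => ρ i ((chartAt ℂ a).symm z) * dens (fun _ => w) a z)
        (chartAt ℂ a).target :=
      ((ρ i).contMDiff.continuous.comp_continuousOn (chartAt ℂ a).continuousOn_symm).mul
        (hU.continuousOn_dens a)
    refine IntegrableOn.of_forall_sdiff_eq_zero ((hc.mono hKt).integrableOn_compact hK)
      (chartAt ℂ a).open_target.measurableSet ?_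
    rintro z ⟨hz, hz'⟩
    have h := hd0 a ((chartAt ℂ a).symm z) ((chartAt ℂ a).map_target hz)
      (fun h => hz' ⟨_, h, (chartAt ℂ a).right_inv hz⟩)
    rw [(chartAt ℂ a).right_inv hz] at h
    simp [h]
  calc potInt p ρ (fun _ => w)
      = ∑ i, ∫ z in (chartAt ℂ a).target, ρ i ((chartAt ℂ a).symm z) * dens (fun _ => w) a z := by
        refine Finset.sum_congr rfl fun i _ => ?_
        refine setIntegral_chart_conformal hU isConformalInvolution_id (p i) a (ρ i) ?_ ?_
        · intro x hx hxa
          have := hd0 (p i) x hx (fun h => hxa (ha h))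
          change _ * dens (fun _ => w) (p i) (chartAt ℂ (p i) x) = 0
          rw [this, mul_zero]
        · intro x _ hxp
          have : ρ i (id x) = 0 := by
            by_contra h
            exact hxp (mem_source_of_ne_zero hρ h)
          rw [this, zero_mul]
    _ = ∫ z in (chartAt ℂ a).target, dens (fun _ => w) a z := by
        rw [← integral_finsetSum _ fun i _ => hint i]
        refine integral_congr_ae (Filter.Eventually.of_forall fun z => ?_)
        simp only
        rw [← Finset.sum_mul, partition_sum, one_mul]
    _ = 0 := hdt

/-- Stokes' theorem: the integral of `∂∂̄ w` vanishes for a global smooth function `w`. -/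
theorem potInt_smooth (hρ : ρ.IsSubordinate fun i => (chartAt ℂ (p i)).source)
    {w : M → ℝ} (hw : ContMDiff 𝓘(ℝ, ℂ) 𝓘(ℝ) ∞ w) : potInt p ρ (fun _ => w) = 0 := by
  have hj : ∀ j, ContMDiff 𝓘(ℝ, ℂ) 𝓘(ℝ) ∞ fun x => ρ j x * w x := fun j =>
    (ρ j).contMDiff.mul hw
  have key : ∀ s : Finset (Fin n), IsPotential (fun _ : M => fun x => ∑ j ∈ s, ρ j x * w x) ∧
      potInt p ρ (fun _ : M => fun x => ∑ j ∈ s, ρ j x * w x) = 0 := by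
    intro s
    induction s using Finset.induction_on with
    | empty =>
      simp only [Finset.sum_empty]
      exact ⟨IsPotential.of_smooth contMDiff_const, potInt_zero⟩
    | insert a s has ih =>
      have e : (fun _ : M => fun x => ∑ j ∈ insert a s, ρ j x * w x) =
          (fun _ : M => fun x => ρ a x * w x) + fun _ : M => fun x => ∑ j ∈ s, ρ j x * w x := by
        funext _ x
        simp [Finset.sum_insert has]
      have ha := IsPotential.of_smooth (hj a)
      rw [e]
      refine ⟨ha.add ih.1, ?_⟩
      rw [potInt_add hρ ha ih.1, ih.2, add_zero]
      exact potInt_eq_zero_of_tsupport hρ (hj a) ((tsupport_mul_subset_left).trans (hρ a))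
  have := (key Finset.univ).2
  simpa only [← Finset.sum_mul, partition_sum, one_mul] using this

end Integration

end

/-! ### Ratios that are squared norms of holomorphic functions -/

noncomputable section

open Laplacian InnerProductSpace MeasureTheory

section Ratio

variable {M : Type v} [TopologicalSpace M] [ChartedSpace ℂ M]

/-- `φ` is the squared norm of a holomorphic section, not locally zero, of a line bundle with a
metric whose local weights are the functions `exp (U x)`. -/
def IsRatio (U : M → M → ℝ) (φ : M → ℝ) : Prop :=
  ∀ x, ∃ g : M → ℂ, HolFunAt g x ∧ (∀ᶠ y in 𝓝[≠] x, g y ≠ 0) ∧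
    ∀ᶠ y in 𝓝 x, φ y = ‖g y‖ ^ 2 * Real.exp (U x y)

variable [IsManifold 𝓘(ℂ) ω M]

theorem smAt_log_norm_sq {g : M → ℂ} {x : M} (hg : HolFunAt g x) (h0 : g x ≠ 0) :
    ContMDiffAt 𝓘(ℝ, ℂ) 𝓘(ℝ) ∞ (fun y => Real.log (‖g y‖ ^ 2)) x := by
  have h1 := hg.restrict
  have h2 : ContDiffAt ℝ ∞ (fun z : ℂ => Real.log (‖z‖ ^ 2)) (g x) :=
    ContDiffAt.log ((contDiff_norm_sq ℝ).contDiffAt) (by simpa using h0)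
  exact h2.contMDiffAt.comp x h1

theorem smAt_comp {F : ℝ → ℝ} {w : M → ℝ} {x : M} (hF : ContDiffAt ℝ ∞ F (w x))
    (hw : ContMDiffAt 𝓘(ℝ, ℂ) 𝓘(ℝ) ∞ w x) :
    ContMDiffAt 𝓘(ℝ, ℂ) 𝓘(ℝ) ∞ (fun y => F (w y)) x :=
  hF.contMDiffAt.comp x hw

theorem laplacian_chart_add_harm {a h b : M → ℝ} {p x : M} (hx : x ∈ (chartAt ℂ p).source)
    (hh : HarmAt h x) (hb : ContMDiffAt 𝓘(ℝ, ℂ) 𝓘(ℝ) ∞ b x) (hab : ∀ᶠ y in 𝓝 x, a y = h y + b y) :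
    Δ (a ∘ (chartAt ℂ p).symm) (chartAt ℂ p x) = Δ (b ∘ (chartAt ℂ p).symm) (chartAt ℂ p x) := by
  have hpc := tendsto_chart_symm ((chartAt ℂ p).map_source hx)
  rw [(chartAt ℂ p).left_inv hx] at hpc
  have h1 : a ∘ (chartAt ℂ p).symm =ᶠ[𝓝 (chartAt ℂ p x)]
      (h ∘ (chartAt ℂ p).symm) + (b ∘ (chartAt ℂ p).symm) := hpc.eventually hab
  have h2 := hh.chart hx
  rw [(laplacian_congr_nhds h1).self_of_nhds, ContDiffAt.laplacian_add h2.1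
    (contDiffAt_comp_chart hx hb), h2.2.self_of_nhds]
  simp

theorem laplacian_chart_harm {a h : M → ℝ} {p x : M} (hx : x ∈ (chartAt ℂ p).source)
    (hh : HarmAt h x) (hab : a =ᶠ[𝓝 x] h) :
    Δ (a ∘ (chartAt ℂ p).symm) (chartAt ℂ p x) = 0 := by
  have h := ((hh.congr hab.symm).chart hx).2.self_of_nhds
  exact h

namespace IsRatio

variable {U : M → M → ℝ} {φ : M → ℝ}

theorem log_eventuallyEq {g : M → ℂ} {w : M → ℝ} {x : M} (hg : HolFunAt g x) (h0 : g x ≠ 0)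
    (h : ∀ᶠ y in 𝓝 x, φ y = ‖g y‖ ^ 2 * Real.exp (w y)) :
    ∀ᶠ y in 𝓝 x, Real.log (φ y) = Real.log (‖g y‖ ^ 2) + w y := by
  have hc : ContinuousAt g x := ContMDiffAt.continuousAt hg
  filter_upwards [h, hc.eventually_ne h0] with y hy hy0
  rw [hy, Real.log_mul (by simpa using hy0) (Real.exp_pos _).ne', Real.log_exp]

theorem continuous (hφ : IsRatio U φ) (hU : IsPotential U) : Continuous φ := by
  rw [continuous_iff_continuousAt]
  intro x
  obtain ⟨g, hg, -, h⟩ := hφ x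
  have hc : ContinuousAt g x := ContMDiffAt.continuousAt hg
  have hu : ContinuousAt (U x) x := ContMDiffAt.continuousAt (hU.smooth x).self_of_nhds
  exact ((hc.norm.pow 2).mul (Real.continuous_exp.continuousAt.comp hu)).congr
    (h.mono fun y hy => hy.symm)

theorem nonneg (hφ : IsRatio U φ) (x : M) : 0 ≤ φ x := by
  obtain ⟨g, -, -, h⟩ := hφ x
  rw [h.self_of_nhds]
  positivity

theorem smAt_log (hφ : IsRatio U φ) (hU : IsPotential U) {x : M} (hx : 0 < φ x) :
    ContMDiffAt 𝓘(ℝ, ℂ) 𝓘(ℝ) ∞ (fun y => Real.log (φ y)) x := by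
  obtain ⟨g, hg, -, h⟩ := hφ x
  have h0 : g x ≠ 0 := by
    rintro h0
    rw [h.self_of_nhds, h0] at hx
    simp at hx
  exact ((smAt_log_norm_sq hg h0).add (hU.smooth x).self_of_nhds).congr_of_eventuallyEq
    (log_eventuallyEq hg h0 h)

theorem eventually_pos (hφ : IsRatio U φ) (x : M) : ∀ᶠ y in 𝓝[≠] x, 0 < φ y := by
  obtain ⟨g, -, h0, h⟩ := hφ x
  filter_upwards [h0, h.filter_mono nhdsWithin_le_nhds] with y hy hy'
  rw [hy']
  positivity

theorem dens_eq_log (hφ : IsRatio U φ) (hU : IsPotential U) {p x : M}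
    (hx : x ∈ (chartAt ℂ p).source) (hpos : 0 < φ x) {w : M → ℝ} {C : ℝ}
    (hw : ∀ᶠ y in 𝓝 x, w y = Real.log (φ y) + C) :
    dens (fun _ => w) p (chartAt ℂ p x) = dens U p (chartAt ℂ p x) := by
  obtain ⟨g, hg, -, h⟩ := hφ x
  have h0 : g x ≠ 0 := by
    rintro h0
    rw [h.self_of_nhds, h0] at hpos
    simp at hpos
  have hC : HarmAt (fun _ : M => C) x := harmonicAt_const C
  rw [dens, dens, (chartAt ℂ p).left_inv hx]
  refine laplacian_chart_add_harm (h := (fun y => Real.log (‖g y‖ ^ 2)) + fun _ => C) hx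
    ((HarmAt.log_norm_sq hg h0).add hC) (hU.smooth x).self_of_nhds ?_
  filter_upwards [hw, log_eventuallyEq hg h0 h] with y h1 h2
  rw [h1, h2, Pi.add_apply]
  ring

variable [CompactSpace M] [T2Space M] {n : ℕ} {p : Fin n → M}
  {ρ : SmoothPartitionOfUnity (Fin n) 𝓘(ℝ, ℂ) M Set.univ}

/-- If the section has no zeros, the integral of the curvature vanishes. -/
theorem potInt_eq_zero (hφ : IsRatio U φ) (hU : IsPotential U)
    (hρ : ρ.IsSubordinate fun i => (chartAt ℂ (p i)).source) (hpos : ∀ x, 0 < φ x) :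
    potInt p ρ U = 0 := by
  have hw : ContMDiff 𝓘(ℝ, ℂ) 𝓘(ℝ) ∞ fun y => Real.log (φ y) := fun x =>
    hφ.smAt_log hU (hpos x)
  rw [← potInt_smooth hρ hw]
  refine Finset.sum_congr rfl fun i _ => setIntegral_congr_fun
    (chartAt ℂ (p i)).open_target.measurableSet fun z hz => ?_
  have h := hφ.dens_eq_log hU ((chartAt ℂ (p i)).map_target hz) (hpos _) (C := 0)
    (w := fun y => Real.log (φ y)) (Filter.Eventually.of_forall fun y => by simp)
  rw [(chartAt ℂ (p i)).right_inv hz] at h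
  simp only [h]

/-- The zeros of the section are isolated, and the surface is compact. -/
theorem finite_zeros (hφ : IsRatio U φ) : {x | φ x = 0}.Finite := by
  have h : ∀ x, {y | y = x ∨ 0 < φ y} ∈ 𝓝 x := by
    intro x
    have := hφ.eventually_pos x
    rw [eventually_nhdsWithin_iff] at this
    filter_upwards [this] with y hy
    exact or_iff_not_imp_left.2 hy
  obtain ⟨t, -, ht⟩ := isCompact_univ.elim_nhds_subcover _ fun x _ => h x
  refine t.finite_toSet.subset fun y hy => ?_
  obtain ⟨x, hx, hxy⟩ := Set.mem_iUnion₂.1 (ht (Set.mem_univ y))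
  rcases hxy with rfl | hxy
  · exact hx
  · exact absurd hy hxy.ne'

/-- The case where the metric is flat near the zeros of the section: the integral of the curvature
is then compared with the integral of `∂∂̄ F (log φ)`, which is zero, for a convex
function `F` that is constant near `-∞`. -/
theorem potInt_neg_of_flat (hφ : IsRatio U φ) (hU : IsPotential U)
    (hρ : ρ.IsSubordinate fun i => (chartAt ℂ (p i)).source)
    (hflat : ∀ x, φ x = 0 → ∀ᶠ y in 𝓝 x, U x y = 0) {x₀ : M} (hx₀ : φ x₀ = 0) :
    potInt p ρ U < 0 := by
  have hc := hφ.continuous hU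
  have hball : ∀ x, φ x = 0 → ∃ (g : M → ℂ) (r : ℝ), 0 < r ∧
      Metric.ball (chartAt ℂ x x) r ⊆ (chartAt ℂ x).target ∧
      ∀ z ∈ Metric.ball (chartAt ℂ x x) r, HolFunAt g ((chartAt ℂ x).symm z) ∧
        ((chartAt ℂ x).symm z ≠ x → g ((chartAt ℂ x).symm z) ≠ 0) ∧
        φ ((chartAt ℂ x).symm z) = ‖g ((chartAt ℂ x).symm z)‖ ^ 2 := by
    intro x hx
    obtain ⟨g, hg, hg0, hgφ⟩ := hφ x
    have hpc := tendsto_chart_symm (mem_chart_target ℂ x)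
    rw [(chartAt ℂ x).left_inv (mem_chart_source ℂ x)] at hpc
    rw [eventually_nhdsWithin_iff] at hg0
    have hev : ∀ᶠ z in 𝓝 (chartAt ℂ x x), z ∈ (chartAt ℂ x).target ∧
        HolFunAt g ((chartAt ℂ x).symm z) ∧
        ((chartAt ℂ x).symm z ≠ x → g ((chartAt ℂ x).symm z) ≠ 0) ∧
        φ ((chartAt ℂ x).symm z) = ‖g ((chartAt ℂ x).symm z)‖ ^ 2 := by
      filter_upwards [(chartAt ℂ x).open_target.mem_nhds (mem_chart_target ℂ x),
        hpc.eventually hg.eventually, hpc.eventually hg0, hpc.eventually hgφ,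
        hpc.eventually (hflat x hx)] with z h1 h2 h3 h4 h5
      exact ⟨h1, h2, h3, by rw [h4, h5, Real.exp_zero, mul_one]⟩
    obtain ⟨r, hr, h⟩ := Metric.eventually_nhds_iff_ball.1 hev
    exact ⟨g, r, hr, fun z hz => (h z hz).1, fun z hz => (h z hz).2⟩
  choose! g r hr hrt hgr using hball
  let D : M → Set M := fun x => (chartAt ℂ x).source ∩
    chartAt ℂ x ⁻¹' Metric.ball (chartAt ℂ x x) (r x)
  have hDo : ∀ x, IsOpen (D x) := fun x => (chartAt ℂ x).isOpen_inter_preimage Metric.isOpen_ball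
  have hD : ∀ x, φ x = 0 → ∀ y ∈ D x, HolFunAt (g x) y ∧ (y ≠ x → g x y ≠ 0) ∧
      φ y = ‖g x y‖ ^ 2 := by
    rintro x hx y ⟨hy, hy'⟩
    have := hgr x hx _ hy'
    rwa [(chartAt ℂ x).left_inv hy] at this
  -- a point `y₀` near the zero `x₀`, where `F (log φ)` will be positive
  obtain ⟨z₀, hz₀, hz₀'⟩ : ∃ z₀ ∈ Metric.ball (chartAt ℂ x₀ x₀) (r x₀), z₀ ≠ chartAt ℂ x₀ x₀ := by
    refine ⟨chartAt ℂ x₀ x₀ + ((r x₀ / 2 : ℝ) : ℂ), ?_, ?_⟩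
    · have := hr x₀ hx₀
      simp only [Metric.mem_ball, dist_self_add_left, Complex.norm_real, Real.norm_eq_abs]
      rw [abs_of_pos (by linarith)]
      linarith
    · have := hr x₀ hx₀
      intro h
      rw [add_eq_left, Complex.ofReal_eq_zero] at h
      linarith
  set y₀ := (chartAt ℂ x₀).symm z₀ with hy₀
  have hy₀ne : y₀ ≠ x₀ := by
    intro h
    have h' := congrArg (chartAt ℂ x₀) h
    rw [hy₀, (chartAt ℂ x₀).right_inv (hrt x₀ hx₀ hz₀)] at h'
    exact hz₀' h'
  have hy₀pos : 0 < φ y₀ := by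
    have h := hgr x₀ hx₀ z₀ hz₀
    rw [h.2.2]
    have := h.2.1 hy₀ne
    positivity
  -- a lower bound of `φ` away from its zeros
  let K : Set M := (⋃ x ∈ {x | φ x = 0}, D x)ᶜ
  have hK : IsCompact K := (isOpen_biUnion fun x _ => hDo x).isClosed_compl.isCompact
  have hKpos : ∀ y ∈ K, 0 < φ y := by
    intro y hy
    refine lt_of_le_of_ne (hφ.nonneg y) fun h => hy ?_
    exact Set.mem_biUnion (show y ∈ {x | φ x = 0} from h.symm)
      ⟨mem_chart_source ℂ y, Metric.mem_ball_self (hr y h.symm)⟩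
  obtain ⟨m, hm, hmK⟩ := hK.exists_forall_le' hc.continuousOn hKpos
  -- `F (log φ)` is `log φ` up to a constant on `K`, and `F (log (φ y₀))` is positive
  set a : ℝ := min (Real.log m - 2) (Real.log (φ y₀) - 1) with ha
  have ham : a + 1 < Real.log m := by
    have := min_le_left (Real.log m - 2) (Real.log (φ y₀) - 1)
    linarith
  have hay : a < Real.log (φ y₀) := by
    have := min_le_right (Real.log m - 2) (Real.log (φ y₀) - 1)
    linarith
  obtain ⟨F, hFs, hF0, ⟨C, hFC⟩, hF2, hFpos⟩ := exists_convex_truncation a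
  let w : M → ℝ := fun y => if φ y = 0 then 0 else F (Real.log (φ y))
  have hw0 : ∀ x, φ x = 0 → w =ᶠ[𝓝 x] 0 := by
    intro x hx
    have : ∀ᶠ y in 𝓝 x, φ y < Real.exp a :=
      hc.continuousAt.eventually_lt_const (by rw [hx]; exact Real.exp_pos a)
    filter_upwards [this] with y hy
    by_cases h : φ y = 0
    · simp [w, h]
    · simp only [w, h, if_false, Pi.zero_apply]
      refine hF0 _ ?_
      rw [← Real.log_exp a]
      exact Real.log_le_log (lt_of_le_of_ne (hφ.nonneg y) (Ne.symm h)) hy.le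
  have hwF : ∀ x, 0 < φ x → ∀ᶠ y in 𝓝 x, w y = F (Real.log (φ y)) := by
    intro x hx
    filter_upwards [hc.continuousAt.eventually_ne hx.ne'] with y hy
    simp [w, hy]
  have hpos_or : ∀ x, φ x = 0 ∨ 0 < φ x := fun x => by
    rcases (hφ.nonneg x).eq_or_lt with h | h
    · exact Or.inl h.symm
    · exact Or.inr h
  have hws : ContMDiff 𝓘(ℝ, ℂ) 𝓘(ℝ) ∞ w := by
    intro x
    rcases hpos_or x with hx | hx
    · exact (contMDiffAt_const (c := (0 : ℝ))).congr_of_eventuallyEq (hw0 x hx)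
    · exact (smAt_comp hFs.contDiffAt (hφ.smAt_log hU hx)).congr_of_eventuallyEq (hwF x hx)
  have hW := IsPotential.of_smooth hws
  -- the curvature vanishes on the discs around the zeros
  have hdU : ∀ q x, x ∈ (chartAt ℂ q).source → ∀ x', φ x' = 0 → x ∈ D x' →
      dens U q (chartAt ℂ q x) = 0 := by
    intro q x hx x' hx' hxD
    rw [dens, (chartAt ℂ q).left_inv hx]
    rcases hpos_or x with h0 | h0
    · exact laplacian_chart_harm hx (HarmAt.zero x) (hflat x h0)
    · have hne : x ≠ x' := by rintro rfl; exact h0.ne' hx'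
      obtain ⟨f, hf, -, hfφ⟩ := hφ x
      have hf0 : f x ≠ 0 := by
        rintro h
        rw [hfφ.self_of_nhds, h] at h0
        simp at h0
      have h1 := hD x' hx' x hxD
      refine laplacian_chart_harm hx ((HarmAt.log_norm_sq h1.1 (h1.2.1 hne)).sub
        (HarmAt.log_norm_sq hf hf0)) ?_
      filter_upwards [log_eventuallyEq hf hf0 hfφ, (hDo x').mem_nhds hxD] with y hy hyD
      have := (hD x' hx' y hyD).2.2
      rw [Pi.sub_apply, ← this, hy]
      ring
  -- on `K` the two forms agree; near the zeros `∂∂̄ U = 0`, and `F (log φ)` is subharmonic, being a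
  -- convex function of the harmonic function `log ‖g‖ ^ 2`
  have hle : ∀ q x, x ∈ (chartAt ℂ q).source →
      dens U q (chartAt ℂ q x) ≤ dens (fun _ => w) q (chartAt ℂ q x) := by
    intro q x hx
    by_cases hxK : x ∈ K
    · refine (hφ.dens_eq_log hU hx (hKpos x hxK) (C := C) ?_).ge
      have h1 := (hφ.smAt_log hU (hKpos x hxK)).continuousAt
      have h2 : a + 1 < Real.log (φ x) :=
        ham.trans_le (Real.log_le_log hm (hmK x hxK))
      filter_upwards [hwF x (hKpos x hxK), h1.eventually_const_lt h2] with y hy hy'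
      rw [hy, hFC _ hy'.le]
    · obtain ⟨x', hx', hxD⟩ := Set.mem_iUnion₂.1 (not_not.1 hxK)
      rw [hdU q x hx x' hx' hxD]
      rcases hpos_or x with h0 | h0
      · exact (laplacian_chart_harm (a := w) hx (HarmAt.zero x) (hw0 x h0)).ge
      · have hne : x ≠ x' := by rintro rfl; exact h0.ne' hx'
        have h1 := hD x' hx' x hxD
        have h2 := HarmAt.log_norm_sq h1.1 (h1.2.1 hne)
        have h3 : ∀ᶠ y in 𝓝 x, w y = F (Real.log (‖g x' y‖ ^ 2)) := by
          filter_upwards [hwF x h0, (hDo x').mem_nhds hxD] with y hy hyD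
          rw [hy, (hD x' hx' y hyD).2.2]
        have hpc := tendsto_chart_symm ((chartAt ℂ q).map_source hx)
        rw [(chartAt ℂ q).left_inv hx] at hpc
        have h4 : w ∘ (chartAt ℂ q).symm =ᶠ[𝓝 (chartAt ℂ q x)]
            F ∘ ((fun y => Real.log (‖g x' y‖ ^ 2)) ∘ (chartAt ℂ q).symm) := hpc.eventually h3
        have h5 := (laplacian_congr_nhds h4).self_of_nhds
        have h6 := h2.chart hx
        change 0 ≤ Δ (w ∘ (chartAt ℂ q).symm) (chartAt ℂ q x)
        rw [h5]
        exact laplacian_comp_nonneg (mod_cast (contDiffAt_infty.1 hFs.contDiffAt 2)) h6.1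
          (fun t => hF2 _ t) h6.2.self_of_nhds
  have hint : ∀ i, IntegrableOn (fun z => ρ i ((chartAt ℂ (p i)).symm z) *
      (dens (fun _ => w) (p i) z - dens U (p i) z)) (chartAt ℂ (p i)).target := fun i => by
    refine ((integrableOn_dens' hρ i hW).sub (integrableOn_dens' hρ i hU)).congr
      (Filter.Eventually.of_forall fun z => ?_)
    simp [mul_sub]
  have hnn : ∀ i, ∀ z ∈ (chartAt ℂ (p i)).target, 0 ≤ ρ i ((chartAt ℂ (p i)).symm z) *
      (dens (fun _ => w) (p i) z - dens U (p i) z) := by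
    intro i z hz
    have h := hle (p i) _ ((chartAt ℂ (p i)).map_target hz)
    rw [(chartAt ℂ (p i)).right_inv hz] at h
    exact mul_nonneg (ρ.nonneg i _) (sub_nonneg.2 h)
  have hsum : -potInt p ρ U = ∑ i, ∫ z in (chartAt ℂ (p i)).target,
      ρ i ((chartAt ℂ (p i)).symm z) * (dens (fun _ => w) (p i) z - dens U (p i) z) := by
    have h := potInt_smooth hρ hws
    rw [← zero_sub, ← h, potInt, potInt, ← Finset.sum_sub_distrib]
    refine Finset.sum_congr rfl fun i _ => ?_
    rw [← integral_sub (integrableOn_dens' hρ i hW) (integrableOn_dens' hρ i hU)]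
    simp only [mul_sub]
  have hinn : ∀ i, 0 ≤ ∫ z in (chartAt ℂ (p i)).target, ρ i ((chartAt ℂ (p i)).symm z) *
      (dens (fun _ => w) (p i) z - dens U (p i) z) := fun i =>
    setIntegral_nonneg (chartAt ℂ (p i)).open_target.measurableSet (hnn i)
  have hle0 : 0 ≤ -potInt p ρ U := hsum ▸ Finset.sum_nonneg fun i _ => hinn i
  refine lt_of_le_of_ne (by linarith) fun h0 => ?_
  -- in the case of equality `F (log φ)` is harmonic on the disc around `x₀`; it vanishes near `x₀`,
  -- so it vanishes at `y₀` as well, since harmonic functions are analytic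
  rw [h0, neg_zero, eq_comm, Finset.sum_eq_zero_iff_of_nonneg fun i _ => hinn i] at hsum
  have heq : ∀ i, ∀ x ∈ (chartAt ℂ (p i)).source, ρ i x ≠ 0 →
      dens (fun _ => w) (p i) (chartAt ℂ (p i) x) = dens U (p i) (chartAt ℂ (p i) x) := by
    intro i x hx hρx
    have h1 := (setIntegral_eq_zero_iff_of_nonneg_ae
      ((ae_restrict_iff' (chartAt ℂ (p i)).open_target.measurableSet).2
        (Filter.Eventually.of_forall (hnn i))) (hint i)).1 (hsum i (Finset.mem_univ i))
    have hcont : ContinuousOn (fun z => ρ i ((chartAt ℂ (p i)).symm z) *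
        (dens (fun _ => w) (p i) z - dens U (p i) z)) (chartAt ℂ (p i)).target :=
      ((ρ i).contMDiff.continuous.comp_continuousOn (chartAt ℂ (p i)).continuousOn_symm).mul
        ((hW.continuousOn_dens _).sub (hU.continuousOn_dens _))
    have h2 := Measure.eqOn_open_of_ae_eq h1 (chartAt ℂ (p i)).open_target hcont
      continuousOn_const ((chartAt ℂ (p i)).map_source hx)
    simp only [(chartAt ℂ (p i)).left_inv hx, Pi.zero_apply, mul_eq_zero, hρx, false_or] at h2
    exact sub_eq_zero.1 h2
  have hharm : ∀ z ∈ Metric.ball (chartAt ℂ x₀ x₀) (r x₀),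
      Δ (w ∘ (chartAt ℂ x₀).symm) z = 0 := by
    intro z hz
    have hzt := hrt x₀ hx₀ hz
    set x := (chartAt ℂ x₀).symm z with hx
    have hxs := (chartAt ℂ x₀).map_target hzt
    have hxD : x ∈ D x₀ := ⟨hxs, by
      rw [Set.mem_preimage, hx, (chartAt ℂ x₀).right_inv hzt]; exact hz⟩
    obtain ⟨i, hi⟩ : ∃ i, ρ i x ≠ 0 := by
      by_contra! h
      have := partition_sum ρ x
      simp [h] at this
    have hxi := mem_source_of_ne_zero hρ hi
    have h1 := heq i x hxi hi
    rw [hdU (p i) x hxi x₀ hx₀ hxD] at h1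
    have h2 := laplacian_chart_conformal isConformalInvolution_id hxs
      (show id x ∈ (chartAt ℂ (p i)).source from hxi) (w := w) (contDiffAt_comp_chart hxi (hws x))
    rw [(chartAt ℂ x₀).right_inv hzt] at h2
    have h3 : Δ (w ∘ (chartAt ℂ (p i)).symm) (chartAt ℂ (p i) (id x)) = 0 := h1
    rw [h3, mul_zero] at h2
    exact h2
  have han : AnalyticOnNhd ℝ (w ∘ (chartAt ℂ x₀).symm)
      (Metric.ball (chartAt ℂ x₀ x₀) (r x₀)) := by
    intro z hz
    refine HarmonicAt.analyticAt ⟨?_, ?_⟩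
    · have h := contDiffAt_comp_chart ((chartAt ℂ x₀).map_target (hrt x₀ hx₀ hz))
        (hws ((chartAt ℂ x₀).symm z))
      rwa [(chartAt ℂ x₀).right_inv (hrt x₀ hx₀ hz)] at h
    · filter_upwards [Metric.isOpen_ball.mem_nhds hz] with y hy using hharm y hy
  have hzero : w ∘ (chartAt ℂ x₀).symm =ᶠ[𝓝 (chartAt ℂ x₀ x₀)] 0 := by
    have hpc := tendsto_chart_symm (mem_chart_target ℂ x₀)
    rw [(chartAt ℂ x₀).left_inv (mem_chart_source ℂ x₀)] at hpc
    exact hpc.eventually (hw0 x₀ hx₀)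
  have hfin := han.eqOn_zero_of_preconnected_of_eventuallyEq_zero
    (convex_ball _ _).isPreconnected (Metric.mem_ball_self (hr x₀ hx₀)) hzero hz₀
  have hwy : w y₀ = 0 := hfin
  simp only [w, hy₀pos.ne', if_false] at hwy
  exact (hFpos _ hay).ne' hwy

/-- If the section has a zero, the integral of `∂∂̄ U` is negative. Subtracting a global smooth
function from `U` makes the metric flat near the zeros and does not change the integral. -/
theorem potInt_neg (hφ : IsRatio U φ) (hU : IsPotential U)
    (hρ : ρ.IsSubordinate fun i => (chartAt ℂ (p i)).source) {x₀ : M} (hx₀ : φ x₀ = 0) :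
    potInt p ρ U < 0 := by
  classical
  have : IsManifold 𝓘(ℝ, ℂ) ∞ M := isManifold_real
  have hW : ∀ x, {y | ContMDiffAt 𝓘(ℝ, ℂ) 𝓘(ℝ) ∞ (U x) y ∧ (y = x ∨ 0 < φ y)} ∈ 𝓝 x := by
    intro x
    have := hφ.eventually_pos x
    rw [eventually_nhdsWithin_iff] at this
    filter_upwards [this, hU.smooth x] with y hy hy'
    exact ⟨hy', or_iff_not_imp_left.2 hy⟩
  have hθ : ∀ x, ∃ θ : SmoothBumpFunction 𝓘(ℝ, ℂ) x, tsupport θ ⊆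
      {y | ContMDiffAt 𝓘(ℝ, ℂ) 𝓘(ℝ) ∞ (U x) y ∧ (y = x ∨ 0 < φ y)} := fun x => by
    obtain ⟨θ, -, h⟩ := (SmoothBumpFunction.nhds_basis_tsupport (I := 𝓘(ℝ, ℂ)) x).mem_iff.1 (hW x)
    exact ⟨θ, h⟩
  choose θ hθ using hθ
  let Z := hφ.finite_zeros.toFinset
  -- `η` agrees with `U x` near each zero `x`
  let η : M → ℝ := fun y => ∑ x ∈ Z, θ x y * U x y
  have hη : ContMDiff 𝓘(ℝ, ℂ) 𝓘(ℝ) ∞ η := by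
    refine ContMDiff.sum fun x _ y => ?_
    by_cases hy : y ∈ tsupport (θ x)
    · exact (θ x).contMDiff.contMDiffAt.mul (hθ x hy).1
    · refine (contMDiffAt_const (c := (0 : ℝ))).congr_of_eventuallyEq ?_
      filter_upwards [(isClosed_tsupport _).isOpen_compl.mem_nhds hy] with z hz
      rw [image_eq_zero_of_notMem_tsupport hz, zero_mul]
  have hηU : ∀ x, φ x = 0 → ∀ᶠ y in 𝓝 x, η y = U x y := by
    intro x hx
    have hxZ : x ∈ Z := by simpa [Z] using hx
    have h1 : ∀ᶠ y in 𝓝 x, ∀ x' ∈ Z, x' ≠ x → θ x' y = 0 := by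
      rw [Filter.eventually_all_finset]
      intro x' hx'
      by_cases h : x' = x
      · exact Filter.Eventually.of_forall fun y h' => absurd h h'
      · have hxs : x ∉ tsupport (θ x') := by
          intro hxs
          rcases (hθ x' hxs).2 with h2 | h2
          · exact h h2.symm
          · exact h2.ne' hx
        filter_upwards [(isClosed_tsupport _).isOpen_compl.mem_nhds hxs] with z hz _
        exact image_eq_zero_of_notMem_tsupport hz
    filter_upwards [h1, (θ x).eventuallyEq_one] with y hy hy1
    simp only [η]
    rw [Finset.sum_eq_single_of_mem x hxZ fun x' hx' hne => by rw [hy x' hx' hne, zero_mul], hy1]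
    simp
  have hη' := IsPotential.of_smooth hη
  have hU' := hU.sub hη'
  have hφ' : IsRatio (U - fun _ => η) fun y => φ y * Real.exp (-η y) := by
    intro x
    obtain ⟨g, hg, hg0, h⟩ := hφ x
    refine ⟨g, hg, hg0, h.mono fun y hy => ?_⟩
    simp only [hy, Pi.sub_apply]
    rw [mul_assoc, ← Real.exp_add, sub_eq_add_neg]
  have hmain := hφ'.potInt_neg_of_flat hU' hρ (x₀ := x₀) ?_ (by simp [hx₀])
  · rwa [potInt_sub hρ hU hη', potInt_smooth hρ hη, sub_zero] at hmain
  · intro x hx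
    have hx' : φ x = 0 := by simpa [(Real.exp_pos _).ne'] using hx
    filter_upwards [hηU x hx'] with y hy
    simp [hy]

end IsRatio

end Ratio

end

/-! ### Hermitian metrics and the degree -/

noncomputable section

open Laplacian InnerProductSpace MeasureTheory

theorem contMDiffMul_complex : ContMDiffMul 𝓘(ℝ, ℂ) ∞ ℂ where
  contMDiff_mul := by
    rw [← modelWithCornersSelf_prod, chartedSpaceSelf_prod]
    exact (contDiff_fst.mul contDiff_snd).contMDiff

namespace HolBundle

variable {M : Type v} [TopologicalSpace M] [ChartedSpace ℂ M] {E : HolBundle.{u} M}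

theorem IsFrameNear.holAt {ι : Type*} {b : ∀ y, Module.Basis ι ℂ (E.Fib y)} {x : M}
    (hb : E.IsFrameNear b x) : ∀ᶠ y in 𝓝 x, ∀ i, E.HolAt (fun z => b z i) y := by
  classical
  filter_upwards [hb] with y hy i
  refine (hy _).2 fun j => ?_
  simp only [Module.Basis.repr_self]
  exact HolFunAt.const _ y

/-! ### Gram determinants -/

namespace HermitianMetric

variable (h : E.HermitianMetric)

/-- The Gram determinant of a family of vectors in a fibre. -/
def gram {ι : Type*} [Fintype ι] [DecidableEq ι] {y : M} (v : ι → E.Fib y) : ℝ :=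
  (Matrix.of fun i j => h.form y (v i) (v j)).det.re

theorem gram_eq_mul {ι : Type*} [Fintype ι] [DecidableEq ι] {y : M}
    (b : Module.Basis ι ℂ (E.Fib y)) (v : ι → E.Fib y) :
    h.gram v = ‖(b.toMatrix v).det‖ ^ 2 * h.gram b := by
  set A := b.toMatrix v with hA
  have hv : ∀ j, v j = ∑ i, A i j • b i := fun j => by
    rw [hA]; simp only [Module.Basis.toMatrix_apply]; exact (b.sum_repr (v j)).symm
  have hm : (Matrix.of fun i j => h.form y (v i) (v j)) =
      A.conjTranspose * (Matrix.of fun i j => h.form y (b i) (b j)) * A := by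
    ext i j
    rw [Matrix.of_apply, hv i, hv j]
    simp only [map_sum, LinearMap.map_smulₛₗ, LinearMap.sum_apply, LinearMap.smul_apply,
      Matrix.mul_apply, Matrix.conjTranspose_apply, Matrix.of_apply, smul_eq_mul,
      Finset.sum_mul, Finset.mul_sum, RingHom.id_apply]
    refine Finset.sum_congr rfl fun k _ => Finset.sum_congr rfl fun l _ => ?_
    simp only [starRingEnd_apply]
    ring
  rw [gram, hm, Matrix.det_mul, Matrix.det_mul, Matrix.det_conjTranspose, mul_right_comm]
  have : star A.det * A.det = ((‖A.det‖ ^ 2 : ℝ) : ℂ) := by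
    rw [← starRingEnd_apply, Complex.conj_mul']
    simp
  rw [this, Complex.re_ofReal_mul, gram]

theorem gram_pos {ι : Type*} [Fintype ι] [DecidableEq ι] {y : M}
    (b : Module.Basis ι ℂ (E.Fib y)) : 0 < h.gram b := by
  open scoped ComplexOrder in
  have hp : (Matrix.of fun i j => h.form y (b i) (b j)).PosDef := by
    refine Matrix.PosDef.of_dotProduct_mulVec_pos ?_ ?_
    · ext i j
      rw [Matrix.conjTranspose_apply, Matrix.of_apply, Matrix.of_apply, ← starRingEnd_apply,
        h.conj_symm]
    · intro x hx
      set v := ∑ i, x i • b i with hv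
      have hv0 : v ≠ 0 := by
        intro h0
        apply hx
        have := b.repr_sum_self x
        rw [← hv, h0, map_zero] at this
        rw [← this]
        rfl
      have e : star x ⬝ᵥ ((Matrix.of fun i j => h.form y (b i) (b j)).mulVec x) = h.form y v v := by
        rw [hv]
        simp only [map_sum, LinearMap.map_smulₛₗ, LinearMap.sum_apply, LinearMap.smul_apply,
          dotProduct, Matrix.mulVec, Matrix.of_apply, smul_eq_mul,
          Finset.mul_sum, RingHom.id_apply, Pi.star_apply, starRingEnd_apply]
        rw [Finset.sum_comm]
        refine Finset.sum_congr rfl fun k _ => Finset.sum_congr rfl fun l _ => ?_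
        ring
      rw [e]
      have him : (h.form y v v).im = 0 := by
        rw [← Complex.conj_eq_iff_im]; exact h.conj_symm y v v
      exact Complex.pos_iff.2 ⟨h.pos y v hv0, him.symm⟩
  have h1 := hp.det_pos
  exact (Complex.pos_iff.1 h1).1

theorem gram_reindex {ι κ : Type*} [Fintype ι] [DecidableEq ι] [Fintype κ] [DecidableEq κ] {y : M}
    (e : κ ≃ ι) (v : ι → E.Fib y) : h.gram (v ∘ e) = h.gram v := by
  rw [gram, gram, ← Matrix.det_submatrix_equiv_self e]
  rfl

/-- The local potentials of the Chern form: the logarithms of the Gram determinants. -/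
def pot (x y : M) : ℝ := Real.log (h.gramDet (E.frame x) y)

theorem exp_pot (x y : M) : Real.exp (h.pot x y) = h.gram (E.frame x y) :=
  Real.exp_log (h.gram_pos (E.frame x y))

/-- The Gram determinant of a family of holomorphic sections. -/
theorem exists_gram_eq {ι : Type*} [Fintype ι] [DecidableEq ι] (x : M) (c : ι → ∀ y, E.Fib y)
    (hc : ∀ i, E.HolAt (c i) x) (hcard : Fintype.card ι = E.rk) :
    ∃ g : M → ℂ, HolFunAt g x ∧ (∀ y, g y ≠ 0 ↔ LinearIndependent ℂ fun i => c i y) ∧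
      ∀ y, h.gram (fun i => c i y) = ‖g y‖ ^ 2 * Real.exp (h.pot x y) := by
  let e : Fin E.rk ≃ ι := Fintype.equivOfCardEq (by simpa using hcard.symm)
  let b : ∀ y, Module.Basis ι ℂ (E.Fib y) := fun y => (E.frame x y).reindex e
  have hb : E.IsFrameNear b x := (E.frame_isFrameNear x).reindex e
  refine ⟨fun y => ((b y).toMatrix fun i => c i y).det, HolFunAt.det fun i j => ?_, fun y => ?_,
    fun y => ?_⟩
  · exact (hb.self_of_nhds (c j)).1 (hc j) i
  · change ((b y).toMatrix fun i => c i y).det ≠ 0 ↔ _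
    rw [← isUnit_iff_ne_zero, ← Module.Basis.det_apply, ← Module.Basis.is_basis_iff_det]
    refine ⟨fun h => h.1, fun h => ⟨h, ?_⟩⟩
    have : Module.finrank ℂ (E.Fib y) = Fintype.card ι := (E.finrank_fib y).trans hcard.symm
    exact h.span_eq_top_of_card_eq_finrank' this.symm
  · rw [h.gram_eq_mul (b y), exp_pot, ← h.gram_reindex e.symm]
    congr 2
    funext i
    simp [b]

theorem gram_pos_iff {ι : Type*} [Fintype ι] [DecidableEq ι] {y : M} (v : ι → E.Fib y)
    (hcard : Fintype.card ι = E.rk) : 0 < h.gram v ↔ LinearIndependent ℂ v := by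
  let e : Fin E.rk ≃ ι := Fintype.equivOfCardEq (by simpa using hcard.symm)
  let b : Module.Basis ι ℂ (E.Fib y) := (E.frame y y).reindex e
  have hu : LinearIndependent ℂ v ↔ (b.toMatrix v).det ≠ 0 := by
    rw [← isUnit_iff_ne_zero, ← Module.Basis.det_apply, ← Module.Basis.is_basis_iff_det]
    refine ⟨fun h => ⟨h, ?_⟩, fun h => h.1⟩
    have : Module.finrank ℂ (E.Fib y) = Fintype.card ι := (E.finrank_fib y).trans hcard.symm
    exact h.span_eq_top_of_card_eq_finrank' this.symm
  rw [h.gram_eq_mul b, hu, mul_pos_iff_of_pos_right (h.gram_pos b)]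
  simp [sq_pos_iff]

variable [IsManifold 𝓘(ℂ) ω M]

theorem isPotential : IsPotential h.pot where
  smooth x := by
    have := contMDiffMul_complex
    filter_upwards [(E.frame_isFrameNear x).holAt] with y hy
    have h1 : ∀ i j, ContMDiffAt 𝓘(ℝ, ℂ) 𝓘(ℝ, ℂ) ∞
        (fun z => h.form z (E.frame x z i) (E.frame x z j)) y := fun i j =>
      h.smooth y _ _ (hy i) (hy j)
    have h2 : ContMDiffAt 𝓘(ℝ, ℂ) 𝓘(ℝ, ℂ) ∞
        (fun z => (Matrix.of fun i j => h.form z (E.frame x z i) (E.frame x z j)).det) y := by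
      simp only [Matrix.det_apply', Matrix.of_apply]
      exact ContMDiffAt.sum fun σ _ => contMDiffAt_const.mul
        (ContMDiffAt.prod fun i _ => h1 _ _)
    have h3 : ContDiffAt ℝ ∞ (fun w : ℂ => Real.log w.re)
        ((Matrix.of fun i j => h.form y (E.frame x y i) (E.frame x y j)).det) :=
      ContDiffAt.log Complex.reCLM.contDiff.contDiffAt (h.gram_pos (E.frame x y)).ne'
    have h4 := ContMDiffAt.comp y h3.contMDiffAt h2
    exact h4
  harm x := by
    filter_upwards [(E.frame_isFrameNear x).holAt] with y hy
    obtain ⟨g, hg, hgl, hge⟩ := h.exists_gram_eq y (fun i z => E.frame x z i) hy (by simp)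
    have hg0 : g y ≠ 0 := (hgl y).2 (E.frame x y).linearIndependent
    refine (HarmAt.log_norm_sq hg hg0).congr ?_
    have hc : ContinuousAt g y := ContMDiffAt.continuousAt hg
    filter_upwards [hc.eventually_ne hg0] with z hz
    have h1 := hge z
    rw [← exp_pot] at h1
    have h2 := congrArg Real.log h1
    rw [Real.log_exp, Real.log_mul (by simpa using hz) (Real.exp_pos _).ne', Real.log_exp] at h2
    simp [h2]

theorem chernDensity_eq (p : M) (z : ℂ) :
    h.chernDensity p z = -(1 / (4 * Real.pi)) * dens h.pot p z := rfl

end HermitianMetric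

/-! ### The degree -/

variable [IsManifold 𝓘(ℂ) ω M] [CompactSpace M] [T2Space M]

theorem exists_subordinate : ∃ (n : ℕ) (p : Fin n → M)
    (ρ : SmoothPartitionOfUnity (Fin n) 𝓘(ℝ, ℂ) M Set.univ),
    ρ.IsSubordinate fun i => (chartAt ℂ (p i)).source := by
  have : IsManifold 𝓘(ℝ, ℂ) ∞ M := isManifold_real
  obtain ⟨t, -, ht⟩ := isCompact_univ.elim_nhds_subcover (fun x : M => (chartAt ℂ x).source)
    fun x _ => (chartAt ℂ x).open_source.mem_nhds (mem_chart_source ℂ x)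
  let p : Fin t.card → M := fun i => (t.equivFin.symm i : M)
  obtain ⟨ρ, hρ⟩ := SmoothPartitionOfUnity.exists_isSubordinate 𝓘(ℝ, ℂ) (isClosed_univ (X := M))
    (fun i => (chartAt ℂ (p i)).source) (fun i => (chartAt ℂ (p i)).open_source) (by
      intro x hx
      obtain ⟨y, hy, hxy⟩ := Set.mem_iUnion₂.1 (ht hx)
      refine Set.mem_iUnion.2 ⟨t.equivFin ⟨y, hy⟩, ?_⟩
      simpa [p] using hxy)
  exact ⟨_, p, ρ, hρ⟩

/-- Every holomorphic bundle has a Hermitian metric, glued from local ones. -/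
theorem nonempty_hermitianMetric (E : HolBundle.{u} M) : Nonempty E.HermitianMetric := by
  have := contMDiffMul_complex
  have : IsManifold 𝓘(ℝ, ℂ) ∞ M := isManifold_real
  let W : M → Set M := fun x => {y | ∀ s : ∀ z, E.Fib z, E.HolAt s y ↔
    ∀ i, HolFunAt (fun z => (E.frame x z).repr (s z) i) y}
  obtain ⟨t, -, ht⟩ := isCompact_univ.elim_nhds_subcover (fun x : M => interior (W x))
    fun x _ => interior_mem_nhds.2 (E.frame_isFrameNear x)
  obtain ⟨ρ, hρ⟩ := SmoothPartitionOfUnity.exists_isSubordinate 𝓘(ℝ, ℂ) (isClosed_univ (X := M))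
    (fun i : t => interior (W i)) (fun i => isOpen_interior) (by
      intro x hx
      obtain ⟨y, hy, hxy⟩ := Set.mem_iUnion₂.1 (ht hx)
      exact Set.mem_iUnion.2 ⟨⟨y, hy⟩, hxy⟩)
  have hsum : ∀ x, ∑ i, ρ i x = 1 := fun x => by
    rw [← finsum_eq_sum_of_fintype]; exact ρ.sum_eq_one (Set.mem_univ x)
  let f : ∀ x, E.Fib x → E.Fib x → ℂ := fun x v w => ∑ i, (ρ i x : ℂ) *
    ∑ k, starRingEnd ℂ ((E.frame i x).repr v k) * (E.frame i x).repr w k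
  let F : ∀ x, E.Fib x →ₗ⋆[ℂ] E.Fib x →ₗ[ℂ] ℂ := fun x =>
    LinearMap.mk₂'ₛₗ (starRingEnd ℂ) (RingHom.id ℂ) (f x)
      (fun v v' w => by
        simp only [f, map_add, Finsupp.add_apply, add_mul, Finset.sum_add_distrib, mul_add])
      (fun c v w => by
        simp only [f, map_smul, Finsupp.smul_apply, smul_eq_mul, map_mul, Finset.mul_sum]
        refine Finset.sum_congr rfl fun i _ => Finset.sum_congr rfl fun k _ => ?_
        ring)
      (fun v w w' => by
        simp only [f, map_add, Finsupp.add_apply, Finset.sum_add_distrib, mul_add])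
      (fun c v w => by
        simp only [f, map_smul, Finsupp.smul_apply, smul_eq_mul, RingHom.id_apply, Finset.mul_sum]
        refine Finset.sum_congr rfl fun i _ => Finset.sum_congr rfl fun k _ => ?_
        ring)
  have hF : ∀ x v w, F x v w = f x v w := fun x v w => rfl
  refine ⟨⟨F, ?_, ?_, ?_⟩⟩
  · intro x v w
    simp only [hF, f, map_sum, map_mul, Complex.conj_ofReal, Complex.conj_conj]
    refine Finset.sum_congr rfl fun i _ => ?_
    congr 1
    refine Finset.sum_congr rfl fun k _ => ?_
    ring
  · intro x v hv
    simp only [hF, f, Complex.re_sum, Complex.re_ofReal_mul,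
      Complex.conj_mul']
    have hre : ∀ i k, ((‖(E.frame i x).repr v k‖ : ℂ) ^ 2).re = ‖(E.frame i x).repr v k‖ ^ 2 :=
      fun i k => by rw [← Complex.ofReal_pow, Complex.ofReal_re]
    simp only [hre]
    have hpos : ∀ i : t, 0 < ∑ k, ‖(E.frame i x).repr v k‖ ^ 2 := by
      intro i
      refine lt_of_le_of_ne (Finset.sum_nonneg fun k _ => by positivity) fun h0 => hv ?_
      rw [eq_comm, Finset.sum_eq_zero_iff_of_nonneg fun k _ => by positivity] at h0
      apply (E.frame i x).repr.injective
      ext k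
      simpa using h0 k (Finset.mem_univ k)
    obtain ⟨i, hi⟩ : ∃ i, ρ i x ≠ 0 := by
      by_contra! h
      have := hsum x
      simp [h] at this
    refine Finset.sum_pos' (fun i _ => mul_nonneg (ρ.nonneg i x) (hpos i).le)
      ⟨i, Finset.mem_univ i, mul_pos (lt_of_le_of_ne (ρ.nonneg i x) (Ne.symm hi)) (hpos i)⟩
  · intro x s r hs hr
    simp only [hF, f]
    refine ContMDiffAt.sum fun i _ => ?_
    by_cases hx : x ∈ tsupport (ρ i)
    · have hW : x ∈ W i := interior_subset (hρ i hx)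
      have h1 := (hW s).1 hs
      have h2 := (hW r).1 hr
      have hρc : ContMDiffAt 𝓘(ℝ, ℂ) 𝓘(ℝ, ℂ) ∞ (fun y => (ρ i y : ℂ)) x :=
        (Complex.ofRealCLM.contDiff.contMDiff.contMDiffAt).comp x ((ρ i).contMDiff x)
      refine hρc.mul (ContMDiffAt.sum fun k _ => ContMDiffAt.mul ?_ (h2 k).restrict)
      have hcc : ContDiff ℝ ∞ (starRingEnd ℂ : ℂ → ℂ) := Complex.conjCLE.contDiff
      exact (hcc.contMDiff.contMDiffAt).comp x (h1 k).restrict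
    · refine (contMDiffAt_const (c := (0 : ℂ))).congr_of_eventuallyEq ?_
      filter_upwards [(isClosed_tsupport _).isOpen_compl.mem_nhds hx] with z hz
      rw [image_eq_zero_of_notMem_tsupport hz, Complex.ofReal_zero, zero_mul]

theorem isDegree_iff (E : HolBundle.{u} M) (d : ℝ) : E.IsDegree d ↔
    ∃ (h : E.HermitianMetric) (n : ℕ) (p : Fin n → M)
      (ρ : SmoothPartitionOfUnity (Fin n) 𝓘(ℝ, ℂ) M Set.univ),
      ρ.IsSubordinate (fun i => (chartAt ℂ (p i)).source) ∧
      d = -(1 / (4 * Real.pi)) * potInt p ρ h.pot := by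
  have key : ∀ (h : E.HermitianMetric) (n : ℕ) (p : Fin n → M)
      (ρ : SmoothPartitionOfUnity (Fin n) 𝓘(ℝ, ℂ) M Set.univ),
      (∑ i, ∫ z in (chartAt ℂ (p i)).target,
      ρ i ((chartAt ℂ (p i)).symm z) * h.chernDensity (p i) z) =
      -(1 / (4 * Real.pi)) * potInt p ρ h.pot := by
    intro h n p ρ
    rw [potInt, Finset.mul_sum]
    refine Finset.sum_congr rfl fun i _ => ?_
    rw [← integral_const_mul]
    refine integral_congr_ae (Filter.Eventually.of_forall fun z => ?_)
    simp only [h.chernDensity_eq]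
    ring
  simp only [IsDegree, key]

/-- The ratio of two metrics is a positive function on the surface. -/
theorem potInt_metric_eq (h h' : E.HermitianMetric) {n : ℕ} {p : Fin n → M}
    {ρ : SmoothPartitionOfUnity (Fin n) 𝓘(ℝ, ℂ) M Set.univ}
    (hρ : ρ.IsSubordinate fun i => (chartAt ℂ (p i)).source) :
    potInt p ρ h.pot = potInt p ρ h'.pot := by
  have hU := h.isPotential.sub h'.isPotential
  have hφ : IsRatio (h.pot - h'.pot) fun y => h.gram (E.frame y y) / h'.gram (E.frame y y) := by
    intro x
    refine ⟨fun _ => 1, HolFunAt.const 1 x, Filter.Eventually.of_forall fun _ => one_ne_zero,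
      Filter.Eventually.of_forall fun y => ?_⟩
    have h0 := h'.gram_pos (E.frame x y)
    beta_reduce
    rw [h.gram_eq_mul (E.frame x y), h'.gram_eq_mul (E.frame x y)]
    have hd : ((E.frame x y).toMatrix (E.frame y y)).det ≠ 0 := by
      have : Invertible ((E.frame x y).toMatrix (E.frame y y)) :=
        (E.frame x y).invertibleToMatrix (E.frame y y)
      exact (Matrix.isUnit_det_of_invertible _).ne_zero
    have hd' := norm_ne_zero_iff.2 hd
    simp only [Pi.sub_apply]
    rw [Real.exp_sub, h.exp_pot, h'.exp_pot]
    field_simp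
    simp
  have := hφ.potInt_eq_zero hU hρ fun y => div_pos (h.gram_pos _) (h'.gram_pos _)
  rw [potInt_sub hρ h.isPotential h'.isPotential] at this
  linarith

/-- The degree, computed with any metric and partition of unity. -/
theorem degree_eq (h : E.HermitianMetric) {n : ℕ} {p : Fin n → M}
    {ρ : SmoothPartitionOfUnity (Fin n) 𝓘(ℝ, ℂ) M Set.univ}
    (hρ : ρ.IsSubordinate fun i => (chartAt ℂ (p i)).source) :
    E.degree = -(1 / (4 * Real.pi)) * potInt p ρ h.pot := by
  have hex : ∃ d, E.IsDegree d := ⟨_, (E.isDegree_iff _).2 ⟨h, n, p, ρ, hρ, rfl⟩⟩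
  obtain ⟨h', n', p', ρ', hρ', hd⟩ := (E.isDegree_iff _).1 (Classical.epsilon_spec hex)
  rw [degree, hd, potInt_metric_eq h' h hρ', potInt_eq hρ' hρ h.isPotential]

end HolBundle

end

/-! ### Exact sequences and generically injective homomorphisms -/

noncomputable section

open Laplacian InnerProductSpace MeasureTheory

section LinearAlgebra

variable {V W X : Type*} [AddCommGroup V] [Module ℂ V] [AddCommGroup W] [Module ℂ W]
  [AddCommGroup X] [Module ℂ X] {ι κ : Type*} [Fintype ι] [Fintype κ]

theorem injective_iff_linearIndependent_basis (b : Module.Basis ι ℂ V) (f : V →ₗ[ℂ] W) :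
    Function.Injective f ↔ LinearIndependent ℂ fun i => f (b i) := by
  constructor
  · intro h
    exact b.linearIndependent.map' f (LinearMap.ker_eq_bot.2 h)
  · intro h
    rw [injective_iff_map_eq_zero]
    intro v hv
    rw [← b.sum_repr v, map_sum] at hv
    simp only [map_smul] at hv
    have h1 := Fintype.linearIndependent_iff.1 h _ hv
    apply b.repr.injective
    ext i
    simpa using h1 i

theorem linearIndependent_sum_of_exact {i : V →ₗ[ℂ] W} {p : W →ₗ[ℂ] X}
    (hi : Function.Injective i) (hpi : ∀ v, p (i v) = 0) {a : ι → V}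
    (ha : LinearIndependent ℂ a) {e : κ → W} (he : LinearIndependent ℂ fun j => p (e j)) :
    LinearIndependent ℂ (Sum.elim (fun k => i (a k)) e) := by
  rw [Fintype.linearIndependent_iff]
  intro g hg
  rw [Fintype.sum_sum_type] at hg
  simp only [Sum.elim_inl, Sum.elim_inr] at hg
  have h1 : ∑ j, g (Sum.inr j) • p (e j) = 0 := by
    have := congrArg p hg
    simpa [map_add, map_sum, hpi] using this
  have h2 := Fintype.linearIndependent_iff.1 he _ h1
  simp only [h2, zero_smul, Finset.sum_const_zero, add_zero] at hg
  have h3 : ∑ k, g (Sum.inl k) • a k = 0 := by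
    apply hi
    rw [map_sum, map_zero]
    simpa using hg
  have h4 := Fintype.linearIndependent_iff.1 ha _ h3
  rintro (k | j)
  · exact h4 k
  · exact h2 j

/-- The determinant of a change of basis is multiplicative in short exact sequences. -/
theorem det_toMatrix_of_exact [DecidableEq ι] [DecidableEq κ] {i : V →ₗ[ℂ] W} {p : W →ₗ[ℂ] X}
    (hpi : ∀ v, p (i v) = 0) (a : Module.Basis ι ℂ V) (c : Module.Basis κ ℂ X)
    (b : Module.Basis (ι ⊕ κ) ℂ W) (hb : ∀ k, b (Sum.inl k) = i (a k))
    (hb' : ∀ j, p (b (Sum.inr j)) = c j) (a' : ι → V) (e' : κ → W) :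
    (b.toMatrix (Sum.elim (fun k => i (a' k)) e')).det =
      (a.toMatrix a').det * (c.toMatrix fun j => p (e' j)).det := by
  have h1 : ∀ v, b.repr (i v) =
      b.repr (∑ k, Sum.elim (fun k => a.repr v k) (fun _ => 0) k • b k) := by
    intro v
    congr 1
    have h := congrArg i (a.sum_repr v)
    simp only [map_sum, map_smul] at h
    rw [Fintype.sum_sum_type, ← h]
    simp [hb]
  have h2 : ∀ w j, b.repr w (Sum.inr j) = c.repr (p w) j := by
    intro w j
    have h3 : p w = ∑ j, b.repr w (Sum.inr j) • c j := by
      conv_lhs => rw [← b.sum_repr w]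
      rw [Fintype.sum_sum_type]
      simp [hb, hpi, hb']
    rw [h3, c.repr_sum_self]
  have h4 : b.toMatrix (Sum.elim (fun k => i (a' k)) e') =
      Matrix.fromBlocks (a.toMatrix a') (Matrix.of fun k j => b.repr (e' j) (Sum.inl k)) 0
        (c.toMatrix fun j => p (e' j)) := by
    ext (k | k) (j | j)
    · simp only [Module.Basis.toMatrix_apply, Sum.elim_inl, Matrix.fromBlocks_apply₁₁]
      rw [h1, b.repr_sum_self]
      rfl
    · simp [Module.Basis.toMatrix_apply]
    · simp only [Module.Basis.toMatrix_apply, Sum.elim_inl, Matrix.fromBlocks_apply₂₁]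
      rw [h1, b.repr_sum_self]
      rfl
    · simp [Module.Basis.toMatrix_apply, h2]
  rw [h4, Matrix.det_fromBlocks_zero₂₁]

end LinearAlgebra

namespace HolBundle

variable {M : Type v} [TopologicalSpace M] [ChartedSpace ℂ M]

/-- A homomorphism of holomorphic vector bundles (not necessarily of constant rank). -/
structure Hom (E E' : HolBundle.{u} M) where
  toFun : ∀ x, E.Fib x →ₗ[ℂ] E'.Fib x
  hol : ∀ s x, E.HolAt s x → E'.HolAt (fun y => toFun y (s y)) x

theorem exists_section (E : HolBundle.{u} M) (x : M) (v : E.Fib x) :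
    ∃ s : ∀ y, E.Fib y, (∀ᶠ y in 𝓝 x, E.HolAt s y) ∧ s x = v := by
  refine ⟨fun y => ∑ k, (E.frame x x).repr v k • E.frame x y k, ?_, (E.frame x x).sum_repr v⟩
  filter_upwards [E.frame_isFrameNear x] with y hy
  refine (hy _).2 fun k => ?_
  simp only [Module.Basis.repr_sum_self]
  exact HolFunAt.const _ _

variable [IsManifold 𝓘(ℂ) ω M] [CompactSpace M] [T2Space M]

/-- The ratio of the Gram determinant of the basis of `B` composed of a basis of `A` and lifts of a
basis of `C` to the product of the Gram determinants of the bases of `A` and `C` depends neither on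
the bases nor on the lifts. -/
theorem gram_exact {A B C : HolBundle.{u} M} {y : M} (hA : A.HermitianMetric)
    (hB : B.HermitianMetric) (hC : C.HermitianMetric) {i : A.Fib y →ₗ[ℂ] B.Fib y}
    {p : B.Fib y →ₗ[ℂ] C.Fib y} (hi : Function.Injective i)
    (hpi : ∀ v, p (i v) = 0) (hrk : A.rk + C.rk = B.rk)
    (a a' : Module.Basis (Fin A.rk) ℂ (A.Fib y)) (c c' : Module.Basis (Fin C.rk) ℂ (C.Fib y))
    {e e' : Fin C.rk → B.Fib y} (he : ∀ j, p (e j) = c j) (he' : ∀ j, p (e' j) = c' j) :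
    hB.gram (Sum.elim (fun k => i (a' k)) e') / (hA.gram a' * hC.gram c') =
      hB.gram (Sum.elim (fun k => i (a k)) e) / (hA.gram a * hC.gram c) := by
  have hli := linearIndependent_sum_of_exact hi hpi a.linearIndependent (e := e)
    (by simpa only [he] using c.linearIndependent)
  have hfr : Module.finrank ℂ (B.Fib y) = Fintype.card (Fin A.rk ⊕ Fin C.rk) := by
    rw [B.finrank_fib, Fintype.card_sum, Fintype.card_fin, Fintype.card_fin, hrk]
  let b := basisOr hfr (Sum.elim (fun k => i (a k)) e)
  have hb : ∀ k, b k = Sum.elim (fun k => i (a k)) e k := basisOr_apply hfr hli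
  have hb2 : (b : Fin A.rk ⊕ Fin C.rk → B.Fib y) = Sum.elim (fun k => i (a k)) e := funext hb
  have hdet := det_toMatrix_of_exact hpi a c b (fun k => hb (Sum.inl k))
    (fun j => by rw [hb (Sum.inr j)]; exact he j) a' e'
  simp only [he'] at hdet
  have ha0 : (a.toMatrix a').det ≠ 0 := by
    have : Invertible (a.toMatrix a') := a.invertibleToMatrix a'
    exact (Matrix.isUnit_det_of_invertible _).ne_zero
  have hc0 : (c.toMatrix c').det ≠ 0 := by
    have : Invertible (c.toMatrix c') := c.invertibleToMatrix c'
    exact (Matrix.isUnit_det_of_invertible _).ne_zero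
  rw [hB.gram_eq_mul b, hA.gram_eq_mul a a', hC.gram_eq_mul c c', ← hb2]
  have hdet' : (b.toMatrix (Sum.elim (fun k => i (a' k)) e')).det =
      (a.toMatrix a').det * (c.toMatrix c').det := hdet
  rw [hdet', norm_mul]
  have h1 := norm_ne_zero_iff.2 ha0
  have h2 := norm_ne_zero_iff.2 hc0
  have h3 := hA.gram_pos a
  have h4 := hC.gram_pos c
  field_simp

theorem rk_add_of_exact [Nonempty M] {A B C : HolBundle.{u} M} (i : Hom A B) (p : Hom B C)
    (hi : ∀ x, Function.Injective (i.toFun x)) (hp : ∀ x, Function.Surjective (p.toFun x))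
    (hex : ∀ x, LinearMap.range (i.toFun x) = LinearMap.ker (p.toFun x)) :
    A.rk + C.rk = B.rk := by
  obtain ⟨x⟩ := ‹Nonempty M›
  have h := LinearMap.finrank_range_add_finrank_ker (p.toFun x)
  rw [← hex, LinearMap.finrank_range_of_inj (hi x), LinearMap.range_eq_top.2 (hp x), finrank_top,
    A.finrank_fib, B.finrank_fib, C.finrank_fib] at h
  omega

/-- The degree is additive in short exact sequences. -/
theorem degree_add_of_exact [Nonempty M] {A B C : HolBundle.{u} M} (i : Hom A B) (p : Hom B C)
    (hi : ∀ x, Function.Injective (i.toFun x)) (hp : ∀ x, Function.Surjective (p.toFun x))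
    (hex : ∀ x, LinearMap.range (i.toFun x) = LinearMap.ker (p.toFun x)) :
    B.degree = A.degree + C.degree := by
  have hrk := rk_add_of_exact i p hi hp hex
  have hpi : ∀ x v, p.toFun x (i.toFun x v) = 0 := fun x v => by
    have : i.toFun x v ∈ LinearMap.ker (p.toFun x) := hex x ▸ LinearMap.mem_range_self _ _
    exact this
  obtain ⟨hA⟩ := nonempty_hermitianMetric A
  obtain ⟨hB⟩ := nonempty_hermitianMetric B
  obtain ⟨hC⟩ := nonempty_hermitianMetric C
  obtain ⟨n, q, ρ, hρ⟩ := exists_subordinate (M := M)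
  have hU := (hB.isPotential.sub hA.isPotential).sub hC.isPotential
  choose e he using fun y j => hp y (C.frame y y j)
  -- the squared norm of the isomorphism `det A ⊗ det C ≅ det B`
  have hφpos : ∀ y, 0 < hB.gram (Sum.elim (fun k => i.toFun y (A.frame y y k)) (e y)) /
      (hA.gram (A.frame y y) * hC.gram (C.frame y y)) := by
    intro y
    refine div_pos ?_ (mul_pos (hA.gram_pos _) (hC.gram_pos _))
    rw [hB.gram_pos_iff _ (by simp [hrk])]
    exact linearIndependent_sum_of_exact (hi y) (hpi y) (A.frame y y).linearIndependent
      (by simpa only [he] using (C.frame y y).linearIndependent)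
  have hφ : IsRatio (hB.pot - hA.pot - hC.pot) fun y =>
      hB.gram (Sum.elim (fun k => i.toFun y (A.frame y y k)) (e y)) /
        (hA.gram (A.frame y y) * hC.gram (C.frame y y)) := by
    intro x
    choose s hs hsx using fun j => B.exists_section x (e x j)
    have hcat : ∀ k : Fin A.rk ⊕ Fin C.rk, B.HolAt
        (Sum.elim (fun k y => i.toFun y (A.frame x y k)) s k) x := by
      rintro (k | j)
      · exact i.hol _ _ ((A.frame_isFrameNear x).holAt.self_of_nhds k)
      · exact (hs j).self_of_nhds
    obtain ⟨g, hg, hgl, hge⟩ := hB.exists_gram_eq x _ hcat (by simp [hrk])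
    obtain ⟨f, hf, hfl, hfe⟩ := hC.exists_gram_eq x (fun j y => p.toFun y (s j y))
      (fun j => p.hol _ _ (hs j).self_of_nhds) (by simp)
    have hf0 : f x ≠ 0 := by
      rw [hfl]
      simpa only [hsx, he] using (C.frame x x).linearIndependent
    have hg0 : g x ≠ 0 := by
      rw [hgl]
      have h1 : (fun k : Fin A.rk ⊕ Fin C.rk =>
          Sum.elim (fun k y => i.toFun y (A.frame x y k)) s k x) =
          Sum.elim (fun k => i.toFun x (A.frame x x k)) (e x) := by
        funext k
        rcases k with k | j
        · rfl
        · exact hsx j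
      rw [h1]
      exact linearIndependent_sum_of_exact (hi x) (hpi x) (A.frame x x).linearIndependent
        (by simpa only [he] using (C.frame x x).linearIndependent)
    have hfn : ∀ᶠ y in 𝓝 x, f y ≠ 0 := (ContMDiffAt.continuousAt hf).eventually_ne hf0
    have hgn : ∀ᶠ y in 𝓝 x, g y ≠ 0 := (ContMDiffAt.continuousAt hg).eventually_ne hg0
    refine ⟨fun y => g y * (f y)⁻¹, hg.mul (hf.inv hf0), Filter.Eventually.filter_mono
      nhdsWithin_le_nhds (by
        filter_upwards [hfn, hgn] with y h1 h2 using mul_ne_zero h2 (inv_ne_zero h1)), ?_⟩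
    filter_upwards [hfn] with y hy
    have hli := (hfl y).1 hy
    have hfr : Module.finrank ℂ (C.Fib y) = Fintype.card (Fin C.rk) := by
      rw [C.finrank_fib, Fintype.card_fin]
    let c' := basisOr hfr fun j => p.toFun y (s j y)
    have hc' : ∀ j, c' j = p.toFun y (s j y) := basisOr_apply hfr hli
    have hc2 : (c' : Fin C.rk → C.Fib y) = fun j => p.toFun y (s j y) := funext hc'
    have h1 := gram_exact hA hB hC (hi y) (hpi y) hrk (A.frame x y) (A.frame y y) c' (C.frame y y)
      (e := fun j => s j y) (fun j => (hc' j).symm) (he y)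
    have h2 : (Sum.elim (fun k => i.toFun y (A.frame x y k)) fun j => s j y) =
        fun k => Sum.elim (fun k y => i.toFun y (A.frame x y k)) s k y := by
      funext k
      rcases k with k | j <;> rfl
    rw [h1, h2, hge y, hc2, hfe y, ← hA.exp_pot]
    simp only [Pi.sub_apply, Real.exp_sub, norm_mul, norm_inv]
    field_simp
  have h0 := hφ.potInt_eq_zero hU hρ hφpos
  rw [potInt_sub hρ (hB.isPotential.sub hA.isPotential) hC.isPotential,
    potInt_sub hρ hB.isPotential hA.isPotential] at h0
  rw [degree_eq hA hρ, degree_eq hB hρ, degree_eq hC hρ, ← mul_add]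
  congr 1
  linarith

/-- Homomorphisms between bundles of the same rank that are generically isomorphisms increase the
degree, strictly so unless they are isomorphisms: the determinant is a holomorphic section of a
line bundle whose degree is the difference of the degrees. -/
theorem degree_of_generic_injective {A B : HolBundle.{u} M} (f : Hom A B) (hrk : A.rk = B.rk)
    (hgen : ∀ x, ∀ᶠ y in 𝓝[≠] x, Function.Injective (f.toFun y)) :
    (A.degree < B.degree ∧ ∃ x, ¬ Function.Injective (f.toFun x)) ∨
      (A.degree = B.degree ∧ ∀ x, Function.Injective (f.toFun x)) := by
  obtain ⟨hA⟩ := nonempty_hermitianMetric A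
  obtain ⟨hB⟩ := nonempty_hermitianMetric B
  obtain ⟨n, q, ρ, hρ⟩ := exists_subordinate (M := M)
  have hU := hB.isPotential.sub hA.isPotential
  have hφ0 : ∀ y, 0 < hB.gram (fun k => f.toFun y (A.frame y y k)) / hA.gram (A.frame y y) ↔
      Function.Injective (f.toFun y) := by
    intro y
    rw [div_pos_iff_of_pos_right (hA.gram_pos _), hB.gram_pos_iff _ (by simp [hrk]),
      injective_iff_linearIndependent_basis (A.frame y y)]
  have hφ : IsRatio (hB.pot - hA.pot) fun y =>
      hB.gram (fun k => f.toFun y (A.frame y y k)) / hA.gram (A.frame y y) := by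
    intro x
    obtain ⟨g, hg, hgl, hge⟩ := hB.exists_gram_eq x (fun k y => f.toFun y (A.frame x y k))
      (fun k => f.hol _ _ ((A.frame_isFrameNear x).holAt.self_of_nhds k)) (by simp [hrk])
    refine ⟨g, hg, ?_, Filter.Eventually.of_forall fun y => ?_⟩
    · filter_upwards [hgen x] with y hy
      rw [hgl, ← injective_iff_linearIndependent_basis (A.frame x y)]
      exact hy
    · have hd0 : ((A.frame x y).toMatrix (A.frame y y)).det ≠ 0 := by
        have : Invertible ((A.frame x y).toMatrix (A.frame y y)) :=
          (A.frame x y).invertibleToMatrix _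
        exact (Matrix.isUnit_det_of_invertible _).ne_zero
      have h1 : hB.gram (fun k => f.toFun y (A.frame y y k)) =
          ‖((A.frame x y).toMatrix (A.frame y y)).det‖ ^ 2 *
            hB.gram (fun k => f.toFun y (A.frame x y k)) := by
        let b : Module.Basis (Fin A.rk) ℂ (B.Fib y) := (B.frame y y).reindex (finCongr hrk.symm)
        rw [hB.gram_eq_mul b, hB.gram_eq_mul b fun k => f.toFun y (A.frame x y k)]
        have h2 : b.toMatrix (fun k => f.toFun y (A.frame y y k)) =
            b.toMatrix (fun k => f.toFun y (A.frame x y k)) *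
              (A.frame x y).toMatrix (A.frame y y) := by
          ext k l
          rw [Matrix.mul_apply, Module.Basis.toMatrix_apply]
          conv_lhs => rw [← (A.frame x y).sum_repr (A.frame y y l)]
          simp only [map_sum, map_smul, Finsupp.coe_finsetSum, Finset.sum_apply,
            Finsupp.smul_apply, smul_eq_mul, Module.Basis.toMatrix_apply]
          exact Finset.sum_congr rfl fun _ _ => mul_comm _ _
        rw [h2, Matrix.det_mul, norm_mul]
        ring
      have h3 := hA.gram_eq_mul (A.frame x y) (A.frame y y)
      have h4 := norm_ne_zero_iff.2 hd0
      beta_reduce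
      rw [h1, h3, hge y, ← hA.exp_pot]
      simp only [Pi.sub_apply, Real.exp_sub]
      field_simp
  have hdeg : B.degree - A.degree =
      -(1 / (4 * Real.pi)) * potInt q ρ (hB.pot - hA.pot) := by
    rw [potInt_sub hρ hB.isPotential hA.isPotential, degree_eq hA hρ, degree_eq hB hρ]
    ring
  have hpi : 0 < 1 / (4 * Real.pi) := by positivity
  by_cases h : ∀ x, Function.Injective (f.toFun x)
  · right
    refine ⟨?_, h⟩
    rw [hφ.potInt_eq_zero hU hρ fun x => (hφ0 x).2 (h x)] at hdeg
    linarith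
  · left
    obtain ⟨x, hx⟩ := not_forall.1 h
    refine ⟨?_, x, hx⟩
    have hx0 : hB.gram (fun k => f.toFun x (A.frame x x k)) / hA.gram (A.frame x x) = 0 := by
      rcases (hφ.nonneg x).eq_or_lt with h0 | h0
      · exact h0.symm
      · exact absurd ((hφ0 x).1 h0) hx
    have hneg := hφ.potInt_neg hU hρ hx0
    nlinarith [mul_pos hpi (neg_pos.2 hneg)]

theorem degree_eq_of_bijective [Nonempty M] {A B : HolBundle.{u} M} (f : Hom A B)
    (hf : ∀ x, Function.Bijective (f.toFun x)) : A.rk = B.rk ∧ A.degree = B.degree := by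
  have hrk : A.rk = B.rk := by
    obtain ⟨x⟩ := ‹Nonempty M›
    have := (LinearEquiv.ofBijective (f.toFun x) (hf x)).finrank_eq
    rwa [A.finrank_fib, B.finrank_fib] at this
  refine ⟨hrk, ?_⟩
  rcases degree_of_generic_injective f hrk fun x => Filter.Eventually.of_forall fun y => (hf y).1
    with h | h
  · obtain ⟨-, x, hx⟩ := h
    exact absurd (hf x).1 hx
  · exact h.1

end HolBundle

end

/-! ### Anti-holomorphic maps -/

noncomputable section

open Laplacian InnerProductSpace MeasureTheory

namespace HolBundle

variable {M : Type v} [TopologicalSpace M] [ChartedSpace ℂ M]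

/-- An anti-holomorphic and fibrewise injective antilinear map of bundles that covers `σ`. -/
structure AntiHom (σ : AntiholInvolution M) (A B : HolBundle.{u} M) where
  toFun : ∀ x, A.Fib x →ₗ⋆[ℂ] B.Fib (σ x)
  injective : ∀ x, Function.Injective (toFun x)
  antihol : ∀ (s : ∀ y, A.Fib y) (t : ∀ y, B.Fib y) (x : M), (∀ y, t (σ y) = toFun y (s y)) →
    A.HolAt s x → B.HolAt t (σ x)

theorem AntiHom.exists_section {σ : AntiholInvolution M} {A B : HolBundle.{u} M}
    (c : AntiHom σ A B) (s : ∀ y, A.Fib y) :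
    ∃ t : ∀ y, B.Fib y, ∀ y, t (σ y) = c.toFun y (s y) := by
  refine ⟨fun z => σ.involutive z ▸ c.toFun (σ z) (s (σ z)), fun y => ?_⟩
  have key : ∀ (w : M) (hw : w = y) (h : σ w = σ y),
      (h ▸ c.toFun w (s w) : B.Fib (σ y)) = c.toFun y (s y) := by
    rintro w rfl h; rfl
  exact key (σ (σ y)) (σ.involutive y) _

variable [IsManifold 𝓘(ℂ) ω M]

theorem _root_.HolFunAt.conj_comp (σ : AntiholInvolution M) {g : M → ℂ} {x : M}
    (hg : HolFunAt g (σ x)) : HolFunAt (fun y => starRingEnd ℂ (g (σ y))) x := by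
  have hσ := σ.antihol x
  rw [holFunAt_iff_analyticAt (mem_chart_source ℂ x)] at hσ ⊢
  rw [holFunAt_iff_analyticAt (mem_chart_source ℂ (σ x))] at hg
  have hx : (chartAt ℂ x).symm (chartAt ℂ x x) = x :=
    (chartAt ℂ x).left_inv (mem_chart_source ℂ x)
  set h := (fun y => starRingEnd ℂ (chartAt ℂ (σ x) (σ y))) ∘ (chartAt ℂ x).symm with hh
  have hhx : h (chartAt ℂ x x) = starRingEnd ℂ (chartAt ℂ (σ x) (σ x)) := by simp [hh, hx]
  have h1 : AnalyticAt ℂ (starRingEnd ℂ ∘ (g ∘ (chartAt ℂ (σ x)).symm) ∘ starRingEnd ℂ)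
      (h (chartAt ℂ x x)) := by
    apply AnalyticAt.conj_conj'
    rw [hhx, Complex.conj_conj]
    exact hg
  refine (h1.comp hσ).congr ?_
  have hev : ∀ᶠ y in 𝓝 x, σ y ∈ (chartAt ℂ (σ x)).source :=
    σ.continuous.continuousAt ((chartAt ℂ (σ x)).open_source.mem_nhds (mem_chart_source ℂ _))
  have hc : Filter.Tendsto (chartAt ℂ x).symm (𝓝 (chartAt ℂ x x)) (𝓝 x) := by
    have := (chartAt ℂ x).continuousAt_symm (mem_chart_target ℂ x)
    rwa [ContinuousAt, hx] at this
  filter_upwards [hc.eventually hev] with z hz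
  simp only [hh, Function.comp_apply, Complex.conj_conj]
  rw [(chartAt ℂ (σ x)).left_inv hz]

variable [CompactSpace M] [T2Space M]

/-- An anti-holomorphic isomorphism that covers `σ` preserves the degree, since `σ` reverses the
orientation and complex conjugation changes the sign of the curvature. -/
theorem AntiHom.degree_eq {σ : AntiholInvolution M} {A B : HolBundle.{u} M} (c : AntiHom σ A B)
    (hrk : A.rk = B.rk) : A.degree = B.degree := by
  obtain ⟨hA⟩ := nonempty_hermitianMetric A
  obtain ⟨hB⟩ := nonempty_hermitianMetric B
  obtain ⟨n, q, ρ, hρ⟩ := exists_subordinate (M := M)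
  have hT := σ.isConformalInvolution
  have hB' := hB.isPotential.comp_conformal hT
  have hU := hB'.sub hA.isPotential
  have hφ0 : ∀ y, 0 < hB.gram (fun k => c.toFun y (A.frame y y k)) / hA.gram (A.frame y y) := by
    intro y
    rw [div_pos_iff_of_pos_right (hA.gram_pos _), hB.gram_pos_iff _ (by simp [hrk])]
    rw [Fintype.linearIndependent_iff]
    intro g hg
    have h1 : c.toFun y (∑ k, starRingEnd ℂ (g k) • A.frame y y k) = 0 := by
      simpa [map_sum, LinearMap.map_smulₛₗ] using hg
    have h2 := c.injective y (h1.trans (map_zero _).symm)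
    intro k
    have := Fintype.linearIndependent_iff.1 (A.frame y y).linearIndependent _ h2 k
    simpa using this
  have hφ : IsRatio ((fun x => hB.pot (σ x) ∘ σ) - hA.pot) fun y =>
      hB.gram (fun k => c.toFun y (A.frame y y k)) / hA.gram (A.frame y y) := by
    intro x
    choose t ht using fun k => c.exists_section (fun y => A.frame x y k)
    obtain ⟨g, hg, hgl, hge⟩ := hB.exists_gram_eq (σ x) t
      (fun k => c.antihol _ _ x (ht k) ((A.frame_isFrameNear x).holAt.self_of_nhds k))
      (by simp [hrk])
    have hd0 : ∀ y, ((A.frame x y).toMatrix (A.frame y y)).det ≠ 0 := fun y => by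
      have : Invertible ((A.frame x y).toMatrix (A.frame y y)) :=
        (A.frame x y).invertibleToMatrix _
      exact (Matrix.isUnit_det_of_invertible _).ne_zero
    have hkey : ∀ y, hB.gram (fun k => c.toFun y (A.frame y y k)) / hA.gram (A.frame y y) =
        ‖starRingEnd ℂ (g (σ y))‖ ^ 2 * Real.exp (((fun x => hB.pot (σ x) ∘ σ) - hA.pot) x y) := by
      intro y
      have h1 : hB.gram (fun k => c.toFun y (A.frame y y k)) =
          ‖((A.frame x y).toMatrix (A.frame y y)).det‖ ^ 2 *
            hB.gram (fun k => c.toFun y (A.frame x y k)) := by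
        let b : Module.Basis (Fin A.rk) ℂ (B.Fib (σ y)) :=
          (B.frame (σ y) (σ y)).reindex (finCongr hrk.symm)
        rw [hB.gram_eq_mul b, hB.gram_eq_mul b fun k => c.toFun y (A.frame x y k)]
        have h2 : b.toMatrix (fun k => c.toFun y (A.frame y y k)) =
            b.toMatrix (fun k => c.toFun y (A.frame x y k)) *
              ((A.frame x y).toMatrix (A.frame y y)).map (starRingEnd ℂ) := by
          ext k l
          rw [Matrix.mul_apply, Module.Basis.toMatrix_apply]
          conv_lhs => rw [← (A.frame x y).sum_repr (A.frame y y l)]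
          simp only [map_sum, LinearMap.map_smulₛₗ, map_smul, Finsupp.coe_finsetSum,
            Finset.sum_apply, Finsupp.smul_apply, smul_eq_mul, Module.Basis.toMatrix_apply,
            Matrix.map_apply]
          exact Finset.sum_congr rfl fun _ _ => mul_comm _ _
        have h3 : (((A.frame x y).toMatrix (A.frame y y)).map (starRingEnd ℂ)).det =
            starRingEnd ℂ ((A.frame x y).toMatrix (A.frame y y)).det :=
          (RingHom.map_det (starRingEnd ℂ) _).symm
        rw [h2, Matrix.det_mul, norm_mul, h3, Complex.norm_conj]
        ring
      have h3 := hA.gram_eq_mul (A.frame x y) (A.frame y y)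
      have h4 := norm_ne_zero_iff.2 (hd0 y)
      have h5 := hge (σ y)
      simp only [ht] at h5
      rw [h1, h3, h5, ← hA.exp_pot, Complex.norm_conj]
      simp only [Pi.sub_apply, Real.exp_sub, Function.comp_apply]
      field_simp
    refine ⟨fun y => starRingEnd ℂ (g (σ y)), hg.conj_comp σ, ?_,
      Filter.Eventually.of_forall hkey⟩
    refine Filter.Eventually.of_forall fun y h0 => (hφ0 y).ne' ?_
    beta_reduce at h0
    rw [hkey, h0]
    simp
  have h0 := hφ.potInt_eq_zero hU hρ hφ0
  rw [potInt_sub hρ hB' hA.isPotential, potInt_conformal hρ hρ hB.isPotential hT] at h0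
  rw [HolBundle.degree_eq hA hρ, HolBundle.degree_eq hB hρ]
  congr 1
  linarith

end HolBundle

end

/-! ### Zeros of holomorphic functions and local frames -/

noncomputable section

section RiemannSurface

variable {M : Type v} [TopologicalSpace M] [ChartedSpace ℂ M]

theorem tendsto_chart_nhdsNE (x : M) :
    Filter.Tendsto (chartAt ℂ x) (𝓝[≠] x) (𝓝[≠] (chartAt ℂ x x)) := by
  refine tendsto_nhdsWithin_iff.2 ⟨((chartAt ℂ x).continuousAt (mem_chart_source ℂ x)).mono_left
    nhdsWithin_le_nhds, ?_⟩
  filter_upwards [self_mem_nhdsWithin, nhdsWithin_le_nhds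
    ((chartAt ℂ x).open_source.mem_nhds (mem_chart_source ℂ x))] with y hy hys h
  exact hy ((chartAt ℂ x).injOn hys (mem_chart_source ℂ x) h)

theorem tendsto_chart_symm_nhdsNE (x : M) :
    Filter.Tendsto (chartAt ℂ x).symm (𝓝[≠] (chartAt ℂ x x)) (𝓝[≠] x) := by
  have hx : (chartAt ℂ x).symm (chartAt ℂ x x) = x :=
    (chartAt ℂ x).left_inv (mem_chart_source ℂ x)
  refine tendsto_nhdsWithin_iff.2 ⟨?_, ?_⟩
  · have := (chartAt ℂ x).continuousAt_symm (mem_chart_target ℂ x)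
    rw [ContinuousAt, hx] at this
    exact this.mono_left nhdsWithin_le_nhds
  · filter_upwards [self_mem_nhdsWithin, nhdsWithin_le_nhds
      ((chartAt ℂ x).open_target.mem_nhds (mem_chart_target ℂ x))] with z hz hzt h
    apply hz
    have h2 := (chartAt ℂ x).right_inv hzt
    rw [Set.mem_singleton_iff.1 h] at h2
    exact h2.symm

theorem neBot_nhdsNE (x : M) : (𝓝[≠] x).NeBot := (tendsto_chart_symm_nhdsNE x).neBot

variable [IsManifold 𝓘(ℂ) ω M]

theorem HolFunAt.comp_chart {g : ℂ → ℂ} {x : M} (hg : AnalyticAt ℂ g (chartAt ℂ x x)) :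
    HolFunAt (fun y => g (chartAt ℂ x y)) x := by
  rw [holFunAt_iff_analyticAt (mem_chart_source ℂ x)]
  refine hg.congr ?_
  filter_upwards [(chartAt ℂ x).open_target.mem_nhds (mem_chart_target ℂ x)] with z hz
  simp [hz]

theorem HolFunAt.eventually_eq_comp_chart (f : M → ℂ) (x : M) :
    ∀ᶠ y in 𝓝 x, f y = (f ∘ (chartAt ℂ x).symm) (chartAt ℂ x y) := by
  filter_upwards [(chartAt ℂ x).open_source.mem_nhds (mem_chart_source ℂ x)] with y hy
  simp [hy]

theorem local_coord_ne_zero (x : M) :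
    ∀ᶠ y in 𝓝[≠] x, chartAt ℂ x y - chartAt ℂ x x ≠ 0 := by
  filter_upwards [(tendsto_chart_nhdsNE x).eventually self_mem_nhdsWithin] with y hy
  exact sub_ne_zero.2 hy

/-- A holomorphic function that vanishes at a point is divisible by the local coordinate. -/
theorem HolFunAt.exists_eq_mul {f : M → ℂ} {x : M} (hf : HolFunAt f x) (h0 : f x = 0) :
    ∃ g, HolFunAt g x ∧ ∀ᶠ y in 𝓝 x, f y = (chartAt ℂ x y - chartAt ℂ x x) * g y := by
  have hx : (chartAt ℂ x).symm (chartAt ℂ x x) = x :=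
    (chartAt ℂ x).left_inv (mem_chart_source ℂ x)
  set F := f ∘ (chartAt ℂ x).symm with hF
  obtain ⟨p, hp⟩ := (holFunAt_iff_analyticAt (mem_chart_source ℂ x)).1 hf
  refine ⟨fun y => dslope F (chartAt ℂ x x) (chartAt ℂ x y),
    HolFunAt.comp_chart ⟨_, hp.has_fpower_series_dslope_fslope⟩, ?_⟩
  filter_upwards [HolFunAt.eventually_eq_comp_chart f x] with y hy
  have h := sub_smul_dslope F (chartAt ℂ x x) (chartAt ℂ x y)
  rw [smul_eq_mul] at h
  rw [h, hy]
  simp [hF, hx, h0]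

/-- The order of vanishing of a holomorphic function that is not locally zero. -/
theorem HolFunAt.exists_order {f : M → ℂ} {x : M} (hf : HolFunAt f x)
    (h0 : ∀ᶠ y in 𝓝[≠] x, f y ≠ 0) : ∃ (n : ℕ) (g : M → ℂ), HolFunAt g x ∧ g x ≠ 0 ∧
      ∀ᶠ y in 𝓝 x, f y = (chartAt ℂ x y - chartAt ℂ x x) ^ n * g y := by
  have hF := (holFunAt_iff_analyticAt (mem_chart_source ℂ x)).1 hf
  have hne : ¬ ∀ᶠ z in 𝓝 (chartAt ℂ x x), (f ∘ (chartAt ℂ x).symm) z = 0 := by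
    intro h
    have h1 := (tendsto_chart_symm_nhdsNE x).eventually h0
    have h2 := (h.filter_mono (nhdsWithin_le_nhds (s := {chartAt ℂ x x}ᶜ))).and h1
    have : (𝓝[≠] (chartAt ℂ x x)).NeBot := inferInstance
    obtain ⟨z, h3, h4⟩ := h2.exists
    exact h4 h3
  obtain ⟨n, g, hg, hg0, hn⟩ := hF.exists_eventuallyEq_pow_smul_nonzero_iff.2 hne
  refine ⟨n, _, HolFunAt.comp_chart hg, hg0, ?_⟩
  filter_upwards [HolFunAt.eventually_eq_comp_chart f x,
    ((chartAt ℂ x).continuousAt (mem_chart_source ℂ x)).eventually hn] with y h1 h2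
  rw [h1, h2, smul_eq_mul]

theorem HolFunAt.eq_zero_of_eventually {f : M → ℂ} {x : M} (hf : HolFunAt f x)
    (h0 : ∀ᶠ y in 𝓝[≠] x, f y = 0) : f x = 0 := by
  have := neBot_nhdsNE x
  have h1 : Filter.Tendsto f (𝓝[≠] x) (𝓝 (f x)) :=
    (ContMDiffAt.continuousAt hf).mono_left nhdsWithin_le_nhds
  exact tendsto_nhds_unique h1 (tendsto_const_nhds.congr' (h0.mono fun y hy => hy.symm))

/-- Small discs around `x`, on which the identity theorem holds. -/
theorem exists_disc (x : M) {S : Set M} (hS : S ∈ 𝓝 x) : ∃ D ∈ 𝓝 x, D ⊆ S ∧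
    ∀ f : M → ℂ, (∀ y ∈ D, HolFunAt f y) → (∃ y ∈ D, f y ≠ 0) → ∀ᶠ y in 𝓝[≠] x, f y ≠ 0 := by
  have hx : (chartAt ℂ x).symm (chartAt ℂ x x) = x :=
    (chartAt ℂ x).left_inv (mem_chart_source ℂ x)
  have hc := (chartAt ℂ x).continuousAt_symm (mem_chart_target ℂ x)
  have h1 : (chartAt ℂ x).symm ⁻¹' S ∩ (chartAt ℂ x).target ∈ 𝓝 (chartAt ℂ x x) :=
    Filter.inter_mem (hc (by rwa [hx]))
      ((chartAt ℂ x).open_target.mem_nhds (mem_chart_target ℂ x))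
  obtain ⟨ε, hε, hB⟩ := Metric.mem_nhds_iff.1 h1
  refine ⟨(chartAt ℂ x).source ∩ chartAt ℂ x ⁻¹' Metric.ball (chartAt ℂ x x) ε,
    Filter.inter_mem ((chartAt ℂ x).open_source.mem_nhds (mem_chart_source ℂ x))
      ((chartAt ℂ x).continuousAt (mem_chart_source ℂ x) (Metric.ball_mem_nhds _ hε)), ?_, ?_⟩
  · rintro y ⟨hys, hy⟩
    have := (hB hy).1
    simpa [hys] using this
  · rintro f hf ⟨y₀, ⟨hys, hy⟩, hne⟩
    have hF : AnalyticOnNhd ℂ (f ∘ (chartAt ℂ x).symm) (Metric.ball (chartAt ℂ x x) ε) := by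
      intro z hz
      have hzt := (hB hz).2
      have hzs := (chartAt ℂ x).map_target hzt
      have := (holFunAt_iff_analyticAt hzs).1 (hf _ ⟨hzs, by
        rw [Set.mem_preimage, (chartAt ℂ x).right_inv hzt]; exact hz⟩)
      rwa [(chartAt ℂ x).right_inv hzt] at this
    by_contra hcon
    have hfreq : ∃ᶠ z in 𝓝[≠] (chartAt ℂ x x), (f ∘ (chartAt ℂ x).symm) z = 0 := by
      intro h
      apply hcon
      filter_upwards [(tendsto_chart_nhdsNE x).eventually h,
        nhdsWithin_le_nhds (HolFunAt.eventually_eq_comp_chart f x)] with y h2 h3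
      rw [h3]
      exact h2
    have h4 := hF.eqOn_zero_of_preconnected_of_frequently_eq_zero
      (convex_ball _ _).isPreconnected (Metric.mem_ball_self hε) hfreq hy
    simp only [Function.comp_apply, (chartAt ℂ x).left_inv hys] at h4
    exact hne h4

end RiemannSurface

namespace HolBundle

variable {M : Type v} [TopologicalSpace M] [ChartedSpace ℂ M]

/-- The basis `b` is a holomorphic frame near the point `y`. -/
def IsFrameAt (E : HolBundle.{u} M) {ι : Type*} (b : ∀ y, Module.Basis ι ℂ (E.Fib y)) (y : M) :
    Prop := ∀ s : ∀ z, E.Fib z, E.HolAt s y ↔ ∀ i, HolFunAt (fun z => (b z).repr (s z) i) y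

variable {E : HolBundle.{u} M}

theorem holAt_add {s t : ∀ z, E.Fib z} {x : M} (hs : E.HolAt s x) (ht : E.HolAt t x) :
    E.HolAt (fun y => s y + t y) x := by
  rw [(E.frame_isFrameNear x).self_of_nhds] at *
  intro i
  simpa using (hs i).add (ht i)

theorem holAt_smul {f : M → ℂ} {s : ∀ z, E.Fib z} {x : M} (hf : HolFunAt f x)
    (hs : E.HolAt s x) : E.HolAt (fun y => f y • s y) x := by
  rw [(E.frame_isFrameNear x).self_of_nhds] at *
  intro i
  simpa using hf.mul (hs i)

theorem holAt_zero (x : M) : E.HolAt (fun _ => 0) x := by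
  rw [(E.frame_isFrameNear x).self_of_nhds]
  intro i
  simpa using HolFunAt.const 0 x

theorem holAt_sum {ι : Type*} (S : Finset ι) {s : ι → ∀ z, E.Fib z} {x : M}
    (hs : ∀ i ∈ S, E.HolAt (s i) x) : E.HolAt (fun y => ∑ i ∈ S, s i y) x := by
  classical
  induction S using Finset.induction_on with
  | empty => simpa using holAt_zero x
  | insert a S ha ih =>
    simp only [Finset.sum_insert ha]
    exact holAt_add (hs a (by simp)) (ih fun i hi => hs i (by simp [hi]))

theorem holAt_sub {s t : ∀ z, E.Fib z} {x : M} (hs : E.HolAt s x) (ht : E.HolAt t x) :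
    E.HolAt (fun y => s y - t y) x := by
  simpa [sub_eq_add_neg] using holAt_add hs (holAt_smul (HolFunAt.const (-1) x) ht)

theorem _root_.Module.Basis.equiv_refl_apply_eq_sum {ι V W : Type*} [Fintype ι] [AddCommGroup V]
    [Module ℂ V] [AddCommGroup W] [Module ℂ W] (a : Module.Basis ι ℂ V) (b : Module.Basis ι ℂ W)
    (v : V) : a.equiv b (Equiv.refl ι) v = ∑ i, a.repr v i • b i := by
  have h := congrArg (a.equiv b (Equiv.refl ι)) (a.sum_repr v)
  simp only [map_sum, map_smul, Module.Basis.equiv_apply, Equiv.refl_apply] at h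
  exact h.symm

/-- The frame `b`, transformed by a constant matrix so that it equals `β` at `y₀`. -/
def constFrame {ι κ : Type*} (b : ∀ y, Module.Basis ι ℂ (E.Fib y)) {y₀ : M}
    (β : Module.Basis κ ℂ (E.Fib y₀)) (y : M) : Module.Basis κ ℂ (E.Fib y) :=
  β.map ((b y₀).equiv (b y) (Equiv.refl ι))

theorem constFrame_self {ι κ : Type*} (b : ∀ y, Module.Basis ι ℂ (E.Fib y)) {y₀ : M}
    (β : Module.Basis κ ℂ (E.Fib y₀)) : constFrame b β y₀ = β := by
  have : (b y₀).equiv (b y₀) (Equiv.refl ι) = LinearEquiv.refl ℂ _ := (b y₀).equiv_refl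
  rw [constFrame, this]
  ext i
  simp

theorem constFrame_apply {ι κ : Type*} [Fintype ι] (b : ∀ y, Module.Basis ι ℂ (E.Fib y)) {y₀ : M}
    (β : Module.Basis κ ℂ (E.Fib y₀)) (y : M) (k : κ) :
    constFrame b β y k = ∑ i, (b y₀).repr (β k) i • b y i := by
  rw [constFrame, Module.Basis.map_apply, Module.Basis.equiv_refl_apply_eq_sum]

theorem constFrame_repr {ι κ : Type*} [Fintype ι] (b : ∀ y, Module.Basis ι ℂ (E.Fib y)) {y₀ : M}
    (β : Module.Basis κ ℂ (E.Fib y₀)) (y : M) (v : E.Fib y) (k : κ) :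
    (constFrame b β y).repr v k = ∑ i, (b y).repr v i * β.repr (b y₀ i) k := by
  have h : (constFrame b β y).repr v = β.repr (((b y₀).equiv (b y) (Equiv.refl ι)).symm v) := rfl
  rw [h, Module.Basis.equiv_symm, Equiv.refl_symm, Module.Basis.equiv_refl_apply_eq_sum]
  simp [map_sum, Finsupp.coe_finsetSum]

theorem IsFrameAt.constFrame {ι κ : Type*} [Fintype ι] [Fintype κ]
    {b : ∀ y, Module.Basis ι ℂ (E.Fib y)} {y : M} (hb : E.IsFrameAt b y) {y₀ : M}
    (β : Module.Basis κ ℂ (E.Fib y₀)) : E.IsFrameAt (constFrame b β) y := by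
  intro s
  rw [hb s]
  constructor
  · intro h k
    simp only [constFrame_repr]
    exact HolFunAt.sum _ fun i _ => (h i).mul (HolFunAt.const _ _)
  · intro h i
    have : ∀ z, (b z).repr (s z) i =
        ∑ k, (HolBundle.constFrame b β z).repr (s z) k * (b y₀).repr (β k) i := by
      intro z
      conv_lhs => rw [← (HolBundle.constFrame b β z).sum_repr (s z)]
      simp only [map_sum, map_smul, Finsupp.coe_finsetSum, Finset.sum_apply, Finsupp.smul_apply,
        smul_eq_mul]
      refine Finset.sum_congr rfl fun k _ => ?_
      congr 1
      rw [constFrame_apply, Module.Basis.repr_sum_self]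
    simp only [this]
    exact HolFunAt.sum _ fun k _ => (h k).mul (HolFunAt.const _ _)

theorem IsFrameAt.holAt {ι : Type*} {b : ∀ y, Module.Basis ι ℂ (E.Fib y)} {y : M}
    (hb : E.IsFrameAt b y) (i : ι) : E.HolAt (fun z => b z i) y := by
  classical
  refine (hb _).2 fun j => ?_
  simp only [Module.Basis.repr_self]
  exact HolFunAt.const _ y

/-- Pointwise independent holomorphic sections extend to a local frame. -/
theorem exists_frame_extending {ι : Type*} [Fintype ι] {x : M} {d : ι → ∀ y, E.Fib y}
    (hd : ∀ᶠ y in 𝓝 x, ∀ i, E.HolAt (d i) y) (hli : LinearIndependent ℂ fun i => d i x) :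
    ∃ (m : ℕ) (b : ∀ y, Module.Basis (ι ⊕ Fin m) ℂ (E.Fib y)), E.IsFrameNear b x ∧
      ∀ᶠ y in 𝓝 x, ∀ i, b y (Sum.inl i) = d i y := by
  classical
  have hfin : Finite (ι ⊕ Module.Basis.sumExtendIndex hli) :=
    Module.Finite.finite_basis (Module.Basis.sumExtend hli)
  have hJ : Finite (Module.Basis.sumExtendIndex hli) :=
    Finite.of_injective (Sum.inr : _ → ι ⊕ Module.Basis.sumExtendIndex hli) Sum.inr_injective
  obtain ⟨m, ⟨e⟩⟩ := Finite.exists_equiv_fin (Module.Basis.sumExtendIndex hli)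
  let B : Module.Basis (ι ⊕ Fin m) ℂ (E.Fib x) :=
    (Module.Basis.sumExtend hli).reindex ((Equiv.refl _).sumCongr e)
  have hBl : ∀ i, B (Sum.inl i) = d i x := by
    intro i
    simp [B, Module.Basis.sumExtend]
    rfl
  choose t ht htx using fun j => E.exists_section x (B (Sum.inr j))
  obtain ⟨b, hb, hbd⟩ := exists_frame_of_linearIndependent x (Sum.elim d t)
    (by
      filter_upwards [hd, Filter.eventually_all.2 ht] with y h1 h2
      rintro (i | j)
      · exact h1 i
      · exact h2 j)
    (by
      have : (fun i => Sum.elim d t i x) = B := by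
        funext i
        rcases i with i | j
        · exact (hBl i).symm
        · exact htx j
      rw [this]
      exact B.linearIndependent)
    (by rw [← E.finrank_fib x, Module.finrank_eq_card_basis B])
  exact ⟨m, b, hb, hbd.mono fun y hy i => hy (Sum.inl i)⟩

variable [IsManifold 𝓘(ℂ) ω M]

/-- Membership in the span of pointwise independent holomorphic sections is a closed condition
on holomorphic sections. -/
theorem mem_span_of_eventually {ι : Type*} [Fintype ι] {x : M} {d : ι → ∀ y, E.Fib y}
    (hd : ∀ᶠ y in 𝓝 x, ∀ i, E.HolAt (d i) y) (hli : LinearIndependent ℂ fun i => d i x)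
    {s : ∀ y, E.Fib y} (hs : E.HolAt s x)
    (h : ∀ᶠ y in 𝓝[≠] x, s y ∈ Submodule.span ℂ (Set.range fun i => d i y)) :
    s x ∈ Submodule.span ℂ (Set.range fun i => d i x) := by
  obtain ⟨m, b, hb, hbd⟩ := exists_frame_extending hd hli
  have h0 : ∀ j, (b x).repr (s x) (Sum.inr j) = 0 := by
    intro j
    refine HolFunAt.eq_zero_of_eventually (f := fun z => (b z).repr (s z) (Sum.inr j))
      ((hb.self_of_nhds s).1 hs (Sum.inr j)) ?_
    filter_upwards [h, nhdsWithin_le_nhds hbd] with y hy hby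
    have h1 : Submodule.span ℂ (Set.range fun i => d i y) ≤
        LinearMap.ker ((b y).coord (Sum.inr j)) := by
      rw [Submodule.span_le]
      rintro _ ⟨i, rfl⟩
      simp [← hby]
    simpa using h1 hy
  rw [← (b x).sum_repr (s x), Fintype.sum_sum_type]
  refine Submodule.add_mem _ (Submodule.sum_mem _ fun i _ => Submodule.smul_mem _ _ ?_)
    (Submodule.sum_mem _ fun j _ => by rw [h0, zero_smul]; exact Submodule.zero_mem _)
  rw [hbd.self_of_nhds i]
  exact Submodule.subset_span ⟨i, rfl⟩

/-- A holomorphic section that vanishes at a point is divisible by the local coordinate. -/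
theorem exists_eq_smul {s : ∀ y, E.Fib y} {x : M} (hs : E.HolAt s x) (h0 : s x = 0) :
    ∃ t : ∀ y, E.Fib y, (∀ᶠ y in 𝓝 x, E.HolAt t y) ∧
      ∀ᶠ y in 𝓝 x, s y = (chartAt ℂ x y - chartAt ℂ x x) • t y := by
  have hb := E.frame_isFrameNear x
  choose g hg hgs using fun i => ((hb.self_of_nhds s).1 hs i).exists_eq_mul (by simp [h0])
  refine ⟨fun y => ∑ i, g i y • E.frame x y i, ?_, ?_⟩
  · filter_upwards [hb, Filter.eventually_all.2 fun i => (hg i).eventually] with y hy hgy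
    refine (hy _).2 fun i => ?_
    simp only [Module.Basis.repr_sum_self]
    exact hgy i
  · filter_upwards [Filter.eventually_all.2 hgs] with y hy
    apply (E.frame x y).repr.injective
    ext i
    rw [hy i, map_smul, Finsupp.smul_apply, Module.Basis.repr_sum_self, smul_eq_mul]

end HolBundle

end

/-! ### Saturation -/

noncomputable section

namespace HolBundle

variable {M : Type v} [TopologicalSpace M] [ChartedSpace ℂ M] [IsManifold 𝓘(ℂ) ω M]
  {E : HolBundle.{u} M}

/-- Sections that are generically independent near `x` generically have the same span as sections
that are independent at `x`. As long as there is a relation at `x`, one of the sections can be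
replaced by the relation, divided by the local coordinate, which lowers the order of vanishing
of the determinant. -/
theorem exists_saturation {ι : Type*} [Fintype ι] [DecidableEq ι] {x : M}
    {L : ∀ y, E.Fib y →ₗ[ℂ] (ι → ℂ)}
    (hL : ∀ᶠ y in 𝓝 x, ∀ s, E.HolAt s y → ∀ i, HolFunAt (fun z => L z (s z) i) y)
    (c : ι → ∀ y, E.Fib y) (hc : ∀ᶠ y in 𝓝 x, ∀ i, E.HolAt (c i) y)
    (hne : ∀ᶠ y in 𝓝[≠] x, (Matrix.of fun i j => L y (c j y) i).det ≠ 0) :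
    ∃ d : ι → ∀ y, E.Fib y, (∀ᶠ y in 𝓝 x, ∀ i, E.HolAt (d i) y) ∧
      LinearIndependent ℂ (fun i => d i x) ∧ ∀ᶠ y in 𝓝[≠] x,
        Submodule.span ℂ (Set.range fun i => d i y) =
          Submodule.span ℂ (Set.range fun i => c i y) := by
  -- `n` is the order of vanishing of the determinant
  have key : ∀ (n : ℕ) (c : ι → ∀ y, E.Fib y), (∀ᶠ y in 𝓝 x, ∀ i, E.HolAt (c i) y) →
      (∃ g : M → ℂ, HolFunAt g x ∧ g x ≠ 0 ∧ ∀ᶠ y in 𝓝[≠] x,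
        (Matrix.of fun i j => L y (c j y) i).det = (chartAt ℂ x y - chartAt ℂ x x) ^ n * g y) →
      ∃ d : ι → ∀ y, E.Fib y, (∀ᶠ y in 𝓝 x, ∀ i, E.HolAt (d i) y) ∧
        LinearIndependent ℂ (fun i => d i x) ∧ ∀ᶠ y in 𝓝[≠] x,
          Submodule.span ℂ (Set.range fun i => d i y) =
            Submodule.span ℂ (Set.range fun i => c i y) := by
    intro n
    induction n with
    | zero =>
      rintro c hc ⟨g, hg, hg0, hge⟩
      refine ⟨c, hc, ?_, Filter.Eventually.of_forall fun _ => rfl⟩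
      have hdet : HolFunAt (fun y => (Matrix.of fun i j => L y (c j y) i).det) x :=
        HolFunAt.det fun i j => hL.self_of_nhds _ (hc.self_of_nhds j) i
      have h0 : (Matrix.of fun i j => L x (c j x) i).det = g x := by
        have h1 := (hdet.add ((HolFunAt.const (-1) x).mul hg)).eq_zero_of_eventually
          (hge.mono fun y hy => by rw [hy]; ring)
        linear_combination h1
      rw [Fintype.linearIndependent_iff]
      intro μ hμ
      have h2 : (Matrix.of fun i j => L x (c j x) i).mulVec μ = 0 := by
        funext i
        have := congrFun (congrArg (L x) hμ) i
        simpa [Matrix.mulVec, dotProduct, mul_comm] using this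
      have h3 := Matrix.eq_zero_of_mulVec_eq_zero (by rwa [h0]) h2
      exact congrFun h3
    | succ n ih =>
      rintro c hc ⟨g, hg, hg0, hge⟩
      by_cases hli : LinearIndependent ℂ fun i => c i x
      · exact ⟨c, hc, hli, Filter.Eventually.of_forall fun _ => rfl⟩
      obtain ⟨μ, hμ, k, hk⟩ := Fintype.not_linearIndependent_iff.1 hli
      have hs : E.HolAt (fun y => ∑ i, μ i • c i y) x :=
        holAt_sum _ fun i _ => holAt_smul (HolFunAt.const (μ i) x) (hc.self_of_nhds i)
      obtain ⟨t, ht, hst⟩ := exists_eq_smul hs hμ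
      have hz := local_coord_ne_zero x
      have hc' : ∀ᶠ y in 𝓝 x, ∀ i, E.HolAt (Function.update c k t i) y := by
        filter_upwards [hc, ht] with y h1 h2 i
        rcases eq_or_ne i k with rfl | hi
        · rwa [Function.update_self]
        · rw [Function.update_of_ne hi]
          exact h1 i
      obtain ⟨d, hd, hdli, hdsp⟩ := ih (Function.update c k t) hc' ⟨fun y => μ k * g y,
        (HolFunAt.const _ _).mul hg, mul_ne_zero hk hg0, by
          filter_upwards [hge, hz, nhdsWithin_le_nhds hst] with y h1 h2 h3
          have h4 : (Matrix.of fun i j => L y (Function.update c k t j y) i) =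
              (Matrix.of fun i j => L y (c j y) i).updateCol k (L y (t y)) := by
            ext i j
            rcases eq_or_ne j k with rfl | hj
            · simp
            · simp [hj]
          have h5 : (chartAt ℂ x y - chartAt ℂ x x) • L y (t y) =
              (Matrix.of fun i j => L y (c j y) i).mulVec μ := by
            rw [← map_smul, ← h3]
            funext i
            simp [Matrix.mulVec, dotProduct, mul_comm]
          have h6 : (chartAt ℂ x y - chartAt ℂ x x) *
              ((Matrix.of fun i j => L y (c j y) i).updateCol k (L y (t y))).det =
              μ k * (Matrix.of fun i j => L y (c j y) i).det := by
            have h7 := Matrix.det_updateCol_sum (Matrix.of fun i j => L y (c j y) i) k μ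
            have h8 : (fun i => ∑ j, μ j • (Matrix.of fun i j => L y (c j y) i) i j) =
                (Matrix.of fun i j => L y (c j y) i).mulVec μ := by
              funext i
              simp [Matrix.mulVec, dotProduct, mul_comm]
            rw [← Matrix.det_updateCol_smul, h5, ← h8, h7, smul_eq_mul]
          rw [h4]
          apply mul_left_cancel₀ h2
          rw [h6, h1]
          ring⟩
      refine ⟨d, hd, hdli, ?_⟩
      filter_upwards [hdsp, hz, nhdsWithin_le_nhds hst] with y h1 h2 h3
      rw [h1]
      apply le_antisymm
      · rw [Submodule.span_le]
        rintro _ ⟨i, rfl⟩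
        rcases eq_or_ne i k with rfl | hi
        · have : t y = (chartAt ℂ x y - chartAt ℂ x x)⁻¹ • ∑ i, μ i • c i y := by
            rw [h3, smul_smul, inv_mul_cancel₀ h2, one_smul]
          simp only [Function.update_self, this]
          exact Submodule.smul_mem _ _ (Submodule.sum_mem _ fun j _ => Submodule.smul_mem _ _
            (Submodule.subset_span ⟨j, rfl⟩))
        · simp only [Function.update_of_ne hi]
          exact Submodule.subset_span ⟨i, rfl⟩
      · have hmem : ∀ i, i ≠ k → c i y ∈ Submodule.span ℂ
            (Set.range fun i => Function.update c k t i y) := fun i hi =>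
          Submodule.subset_span ⟨i, by simp [hi]⟩
        have htm : t y ∈ Submodule.span ℂ (Set.range fun i => Function.update c k t i y) :=
          Submodule.subset_span ⟨k, by simp⟩
        rw [Submodule.span_le]
        rintro _ ⟨i, rfl⟩
        rcases eq_or_ne i k with rfl | hi
        · rw [← Finset.add_sum_erase _ _ (Finset.mem_univ i)] at h3
          have : c i y = (μ i)⁻¹ • ((chartAt ℂ x y - chartAt ℂ x x) • t y -
              ∑ j ∈ Finset.univ.erase i, μ j • c j y) := by
            rw [← h3, add_sub_cancel_right, smul_smul, inv_mul_cancel₀ hk, one_smul]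
          beta_reduce
          rw [this]
          exact Submodule.smul_mem _ _ (Submodule.sub_mem _ (Submodule.smul_mem _ _ htm)
            (Submodule.sum_mem _ fun j hj => Submodule.smul_mem _ _
              (hmem j (Finset.ne_of_mem_erase hj))))
        · exact hmem i hi
  have hdet : HolFunAt (fun y => (Matrix.of fun i j => L y (c j y) i).det) x :=
    HolFunAt.det fun i j => hL.self_of_nhds _ (hc.self_of_nhds j) i
  obtain ⟨n, g, hg, hg0, hge⟩ := hdet.exists_order hne
  exact key n c hc ⟨g, hg, hg0, nhdsWithin_le_nhds hge⟩

/-- A family of subspaces is generically a subbundle of rank `r` if near every point `x` it is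
spanned, away from `x`, by holomorphic sections that are independent at `x`. -/
def IsGenericSubbundle (E : HolBundle.{u} M) (V : ∀ y, Submodule ℂ (E.Fib y)) (r : ℕ) : Prop :=
  ∀ x, ∃ d : Fin r → ∀ y, E.Fib y, (∀ᶠ y in 𝓝 x, ∀ i, E.HolAt (d i) y) ∧
    LinearIndependent ℂ (fun i => d i x) ∧ ∀ᶠ y in 𝓝[≠] x,
      V y = Submodule.span ℂ (Set.range fun i => d i y)

theorem eventually_eventually_nhdsNE {X : Type*} [TopologicalSpace X] [T1Space X] {x : X}
    {p : X → Prop} (h : ∀ᶠ y in 𝓝[≠] x, p y) : ∀ᶠ y in 𝓝 x, ∀ᶠ z in 𝓝[≠] y, p z := by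
  rw [eventually_nhdsWithin_iff, ← eventually_eventually_nhds] at h
  filter_upwards [h] with y hy
  rcases eq_or_ne y x with rfl | hne
  · rwa [eventually_nhdsWithin_iff]
  · refine nhdsWithin_le_nhds ?_
    filter_upwards [hy, isOpen_ne.mem_nhds hne] with z h1 h2 using h1 h2

theorem linearIndependent_eventually {ι : Type*} [Fintype ι] {x : M} {d : ι → ∀ y, E.Fib y}
    (hd : ∀ᶠ y in 𝓝 x, ∀ i, E.HolAt (d i) y) (hli : LinearIndependent ℂ fun i => d i x) :
    ∀ᶠ y in 𝓝 x, LinearIndependent ℂ fun i => d i y := by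
  obtain ⟨m, b, hb, hbd⟩ := exists_frame_extending hd hli
  filter_upwards [hbd] with y hy
  simp only [← hy]
  exact (b y).linearIndependent.comp _ Sum.inl_injective

/-- An inclusion of spans of holomorphic sections extends from a punctured neighbourhood to `x`, if
the sections that span the larger space are independent at `x`. -/
theorem span_le_of_eventually {ι κ : Type*} [Fintype ι] [Fintype κ] {x : M}
    {c : κ → ∀ y, E.Fib y} {d : ι → ∀ y, E.Fib y}
    (hc : ∀ᶠ y in 𝓝 x, ∀ i, E.HolAt (c i) y)
    (hd : ∀ᶠ y in 𝓝 x, ∀ i, E.HolAt (d i) y) (hli : LinearIndependent ℂ fun i => d i x)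
    (h : ∀ᶠ y in 𝓝[≠] x, Submodule.span ℂ (Set.range fun i => c i y) ≤
      Submodule.span ℂ (Set.range fun i => d i y)) :
    Submodule.span ℂ (Set.range fun i => c i x) ≤ Submodule.span ℂ (Set.range fun i => d i x) := by
  rw [Submodule.span_le]
  rintro _ ⟨i, rfl⟩
  exact mem_span_of_eventually hd hli (hc.self_of_nhds i)
    (h.mono fun y hy => hy (Submodule.subset_span ⟨i, rfl⟩))

variable [T2Space M]

/-- A generic subbundle extends to a subbundle. -/
theorem IsGenericSubbundle.exists_subbundle {V : ∀ y, Submodule ℂ (E.Fib y)} {r : ℕ}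
    (hV : E.IsGenericSubbundle V r) : ∃ S : E.Subbundle, S.rk = r ∧
      ∀ x, ∀ᶠ y in 𝓝[≠] x, S.carrier y = V y := by
  choose d hd hli hsp using hV
  have hloc : ∀ x, ∀ᶠ y in 𝓝 x, Submodule.span ℂ (Set.range fun i => d y i y) =
      Submodule.span ℂ (Set.range fun i => d x i y) := by
    intro x
    filter_upwards [eventually_eventually_nhdsNE (hsp x), eventually_eventually_nhds.2 (hd x),
      linearIndependent_eventually (hd x) (hli x)] with y h1 h2 h3
    apply le_antisymm
    · refine span_le_of_eventually (hd y) h2 h3 ?_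
      filter_upwards [h1, hsp y] with z h4 h5
      rw [← h4, h5]
    · refine span_le_of_eventually h2 (hd y) (hli y) ?_
      filter_upwards [h1, hsp y] with z h4 h5
      rw [← h4, h5]
  refine ⟨⟨fun x => Submodule.span ℂ (Set.range fun i => d x i x), r, fun x => ⟨d x, ?_⟩⟩, rfl,
    fun x => ?_⟩
  · filter_upwards [hd x, linearIndependent_eventually (hd x) (hli x), hloc x] with y h1 h2 h3
    exact ⟨h1, h2, h3⟩
  · filter_upwards [hsp x, nhdsWithin_le_nhds (hloc x)] with y h1 h2
    rw [h1]
    exact h2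

namespace Subbundle

variable (F : E.Subbundle)

/-- A holomorphic section with values in a subbundle away from `x` has its value at `x` in it. -/
theorem mem_of_eventually {x : M} {s : ∀ y, E.Fib y} (hs : E.HolAt s x)
    (h : ∀ᶠ y in 𝓝[≠] x, s y ∈ F.carrier y) : s x ∈ F.carrier x := by
  obtain ⟨c, hc⟩ := F.exists_sections x
  have h1 := hc.self_of_nhds
  rw [h1.2.2]
  refine mem_span_of_eventually (hc.mono fun y hy => hy.1) h1.2.1 hs ?_
  filter_upwards [h, nhdsWithin_le_nhds hc] with y h2 h3
  rwa [← h3.2.2]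

theorem exists_section_mem {x : M} {v : E.Fib x} (hv : v ∈ F.carrier x) :
    ∃ s : ∀ y, E.Fib y, s x = v ∧ ∀ᶠ y in 𝓝 x, E.HolAt s y ∧ s y ∈ F.carrier y := by
  obtain ⟨c, hc⟩ := F.exists_sections x
  rw [hc.self_of_nhds.2.2, Submodule.mem_span_range_iff_exists_fun] at hv
  obtain ⟨μ, rfl⟩ := hv
  refine ⟨fun y => ∑ i, μ i • c i y, rfl, ?_⟩
  filter_upwards [hc] with y hy
  refine ⟨holAt_sum _ fun i _ => holAt_smul (HolFunAt.const _ _) (hy.1 i), ?_⟩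
  rw [hy.2.2]
  exact Submodule.sum_mem _ fun i _ => Submodule.smul_mem _ _ (Submodule.subset_span ⟨i, rfl⟩)

end Subbundle

end HolBundle

end

/-! ### Kernels and images of homomorphisms -/

noncomputable section

/-- Bases of the source and the target of a linear map in which it is a coordinate projection. -/
theorem LinearMap.exists_adapted_bases {V W : Type*} [AddCommGroup V] [Module ℂ V]
    [AddCommGroup W] [Module ℂ W] [FiniteDimensional ℂ V] [FiniteDimensional ℂ W]
    (f : V →ₗ[ℂ] W) : ∃ (r k m : ℕ) (a : Module.Basis (Fin r ⊕ Fin k) ℂ V)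
      (b : Module.Basis (Fin r ⊕ Fin m) ℂ W), Module.finrank ℂ (LinearMap.range f) = r ∧
      Module.finrank ℂ (LinearMap.ker f) = k ∧ ∀ i, f (a (Sum.inl i)) = b (Sum.inl i) := by
  obtain ⟨C, hC⟩ := (LinearMap.ker f).exists_isCompl
  obtain ⟨D, hD⟩ := (LinearMap.range f).exists_isCompl
  let e : C ≃ₗ[ℂ] LinearMap.range f := (Submodule.quotientEquivOfIsCompl _ C hC).symm.trans
    f.quotKerEquivRange
  have he : ∀ v : C, (e v : W) = f v := fun v => by
    simp [e]
  let β := Module.finBasis ℂ (LinearMap.range f)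
  let a := ((β.map e.symm).prod (Module.finBasis ℂ (LinearMap.ker f))).map
    (Submodule.prodEquivOfIsCompl C _ hC.symm)
  let b := (β.prod (Module.finBasis ℂ D)).map (Submodule.prodEquivOfIsCompl _ D hD)
  refine ⟨_, _, _, a, b, rfl, rfl, fun i => ?_⟩
  have h1 : a (Sum.inl i) = (e.symm (β i) : V) := by
    simp [a]
  have h2 : b (Sum.inl i) = (β i : W) := by
    simp [b]
  rw [h1, h2, ← he, LinearEquiv.apply_symm_apply]

namespace HolBundle

variable {M : Type v} [TopologicalSpace M] [ChartedSpace ℂ M] [IsManifold 𝓘(ℂ) ω M]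
  {G H : HolBundle.{u} M}

/-- Away from `x`, a homomorphism has constant rank near `x`, and its kernel and image are spanned
by holomorphic sections that are independent at `x`. -/
theorem Hom.exists_local_kernel_image (f : Hom G H) (x : M) : ∃ r k : ℕ,
    (∃ d : Fin r → ∀ y, H.Fib y, (∀ᶠ y in 𝓝 x, ∀ i, H.HolAt (d i) y) ∧
      LinearIndependent ℂ (fun i => d i x) ∧ ∀ᶠ y in 𝓝[≠] x,
        LinearMap.range (f.toFun y) = Submodule.span ℂ (Set.range fun i => d i y)) ∧
    (∃ d : Fin k → ∀ y, G.Fib y, (∀ᶠ y in 𝓝 x, ∀ i, G.HolAt (d i) y) ∧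
      LinearIndependent ℂ (fun i => d i x) ∧ ∀ᶠ y in 𝓝[≠] x,
        LinearMap.ker (f.toFun y) = Submodule.span ℂ (Set.range fun i => d i y)) ∧
    r + k = G.rk ∧ ∀ᶠ y in 𝓝[≠] x, Module.finrank ℂ (LinearMap.range (f.toFun y)) = r := by
  obtain ⟨D, hDx, hDS, hD⟩ := exists_disc x
    (Filter.inter_mem (G.frame_isFrameNear x) (H.frame_isFrameNear x))
  have hrk : ∀ y, Module.finrank ℂ (LinearMap.range (f.toFun y)) +
      Module.finrank ℂ (LinearMap.ker (f.toFun y)) = G.rk := fun y => by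
    rw [LinearMap.finrank_range_add_finrank_ker, G.finrank_fib]
  -- a point of the disc at which the rank is maximal
  obtain ⟨y₀, hy₀, hmax⟩ : ∃ y₀ ∈ D, ∀ y ∈ D, Module.finrank ℂ (LinearMap.range (f.toFun y)) ≤
      Module.finrank ℂ (LinearMap.range (f.toFun y₀)) := by
    let S : Set ℕ := (fun y => Module.finrank ℂ (LinearMap.range (f.toFun y))) '' D
    have hS : BddAbove S := ⟨G.rk, by
      rintro _ ⟨y, -, rfl⟩
      have := hrk y
      beta_reduce
      omega⟩
    obtain ⟨y₀, h1, h2⟩ := Nat.sSup_mem (⟨_, x, mem_of_mem_nhds hDx, rfl⟩ : S.Nonempty) hS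
    refine ⟨y₀, h1, fun y hy => ?_⟩
    have := le_csSup hS ⟨y, hy, rfl⟩
    rwa [← h2] at this
  obtain ⟨r, k, m, α, β, hr, hk, hαβ⟩ := (f.toFun y₀).exists_adapted_bases
  have hrk₀ := hrk y₀
  rw [hr, hk] at hrk₀
  rw [hr] at hmax
  let a := constFrame (G.frame x) α
  let b := constFrame (H.frame x) β
  have ha : ∀ y ∈ D, G.IsFrameAt a y := fun y hy => IsFrameAt.constFrame (hDS hy).1 α
  have hb : ∀ y ∈ D, H.IsFrameAt b y := fun y hy => IsFrameAt.constFrame (hDS hy).2 β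
  let L : ∀ y, H.Fib y →ₗ[ℂ] (Fin r → ℂ) := fun y => LinearMap.pi fun i => (b y).coord (Sum.inl i)
  have hL : ∀ y ∈ D, ∀ s, H.HolAt s y → ∀ i, HolFunAt (fun z => L z (s z) i) y :=
    fun y hy s hs i => (hb y hy s).1 hs (Sum.inl i)
  let c : Fin r → ∀ y, H.Fib y := fun i y => f.toFun y (a y (Sum.inl i))
  have hc : ∀ y ∈ D, ∀ i, H.HolAt (c i) y := fun y hy i => f.hol _ _ ((ha y hy).holAt _)
  let Δ : M → Matrix (Fin r) (Fin r) ℂ := fun y => Matrix.of fun i j => L y (c j y) i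
  have hΔ : ∀ y ∈ D, ∀ i j, HolFunAt (fun z => Δ z i j) y := fun y hy i j =>
    hL y hy _ (hc y hy j) i
  have hΔμ : ∀ y (μ : Fin r → ℂ), ∑ i, μ i • L y (c i y) = (Δ y).mulVec μ := by
    intro y μ
    funext i
    simp [Δ, Matrix.mulVec, dotProduct, mul_comm]
  have hne : ∀ᶠ y in 𝓝[≠] x, (Δ y).det ≠ 0 := by
    refine hD _ (fun y hy => HolFunAt.det (hΔ y hy)) ⟨y₀, hy₀, ?_⟩
    have : Δ y₀ = 1 := by
      ext i j
      simp only [Δ, L, c, a, b, Matrix.of_apply, LinearMap.pi_apply, constFrame_self, hαβ,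
        Module.Basis.coord_apply, Module.Basis.repr_self, Matrix.one_apply,
        Finsupp.single_apply, Sum.inl.injEq, eq_comm]
    rw [this, Matrix.det_one]
    exact one_ne_zero
  have hDev : ∀ᶠ y in 𝓝 x, y ∈ D := hDx
  have hspan : ∀ᶠ y in 𝓝[≠] x,
      LinearMap.range (f.toFun y) = Submodule.span ℂ (Set.range fun i => c i y) ∧
      Module.finrank ℂ (LinearMap.range (f.toFun y)) = r ∧
      ∀ μ : Fin r → ℂ, L y (∑ i, μ i • c i y) = 0 → μ = 0 := by
    filter_upwards [hne, nhdsWithin_le_nhds hDev] with y hy hyD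
    have hμ : ∀ μ : Fin r → ℂ, L y (∑ i, μ i • c i y) = 0 → μ = 0 := by
      intro μ h
      refine Matrix.eq_zero_of_mulVec_eq_zero hy ?_
      rw [← hΔμ, ← h, map_sum]
      simp only [map_smul]
    have hli : LinearIndependent ℂ fun i => c i y := by
      rw [Fintype.linearIndependent_iff]
      intro μ h
      exact congrFun (hμ μ (by rw [h, map_zero]))
    have hle : Submodule.span ℂ (Set.range fun i => c i y) ≤ LinearMap.range (f.toFun y) := by
      rw [Submodule.span_le]
      rintro _ ⟨i, rfl⟩
      exact LinearMap.mem_range_self _ _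
    have hfr : Module.finrank ℂ (Submodule.span ℂ (Set.range fun i => c i y)) = r := by
      rw [finrank_span_eq_card hli, Fintype.card_fin]
    have heq := Submodule.eq_of_le_of_finrank_le hle (by rw [hfr]; exact hmax y hyD)
    exact ⟨heq.symm, by rw [← heq, hfr], hμ⟩
  -- Cramer's rule, applied to the remaining vectors of the frame, produces sections of the kernel
  let e : Fin k → ∀ y, G.Fib y := fun j y => (Δ y).det • a y (Sum.inr j) -
    ∑ i, ((Δ y).cramer (L y (f.toFun y (a y (Sum.inr j)))) i) • a y (Sum.inl i)
  have he : ∀ y ∈ D, ∀ j, G.HolAt (e j) y := by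
    intro y hy j
    refine holAt_sub (holAt_smul (HolFunAt.det (hΔ y hy)) ((ha y hy).holAt _))
      (holAt_sum _ fun i _ => holAt_smul ?_ ((ha y hy).holAt _))
    simp only [Matrix.cramer_apply]
    refine HolFunAt.det fun p q => ?_
    rcases eq_or_ne q i with rfl | hq
    · simpa using hL y hy _ (f.hol _ _ ((ha y hy).holAt (Sum.inr j))) p
    · simpa [Matrix.updateCol_ne hq] using hΔ y hy p q
  let L' : ∀ y, G.Fib y →ₗ[ℂ] (Fin k → ℂ) := fun y =>
    LinearMap.pi fun j => (a y).coord (Sum.inr j)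
  have hL'e : ∀ y, (Matrix.of fun i j => L' y (e j y) i) = (Δ y).det • 1 := by
    intro y
    ext i j
    simp [L', e, Matrix.one_apply, Finsupp.single_apply, eq_comm]
  have hne' : ∀ᶠ y in 𝓝[≠] x, (Matrix.of fun i j => L' y (e j y) i).det ≠ 0 := by
    filter_upwards [hne] with y hy
    rw [hL'e, Matrix.det_smul, Matrix.det_one, mul_one]
    exact pow_ne_zero _ hy
  have hker : ∀ᶠ y in 𝓝[≠] x,
      LinearMap.ker (f.toFun y) = Submodule.span ℂ (Set.range fun i => e i y) := by
    filter_upwards [hne', hspan] with y hy ⟨h1, h2, h3⟩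
    have hle : Submodule.span ℂ (Set.range fun i => e i y) ≤ LinearMap.ker (f.toFun y) := by
      rw [Submodule.span_le]
      rintro _ ⟨j, rfl⟩
      have h4 : f.toFun y (e j y) ∈ LinearMap.range (f.toFun y) := LinearMap.mem_range_self _ _
      rw [h1, Submodule.mem_span_range_iff_exists_fun] at h4
      obtain ⟨μ, hμ⟩ := h4
      have h5 : L y (f.toFun y (e j y)) = 0 := by
        simp only [e, map_sub, map_smul, map_sum]
        change _ - ∑ i, (Δ y).cramer (L y (f.toFun y (a y (Sum.inr j)))) i • L y (c i y) = _
        rw [hΔμ, Matrix.mulVec_cramer, sub_self]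
      have h7 := h3 μ (by rw [hμ, h5])
      rw [SetLike.mem_coe, LinearMap.mem_ker, ← hμ, h7]
      simp
    have hli : LinearIndependent ℂ fun i => e i y := by
      rw [Fintype.linearIndependent_iff]
      intro μ h
      refine congrFun (Matrix.eq_zero_of_mulVec_eq_zero hy ?_)
      have h8 := congrArg (L' y) h
      rw [map_zero] at h8
      rw [← h8]
      funext i
      simp [Matrix.mulVec, dotProduct, mul_comm]
    refine (Submodule.eq_of_le_of_finrank_le hle ?_).symm
    rw [finrank_span_eq_card hli, Fintype.card_fin]
    have := hrk y
    omega
  obtain ⟨d₁, hd₁, hli₁, hsp₁⟩ := exists_saturation (hDev.mono hL) c (hDev.mono hc) hne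
  obtain ⟨d₂, hd₂, hli₂, hsp₂⟩ := exists_saturation (L := L') (hDev.mono fun y hy s hs j =>
    (ha y hy s).1 hs (Sum.inr j)) e (hDev.mono he) hne'
  refine ⟨r, k, ⟨d₁, hd₁, hli₁, ?_⟩, ⟨d₂, hd₂, hli₂, ?_⟩, hrk₀, hspan.mono fun y hy => hy.2.1⟩
  · filter_upwards [hspan, hsp₁] with y h1 h2
    rw [h1.1, h2]
  · filter_upwards [hker, hsp₂] with y h1 h2
    rw [h1, h2]

variable [T2Space M] [ConnectedSpace M]

/-- The generic kernel and the saturated image of a homomorphism. -/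
theorem Hom.exists_kernel_image (f : Hom G H) : ∃ (K : G.Subbundle) (I : H.Subbundle),
    K.rk + I.rk = G.rk ∧
    (∀ x, ∀ᶠ y in 𝓝[≠] x, K.carrier y = LinearMap.ker (f.toFun y)) ∧
    (∀ x, ∀ᶠ y in 𝓝[≠] x, I.carrier y = LinearMap.range (f.toFun y)) := by
  choose r k hI hK hrk hgen using f.exists_local_kernel_image
  have hconst : ∀ x y, r x = r y := by
    have hloc : IsLocallyConstant r := by
      rw [IsLocallyConstant.iff_eventually_eq]
      intro x
      filter_upwards [eventually_eventually_nhdsNE (hgen x)] with y hy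
      have := neBot_nhdsNE y
      obtain ⟨z, h1, h2⟩ := (hy.and (hgen y)).exists
      rw [← h1, ← h2]
    exact fun x y => hloc.apply_eq_of_isPreconnected isPreconnected_univ trivial trivial
  obtain ⟨x₀⟩ : Nonempty M := inferInstance
  have hkc : ∀ y, k y = k x₀ := fun y => by
    have h1 := hrk y
    have h2 := hrk x₀
    have h3 := hconst y x₀
    omega
  obtain ⟨I, hIrk, hIe⟩ := IsGenericSubbundle.exists_subbundle
    (V := fun y => LinearMap.range (f.toFun y)) (r := r x₀) fun x => by
      rw [← hconst x x₀]; exact hI x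
  obtain ⟨K, hKrk, hKe⟩ := IsGenericSubbundle.exists_subbundle
    (V := fun y => LinearMap.ker (f.toFun y)) (r := k x₀) fun x => by
      rw [← hkc x]; exact hK x
  exact ⟨K, I, by rw [hIrk, hKrk, add_comm]; exact hrk x₀, hKe, hIe⟩

end HolBundle

end

/-! ### Subbundles, quotients and their degrees -/

noncomputable section

namespace HolBundle

variable {M : Type v} [TopologicalSpace M] [ChartedSpace ℂ M]

/-! ### Homomorphisms -/

namespace Hom

variable {E E' E'' : HolBundle.{u} M}

/-- The composition of two homomorphisms. -/
def comp (g : Hom E' E'') (f : Hom E E') : Hom E E'' where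
  toFun x := (g.toFun x).comp (f.toFun x)
  hol s x hs := g.hol _ x (f.hol s x hs)

/-- The homomorphism to a subbundle that contains the image. -/
def codRestrict (f : Hom E E') (F : E'.Subbundle) (h : ∀ x v, f.toFun x v ∈ F.carrier x) :
    Hom E F.toBundle where
  toFun x := (f.toFun x).codRestrict (F.carrier x) (h x)
  hol s x hs := f.hol s x hs

/-- The homomorphism induced on the quotient by a subbundle of the kernel. -/
def descend (f : Hom E E') (F : E.Subbundle) (h : ∀ x, F.carrier x ≤ LinearMap.ker (f.toFun x)) :
    Hom F.quotient E' where
  toFun x := (F.carrier x).liftQ (f.toFun x) (h x)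
  hol s x hs := by
    obtain ⟨a, ha, hsa⟩ := hs
    refine holAt_congr (f.hol a x ha) ?_
    filter_upwards [hsa] with y hy
    rw [hy]
    exact ((F.carrier y).liftQ_apply (f.toFun y) (a y)).symm

/-- A fibrewise bijective homomorphism is an isomorphism. -/
def toIso (f : Hom E E') (hf : ∀ x, Function.Bijective (f.toFun x)) : Iso E E' where
  toEquiv x := LinearEquiv.ofBijective (f.toFun x) (hf x)
  hol s x := by
    refine ⟨f.hol s x, fun h => ?_⟩
    have ha := E.frame_isFrameNear x
    have hrk : E'.rk = Fintype.card (Fin E.rk) := by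
      rw [← E'.finrank_fib x, ← (LinearEquiv.ofBijective (f.toFun x) (hf x)).finrank_eq,
        E.finrank_fib, Fintype.card_fin]
    obtain ⟨b, hb, hbf⟩ := exists_frame_of_linearIndependent x
      (fun i y => f.toFun y (E.frame x y i)) (ha.holAt.mono fun y hy i => f.hol _ _ (hy i))
      ((injective_iff_linearIndependent_basis (E.frame x x) _).1 (hf x).1) hrk
    rw [ha.self_of_nhds]
    intro i
    refine ((hb.self_of_nhds _).1 h i).congr ?_
    filter_upwards [hbf] with y hy
    have h1 : f.toFun y (s y) = ∑ i, (E.frame x y).repr (s y) i • b y i := by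
      conv_lhs => rw [← (E.frame x y).sum_repr (s y)]
      simp only [map_sum, map_smul, hy]
    change (b y).repr (f.toFun y (s y)) i = _
    rw [h1, Module.Basis.repr_sum_self]

end Hom

/-- The homomorphism underlying an isomorphism. -/
def Iso.toHom {E E' : HolBundle.{u} M} (f : Iso E E') : Hom E E' where
  toFun x := f.toEquiv x
  hol s x hs := (f.hol s x).1 hs

/-- The homomorphism underlying the inverse of an isomorphism. -/
def Iso.invHom {E E' : HolBundle.{u} M} (f : Iso E E') : Hom E' E where
  toFun x := (f.toEquiv x).symm
  hol s x hs := by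
    rw [f.hol]
    simpa using hs

namespace Subbundle

variable {E : HolBundle.{u} M}

/-- The inclusion of a subbundle. -/
def incl (F : E.Subbundle) : Hom F.toBundle E where
  toFun x := (F.carrier x).subtype
  hol _ _ hs := hs

/-- The projection to the quotient by a subbundle. -/
def proj (F : E.Subbundle) : Hom E F.quotient where
  toFun x := (F.carrier x).mkQ
  hol s _ hs := ⟨s, hs, Filter.Eventually.of_forall fun _ => rfl⟩

theorem incl_injective (F : E.Subbundle) (x : M) : Function.Injective (F.incl.toFun x) :=
  (F.carrier x).injective_subtype

theorem proj_surjective (F : E.Subbundle) (x : M) : Function.Surjective (F.proj.toFun x) :=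
  (F.carrier x).mkQ_surjective

theorem range_incl (F : E.Subbundle) (x : M) :
    LinearMap.range (F.incl.toFun x) = F.carrier x := (F.carrier x).range_subtype

theorem ker_proj (F : E.Subbundle) (x : M) :
    LinearMap.ker (F.proj.toFun x) = F.carrier x := (F.carrier x).ker_mkQ

section Order

variable [Nonempty M]

theorem rk_le (F : E.Subbundle) : F.rk ≤ E.rk := by
  obtain ⟨x⟩ := ‹Nonempty M›
  rw [← F.finrank_carrier x, ← E.finrank_fib x]
  exact Submodule.finrank_le _

theorem rk_mono {F G : E.Subbundle} (h : F.carrier ≤ G.carrier) : F.rk ≤ G.rk := by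
  obtain ⟨x⟩ := ‹Nonempty M›
  rw [← F.finrank_carrier x, ← G.finrank_carrier x]
  exact Submodule.finrank_mono (h x)

theorem carrier_eq_of_rk_le {F G : E.Subbundle} (h : F.carrier ≤ G.carrier) (hrk : G.rk ≤ F.rk) :
    F.carrier = G.carrier := by
  funext x
  refine Submodule.eq_of_le_of_finrank_le (h x) ?_
  rwa [F.finrank_carrier, G.finrank_carrier]

theorem rk_congr {F G : E.Subbundle} (h : F.carrier = G.carrier) : F.rk = G.rk :=
  (rk_mono h.le).antisymm (rk_mono h.ge)

theorem carrier_injective : Function.Injective (carrier : E.Subbundle → _) := by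
  intro F G h
  have hrk := rk_congr h
  cases F
  cases G
  obtain rfl : _ = _ := h
  obtain rfl : _ = _ := hrk
  rfl

theorem rk_eq_zero_iff (F : E.Subbundle) : F.rk = 0 ↔ F.carrier = ⊥ := by
  constructor
  · intro h
    funext x
    have := F.finrank_carrier x
    rw [h] at this
    exact Submodule.finrank_eq_zero.1 this
  · intro h
    obtain ⟨x⟩ := ‹Nonempty M›
    rw [← F.finrank_carrier x, h]
    simp

theorem rk_eq_iff (F : E.Subbundle) : F.rk = E.rk ↔ F.carrier = ⊤ := by
  constructor
  · intro h
    funext x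
    refine Submodule.eq_top_of_finrank_eq ?_
    rw [F.finrank_carrier, E.finrank_fib, h]
  · intro h
    obtain ⟨x⟩ := ‹Nonempty M›
    rw [← F.finrank_carrier x, h, ← E.finrank_fib x]
    exact finrank_top ℂ (E.Fib x)

end Order

/-- The zero subbundle. -/
def zero (E : HolBundle.{u} M) : E.Subbundle where
  carrier := ⊥
  rk := 0
  exists_sections x := ⟨fun i => i.elim0, Filter.Eventually.of_forall fun y =>
    ⟨fun i => i.elim0, linearIndependent_empty_type, by simp⟩⟩

/-- The bundle itself as a subbundle. -/
def whole (E : HolBundle.{u} M) : E.Subbundle where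
  carrier := ⊤
  rk := E.rk
  exists_sections x := ⟨fun i y => E.frame x y i, by
    filter_upwards [(E.frame_isFrameNear x).holAt] with y hy
    exact ⟨hy, (E.frame x y).linearIndependent, (E.frame x y).span_eq.symm⟩⟩

section Maps

variable {A B A' B' : E.Subbundle} (h : A.carrier ≤ B.carrier) (h' : A'.carrier ≤ B'.carrier)
  (hA : A.carrier ≤ A'.carrier) (hB : B.carrier ≤ B'.carrier)

/-- The homomorphism `B / A → B' / A'` induced by inclusions `A ⊆ A'` and `B ⊆ B'`. -/
def subquotientMap : Hom (A.subquotient B h) (A'.subquotient B' h') where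
  toFun x := ((A.carrier x).submoduleOf (B.carrier x)).mapQ
    ((A'.carrier x).submoduleOf (B'.carrier x)) (Submodule.inclusion (hB x)) fun v hv => hA x hv
  hol s x hs := by
    obtain ⟨a, ha, hsa⟩ := hs
    refine ⟨fun y => Submodule.inclusion (hB y) (a y), ha, ?_⟩
    filter_upwards [hsa] with y hy
    rw [hy]
    rfl

theorem subquotientMap_injective (hle : A'.carrier ⊓ B.carrier ≤ A.carrier) (x : M) :
    Function.Injective ((subquotientMap h h' hA hB).toFun x) := by
  rw [← LinearMap.ker_eq_bot, LinearMap.ker_eq_bot']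
  intro v hv
  obtain ⟨v, rfl⟩ := Submodule.Quotient.mk_surjective _ v
  have h1 : Submodule.inclusion (hB x) v ∈ (A'.carrier x).submoduleOf (B'.carrier x) :=
    (Submodule.Quotient.mk_eq_zero _).1 hv
  exact (Submodule.Quotient.mk_eq_zero _).2 (hle x ⟨h1, v.2⟩)

theorem subquotientMap_surjective (hle : B'.carrier ≤ A'.carrier ⊔ B.carrier) (x : M) :
    Function.Surjective ((subquotientMap h h' hA hB).toFun x) := by
  intro w
  obtain ⟨w, rfl⟩ := ((A'.carrier x).submoduleOf (B'.carrier x)).mkQ_surjective w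
  change B'.carrier x at w
  obtain ⟨a, ha, b, hb, hab⟩ := Submodule.mem_sup.1 (hle x w.2)
  refine ⟨Submodule.Quotient.mk ⟨b, hb⟩, (Submodule.Quotient.eq _).2 ?_⟩
  have h2 : b - (w : E.Fib x) = -a := by rw [← hab]; abel
  change (b - (w : E.Fib x)) ∈ A'.carrier x
  rw [h2]
  exact Submodule.neg_mem _ ha

end Maps

end Subbundle

variable [IsManifold 𝓘(ℂ) ω M] [CompactSpace M] [T2Space M]

section Degree

variable [Nonempty M] {E : HolBundle.{u} M}

theorem Subbundle.degree_quotient (F : E.Subbundle) :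
    F.quotient.degree = E.degree - F.toBundle.degree := by
  have h := degree_add_of_exact F.incl F.proj F.incl_injective F.proj_surjective
    fun x => by rw [F.range_incl, F.ker_proj]
  linarith

/-- Follows from the short exact sequence `0 → E → E → E → 0`, which is exact since the fibres are
zero. -/
theorem degree_eq_zero_of_rk (h : E.rk = 0) : E.degree = 0 := by
  have hz : ∀ x (v : E.Fib x), v = 0 := fun x v =>
    (finrank_zero_iff_forall_zero (K := ℂ)).1 ((E.finrank_fib x).trans h) v
  have := degree_add_of_exact (A := E) (B := E) (C := E) ⟨fun x => LinearMap.id, fun s x hs => hs⟩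
    ⟨fun x => LinearMap.id, fun s x hs => hs⟩ (fun x => Function.injective_id)
    (fun x => Function.surjective_id) fun x => by
      ext v
      simp [hz x v]
  linarith

theorem Subbundle.degree_of_eq_bot {F : E.Subbundle} (h : F.carrier = ⊥) :
    F.toBundle.degree = 0 :=
  degree_eq_zero_of_rk (F.rk_eq_zero_iff.2 h)

theorem Subbundle.degree_of_eq_top {F : E.Subbundle} (h : F.carrier = ⊤) :
    F.toBundle.degree = E.degree :=
  (degree_eq_of_bijective F.incl fun x => ⟨F.incl_injective x, fun v => by
    have : v ∈ F.carrier x := by rw [h]; trivial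
    exact ⟨⟨v, this⟩, rfl⟩⟩).2

theorem Subbundle.degree_restrict {A B : E.Subbundle} (h : A.carrier ≤ B.carrier) :
    (A.restrict B h).toBundle.degree = A.toBundle.degree := by
  let f : Hom (A.restrict B h).toBundle A.toBundle :=
    { toFun := fun x => ((B.carrier x).subtype.comp
        ((A.carrier x).submoduleOf (B.carrier x)).subtype).codRestrict (A.carrier x) fun v => v.2
      hol := fun s x hs => hs }
  refine (degree_eq_of_bijective f fun x => ⟨fun v w hvw => ?_, fun w => ?_⟩).2
  · exact Subtype.ext (Subtype.ext (congrArg (A.carrier x).subtype hvw))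
  · exact ⟨⟨⟨w.1, h x w.2⟩, w.2⟩, rfl⟩

theorem Subbundle.degree_subquotient {A B : E.Subbundle} (h : A.carrier ≤ B.carrier) :
    (A.subquotient B h).degree = B.toBundle.degree - A.toBundle.degree := by
  rw [subquotient, degree_quotient, degree_restrict]

theorem Subbundle.rk_subquotient {A B : E.Subbundle} (h : A.carrier ≤ B.carrier) :
    (A.subquotient B h).rk = B.rk - A.rk := rfl

end Degree

variable [ConnectedSpace M] {G H : HolBundle.{u} M}

/-- The degree of a bundle is at most the sum of the degrees of the generic kernel and of the
saturated image of a homomorphism, and it is equal to it only for homomorphisms of constant rank. -/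
theorem Hom.exists_kernel_image_degree (f : Hom G H) : ∃ (K : G.Subbundle) (I : H.Subbundle),
    K.rk + I.rk = G.rk ∧
    (∀ x, ∀ᶠ y in 𝓝[≠] x, K.carrier y = LinearMap.ker (f.toFun y)) ∧
    (∀ x, ∀ᶠ y in 𝓝[≠] x, I.carrier y = LinearMap.range (f.toFun y)) ∧
    (∀ x, K.carrier x ≤ LinearMap.ker (f.toFun x)) ∧
    (∀ x, LinearMap.range (f.toFun x) ≤ I.carrier x) ∧
    G.degree ≤ K.toBundle.degree + I.toBundle.degree ∧
    (G.degree = K.toBundle.degree + I.toBundle.degree →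
      ∀ x, K.carrier x = LinearMap.ker (f.toFun x) ∧
        I.carrier x = LinearMap.range (f.toFun x)) := by
  obtain ⟨K, I, hrk, hK, hI⟩ := f.exists_kernel_image
  have hKle : ∀ x, K.carrier x ≤ LinearMap.ker (f.toFun x) := by
    intro x v hv
    obtain ⟨s, rfl, hs⟩ := K.exists_section_mem hv
    have h1 : f.toFun x (s x) ∈ (Subbundle.zero H).carrier x := by
      refine (Subbundle.zero H).mem_of_eventually (s := fun y => f.toFun y (s y))
        (f.hol _ _ hs.self_of_nhds.1) ?_
      filter_upwards [hK x, nhdsWithin_le_nhds hs] with y h1 h2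
      rw [h1] at h2
      rw [LinearMap.mem_ker.1 h2.2]
      exact Submodule.zero_mem _
    exact h1
  have hIle : ∀ x, LinearMap.range (f.toFun x) ≤ I.carrier x := by
    rintro x _ ⟨v, rfl⟩
    obtain ⟨s, hs, rfl⟩ := G.exists_section x v
    refine I.mem_of_eventually (s := fun y => f.toFun y (s y)) (f.hol _ _ hs.self_of_nhds) ?_
    filter_upwards [hI x] with y h1
    rw [h1]
    exact LinearMap.mem_range_self _ _
  have hle : ∀ x v, f.toFun x v ∈ I.carrier x := fun x v => hIle x (LinearMap.mem_range_self _ _)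
  -- the induced map from `G / K` to `I` is generically an isomorphism
  let g := (f.codRestrict I hle).descend K fun x v hv => by
    rw [LinearMap.mem_ker]
    exact Subtype.ext (hKle x hv)
  have hinj : ∀ x, Function.Injective (g.toFun x) ↔ K.carrier x = LinearMap.ker (f.toFun x) := by
    intro x
    constructor
    · intro h
      refine le_antisymm (hKle x) fun v hv => ?_
      have h1 : g.toFun x ((K.carrier x).mkQ v) = g.toFun x 0 := by
        rw [map_zero]
        exact Subtype.ext hv
      exact (Submodule.Quotient.mk_eq_zero _).1 (h h1)
    · intro h
      rw [← LinearMap.ker_eq_bot, LinearMap.ker_eq_bot']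
      intro v hv
      obtain ⟨v, rfl⟩ := (K.carrier x).mkQ_surjective v
      refine (Submodule.Quotient.mk_eq_zero _).2 ?_
      rw [h]
      exact congrArg (I.carrier x).subtype hv
  have hrkg : K.quotient.rk = I.toBundle.rk := by
    change G.rk - K.rk = I.rk
    omega
  have hd := K.degree_quotient
  refine ⟨K, I, hrk, hK, hI, hKle, hIle, ?_⟩
  rcases degree_of_generic_injective g hrkg fun x => (hK x).mono fun y hy => (hinj y).2 hy with
    ⟨h1, -⟩ | ⟨h1, h2⟩
  · exact ⟨by linarith, fun h => by linarith⟩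
  · refine ⟨by linarith, fun _ x => ⟨(hinj x).1 (h2 x), ?_⟩⟩
    refine (Submodule.eq_of_le_of_finrank_le (hIle x) ?_).symm
    have h3 := LinearMap.finrank_range_add_finrank_ker (f.toFun x)
    rw [← (hinj x).1 (h2 x), K.finrank_carrier, G.finrank_fib] at h3
    rw [I.finrank_carrier]
    omega

/-- The kernel of a surjective homomorphism is a subbundle. -/
theorem Hom.exists_kernel (f : Hom G H) (hf : ∀ x, Function.Surjective (f.toFun x)) :
    ∃ K : G.Subbundle, (∀ x, K.carrier x = LinearMap.ker (f.toFun x)) ∧ K.rk + H.rk = G.rk ∧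
      K.toBundle.degree = G.degree - H.degree := by
  obtain ⟨K, I, hrk, hK, hI, hKle, hIle, -⟩ := f.exists_kernel_image_degree
  have hItop : I.rk = H.rk := by
    rw [I.rk_eq_iff]
    funext x
    have := hIle x
    rw [LinearMap.range_eq_top.2 (hf x), top_le_iff] at this
    exact this
  have hKe : ∀ x, K.carrier x = LinearMap.ker (f.toFun x) := by
    intro x
    refine Submodule.eq_of_le_of_finrank_le (hKle x) ?_
    have h3 := LinearMap.finrank_range_add_finrank_ker (f.toFun x)
    rw [LinearMap.range_eq_top.2 (hf x), finrank_top, G.finrank_fib, H.finrank_fib] at h3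
    rw [K.finrank_carrier]
    omega
  refine ⟨K, hKe, by omega, ?_⟩
  have := degree_add_of_exact K.incl f K.incl_injective hf fun x => by rw [K.range_incl, hKe]
  linarith

/-- The image of an injective homomorphism is a subbundle. -/
theorem Hom.exists_image (f : Hom G H) (hf : ∀ x, Function.Injective (f.toFun x)) :
    ∃ I : H.Subbundle, (∀ x, I.carrier x = LinearMap.range (f.toFun x)) ∧ I.rk = G.rk ∧
      I.toBundle.degree = G.degree := by
  obtain ⟨K, I, hrk, hK, hI, hKle, hIle, -⟩ := f.exists_kernel_image_degree
  have hKbot : K.rk = 0 := by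
    rw [K.rk_eq_zero_iff]
    funext x
    have := hKle x
    rw [LinearMap.ker_eq_bot.2 (hf x), le_bot_iff] at this
    exact this
  have hIe : ∀ x, I.carrier x = LinearMap.range (f.toFun x) := by
    intro x
    refine (Submodule.eq_of_le_of_finrank_le (hIle x) ?_).symm
    rw [LinearMap.finrank_range_of_inj (hf x), I.finrank_carrier, G.finrank_fib]
    omega
  refine ⟨I, hIe, by omega, ?_⟩
  have hle : ∀ x v, f.toFun x v ∈ I.carrier x := fun x v => hIle x (LinearMap.mem_range_self _ _)
  refine (degree_eq_of_bijective (f.codRestrict I hle)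
    fun x => ⟨fun v w h => ?_, fun w => ?_⟩).2.symm
  · exact hf x (congrArg Subtype.val h)
  · have h1 : (I.carrier x).subtype w ∈ LinearMap.range (f.toFun x) := hIe x ▸ w.2
    obtain ⟨v, hv⟩ := h1
    exact ⟨v, Subtype.ext hv⟩

end HolBundle

end

/-! ### Schur's lemma for real bundles -/

noncomputable section

namespace HolBundle

variable {M : Type v} [TopologicalSpace M] [ChartedSpace ℂ M] {σ : AntiholInvolution M}

namespace Hom

variable {E E' : HolBundle.{u} M}

/-- The sum of two homomorphisms. -/
def add (f g : Hom E E') : Hom E E' where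
  toFun x := f.toFun x + g.toFun x
  hol s x hs := holAt_add (f.hol s x hs) (g.hol s x hs)

/-- A scalar multiple of a homomorphism. -/
def smul (c : ℂ) (f : Hom E E') : Hom E E' where
  toFun x := c • f.toFun x
  hol s x hs := holAt_smul (HolFunAt.const c x) (f.hol s x hs)

/-- The homomorphism is not identically zero. -/
def IsNonzero (f : Hom E E') : Prop := ∃ x v, f.toFun x v ≠ 0

end Hom

namespace RealStructure

variable {E E' : HolBundle.{u} M} (τ : RealStructure σ E) (τ' : RealStructure σ E')

theorem conj_conj_heq (x : M) (v : E.Fib x) : HEq (τ.conj (σ x) (τ.conj x v)) v :=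
  (Sigma.mk.inj (τ.involutive x v)).2

theorem conj_injective (x : M) : Function.Injective (τ.conj x) := fun v w h =>
  eq_of_heq ((τ.conj_conj_heq x v).symm.trans (by rw [h]; exact τ.conj_conj_heq x w))

theorem conj_bijective (x : M) : Function.Bijective (τ.conj x) := by
  refine ⟨τ.conj_injective x, fun w => ?_⟩
  have key : ∀ (y : M) (h : y = x) (u : E.Fib y), ∃ v : E.Fib x, HEq u v := by
    rintro y rfl u
    exact ⟨u, HEq.rfl⟩
  obtain ⟨v, hv⟩ := key _ (σ.involutive x) (τ.conj (σ x) w)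
  exact ⟨v, τ.conj_injective (σ x) (eq_of_heq ((τ.conj_conj_heq x v).trans hv.symm))⟩

/-- The real structure as an antilinear equivalence of fibres. -/
def conjEquiv (x : M) : E.Fib x ≃ₛₗ[starRingEnd ℂ] E.Fib (σ x) :=
  LinearEquiv.ofBijective (τ.conj x) (τ.conj_bijective x)

theorem conjEquiv_apply (x : M) (v : E.Fib x) : τ.conjEquiv x v = τ.conj x v := rfl

/-- The conjugate `τ' ∘ f ∘ τ` of a homomorphism. -/
def conjHom (f : Hom E E') : Hom E E' where
  toFun x := ((τ'.conjEquiv x).symm.toLinearMap.comp (f.toFun (σ x))).comp (τ.conj x)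
  hol s x hs := by
    obtain ⟨t, ht⟩ := τ.exists_conj_section s
    obtain ⟨u, hu⟩ := τ'.exists_conj_section fun y => f.toFun y (t y)
    have h1 := τ'.antihol _ u (σ x) hu (f.hol t (σ x) (τ.antihol s t x ht hs))
    rw [σ.involutive] at h1
    refine holAt_congr h1 (Filter.Eventually.of_forall fun y => ?_)
    set p := (τ'.conjEquiv y).symm (f.toFun (σ y) (τ.conj y (s y))) with hp
    have h2 : f.toFun (σ y) (t (σ y)) = τ'.conj y p := by
      rw [ht, hp, ← conjEquiv_apply τ', LinearEquiv.apply_symm_apply]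
    have h3 : HEq (u (σ (σ y))) p := by
      rw [hu, h2]
      exact τ'.conj_conj_heq y p
    have h4 : HEq (u (σ (σ y))) (u y) := by rw [σ.involutive]
    exact eq_of_heq (h4.symm.trans h3)

theorem conj_conjHom_apply (f : Hom E E') (x : M) (v : E.Fib x) :
    τ'.conj x ((conjHom τ τ' f).toFun x v) = f.toFun (σ x) (τ.conj x v) :=
  (τ'.conjEquiv x).apply_symm_apply _

theorem conjHom_conj_apply (f : Hom E E') (x : M) (v : E.Fib x) :
    (conjHom τ τ' f).toFun (σ x) (τ.conj x v) = τ'.conj x (f.toFun x v) := by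
  apply τ'.conj_injective
  rw [conj_conjHom_apply]
  have key : ∀ (y : M) (h : y = x) (w : E.Fib y), HEq w v → HEq (f.toFun y w) (f.toFun x v) := by
    rintro y rfl w h
    rw [eq_of_heq h]
  exact eq_of_heq ((key _ (σ.involutive x) _ (τ.conj_conj_heq x v)).trans
    (τ'.conj_conj_heq x _).symm)

/-- The homomorphism commutes with the real structures. -/
def Commutes (f : Hom E E') : Prop :=
  ∀ x v, f.toFun (σ x) (τ.conj x v) = τ'.conj x (f.toFun x v)

theorem commutes_add_conjHom (f : Hom E E') : Commutes τ τ' (f.add (conjHom τ τ' f)) := by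
  intro x v
  change f.toFun (σ x) (τ.conj x v) + (conjHom τ τ' f).toFun (σ x) (τ.conj x v) =
    τ'.conj x (f.toFun x v + (conjHom τ τ' f).toFun x v)
  rw [map_add, conj_conjHom_apply, conjHom_conj_apply, add_comm]

/-- If there is a non-zero homomorphism, then there is one that is compatible with the real
structures: the real or the imaginary part. -/
theorem exists_commutes (f : Hom E E') (hf : f.IsNonzero) :
    ∃ g : Hom E E', g.IsNonzero ∧ Commutes τ τ' g := by
  by_contra! hcon
  have h1 : ∀ g : Hom E E', ∀ x v, g.toFun x v + (conjHom τ τ' g).toFun x v = 0 := by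
    intro g x v
    by_contra h
    exact hcon (g.add (conjHom τ τ' g)) ⟨x, v, h⟩ (commutes_add_conjHom τ τ' g)
  obtain ⟨x, v, hv⟩ := hf
  have h2 := h1 f x v
  have h3 := h1 (f.smul Complex.I) x v
  have h4 : (conjHom τ τ' (f.smul Complex.I)).toFun x v =
      -Complex.I • (conjHom τ τ' f).toFun x v := by
    apply τ'.conj_injective
    rw [conj_conjHom_apply, LinearMap.map_smulₛₗ, conj_conjHom_apply]
    simp [Hom.smul]
  rw [h4] at h3
  change Complex.I • f.toFun x v + _ = 0 at h3
  rw [eq_neg_of_add_eq_zero_right h2] at h3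
  rw [smul_neg, neg_smul, neg_neg, ← two_smul ℂ, smul_smul] at h3
  exact hv ((smul_eq_zero.1 h3).resolve_left (by simp))

variable {τ τ'}

theorem tendsto_involution (σ : AntiholInvolution M) (x : M) :
    Filter.Tendsto σ (𝓝 (σ x)) (𝓝 x) := by
  have := σ.continuous.tendsto (σ x)
  rwa [σ.involutive] at this

theorem tendsto_involution_nhdsNE (σ : AntiholInvolution M) (x : M) :
    Filter.Tendsto σ (𝓝[≠] (σ x)) (𝓝[≠] x) := by
  refine tendsto_nhdsWithin_iff.2 ⟨(tendsto_involution σ x).mono_left nhdsWithin_le_nhds, ?_⟩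
  filter_upwards [self_mem_nhdsWithin] with y hy h
  apply hy
  rw [Set.mem_singleton_iff, ← Set.mem_singleton_iff.1 h, σ.involutive]

variable [IsManifold 𝓘(ℂ) ω M] [T2Space M]

/-- By continuity, a subbundle is real as soon as it is generically real. -/
theorem preserves_of_eventually {F : E.Subbundle}
    (h : ∀ x, ∀ᶠ y in 𝓝[≠] x, ∀ v ∈ F.carrier y, τ.conj y v ∈ F.carrier (σ y)) :
    τ.Preserves F := by
  intro x v hv
  obtain ⟨s, rfl, hs⟩ := F.exists_section_mem hv
  obtain ⟨t, ht⟩ := τ.exists_conj_section s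
  rw [← ht]
  refine F.mem_of_eventually (τ.antihol s t x ht hs.self_of_nhds.1) ?_
  filter_upwards [(tendsto_involution_nhdsNE σ x).eventually
    ((h x).and (nhdsWithin_le_nhds hs))] with z hz
  have h1 := hz.1 _ hz.2.2
  rw [← ht, σ.involutive] at h1
  exact h1

variable [CompactSpace M] [ConnectedSpace M]

theorem IsRealStable.degree_lt (h : τ.IsRealStable) {F : E.Subbundle} (hF : τ.Preserves F)
    (h0 : F.carrier ≠ ⊥) (h1 : F.carrier ≠ ⊤) : F.toBundle.degree < E.slope * F.rk := by
  have h2 := h.2 F hF h0 h1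
  have h3 : 0 < F.rk := Nat.pos_of_ne_zero fun h => h0 (F.rk_eq_zero_iff.1 h)
  rwa [slope, div_lt_iff₀ (by exact_mod_cast h3)] at h2

/-- Schur's lemma for stable real bundles of the same slope. -/
theorem IsRealStable.nonempty_realIso (h : τ.IsRealStable) (h' : τ'.IsRealStable)
    (hs : E.slope = E'.slope) (f : Hom E E') (hf : f.IsNonzero) : Nonempty (RealIso τ τ') := by
  obtain ⟨g, ⟨x₀, v₀, hv₀⟩, hg⟩ := exists_commutes τ τ' f hf
  obtain ⟨K, I, hrk, hK, hI, hKle, hIle, hdeg, heq⟩ := g.exists_kernel_image_degree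
  have hKτ : τ.Preserves K := by
    refine preserves_of_eventually fun x => ?_
    have hσ : Filter.Tendsto σ (𝓝[≠] x) (𝓝[≠] (σ x)) := by
      have := tendsto_involution_nhdsNE σ (σ x)
      rwa [σ.involutive] at this
    filter_upwards [hσ.eventually (hK (σ x))] with y h2 v hv
    rw [h2, LinearMap.mem_ker, hg, LinearMap.mem_ker.1 (hKle y hv), map_zero]
  have hIτ : τ'.Preserves I := by
    refine preserves_of_eventually fun x => ?_
    filter_upwards [hI x] with y h1 v hv
    rw [h1] at hv
    obtain ⟨w, rfl⟩ := hv
    rw [← hg]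
    exact hIle _ (LinearMap.mem_range_self _ _)
  have hKtop : K.carrier ≠ ⊤ := fun h0 => hv₀ (hKle x₀ (by rw [h0]; trivial))
  have hIbot : I.carrier ≠ ⊥ := fun h0 => hv₀ (by
    have := hIle x₀ (LinearMap.mem_range_self _ v₀)
    rw [h0] at this
    exact this)
  have hE : E.degree = E.slope * E.rk := by
    rw [slope, div_mul_cancel₀]
    exact_mod_cast h.1.ne'
  have hE' : E'.degree = E.slope * E'.rk := by
    rw [hs, slope, div_mul_cancel₀]
    exact_mod_cast h'.1.ne'
  have hrk' : (K.rk : ℝ) + I.rk = E.rk := by exact_mod_cast hrk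
  have hIdeg : I.toBundle.degree ≤ E.slope * I.rk ∧
      (I.toBundle.degree = E.slope * I.rk → I.carrier = ⊤) := by
    by_cases hIt : I.carrier = ⊤
    · refine ⟨?_, fun _ => hIt⟩
      rw [Subbundle.degree_of_eq_top hIt, hE', I.rk_eq_iff.2 hIt]
    · have := h'.degree_lt hIτ hIbot hIt
      rw [← hs] at this
      exact ⟨this.le, fun h0 => absurd h0 this.ne⟩
  have hKbot : K.carrier = ⊥ := by
    by_contra hKb
    have := h.degree_lt hKτ hKb hKtop
    have hmul : E.slope * (K.rk : ℝ) + E.slope * I.rk = E.slope * E.rk := by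
      rw [← mul_add, hrk']
    linarith [hIdeg.1]
  rw [Subbundle.degree_of_eq_bot hKbot, zero_add] at hdeg heq
  have hK0 : (K.rk : ℝ) = 0 := by exact_mod_cast K.rk_eq_zero_iff.2 hKbot
  have hIrk : (I.rk : ℝ) = E.rk := by linarith
  rw [hIrk, ← hE] at hIdeg
  have hbij : ∀ x, Function.Bijective (g.toFun x) := by
    intro x
    obtain ⟨h1, h2⟩ := heq (le_antisymm hdeg hIdeg.1) x
    constructor
    · rw [← LinearMap.ker_eq_bot, ← h1, hKbot]
      rfl
    · rw [← LinearMap.range_eq_top, ← h2, hIdeg.2 (le_antisymm hIdeg.1 hdeg)]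
      rfl
  exact ⟨⟨g.toIso hbij, hg⟩⟩

end RealStructure

end HolBundle

end

/-! ### The lattice of subbundles of maximal slope -/

noncomputable section

namespace HolBundle

variable {M : Type v} [TopologicalSpace M] [ChartedSpace ℂ M] {σ : AntiholInvolution M}
  {E : HolBundle.{u} M}

namespace RealStructure

variable (τ : RealStructure σ E)

theorem conj_section_apply {c u : ∀ y, E.Fib y} (h : ∀ z, u (σ z) = τ.conj z (c z)) (y : M) :
    τ.conj y (u y) = c (σ y) := by
  have h1 : HEq (τ.conj (σ (σ y)) (u (σ (σ y)))) (c (σ y)) := by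
    rw [h (σ y)]
    exact τ.conj_conj_heq _ _
  have h2 : HEq (τ.conj (σ (σ y)) (u (σ (σ y)))) (τ.conj y (u y)) := by
    have key : ∀ w, w = y → HEq (τ.conj w (u w)) (τ.conj y (u y)) := by
      rintro w rfl
      rfl
    exact key _ (σ.involutive y)
  exact eq_of_heq (h2.symm.trans h1)

/-- The image of a subbundle under the real structure. -/
def conjSub (F : E.Subbundle) : E.Subbundle where
  carrier y := (F.carrier (σ y)).comap (τ.conj y)
  rk := F.rk
  exists_sections x := by
    obtain ⟨c, hc⟩ := F.exists_sections (σ x)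
    choose u hu using fun i => τ.exists_conj_section (c i)
    have hσ : Filter.Tendsto σ (𝓝 x) (𝓝 (σ x)) := σ.continuous.tendsto x
    refine ⟨u, ?_⟩
    filter_upwards [hσ.eventually hc] with y hy
    have h1 : ∀ i, τ.conj y (u i y) = c i (σ y) := fun i => τ.conj_section_apply (hu i) y
    refine ⟨fun i => ?_, ?_, ?_⟩
    · have h2 := τ.antihol _ _ _ (hu i) (hy.1 i)
      rwa [σ.involutive] at h2
    · rw [Fintype.linearIndependent_iff]
      intro g hg i
      have h2 := congrArg (τ.conj y) hg
      simp only [map_sum, LinearMap.map_smulₛₗ, h1, map_zero] at h2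
      have h3 := Fintype.linearIndependent_iff.1 hy.2.1 _ h2 i
      simpa using h3
    · have h2 : F.carrier (σ y) =
          (Submodule.span ℂ (Set.range fun i => u i y)).map (τ.conj y) := by
        rw [hy.2.2, Submodule.map_span, ← Set.range_comp]
        congr 2
        funext i
        exact (h1 i).symm
      rw [h2, Submodule.comap_map_eq_of_injective (τ.conj_injective y)]

theorem conjSub_conjSub (F : E.Subbundle) : (τ.conjSub (τ.conjSub F)).carrier = F.carrier := by
  funext x
  ext v
  change τ.conj (σ x) (τ.conj x v) ∈ F.carrier (σ (σ x)) ↔ v ∈ F.carrier x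
  have key : ∀ (y : M) (h : y = x) (w : E.Fib y), HEq w v →
      (w ∈ F.carrier y ↔ v ∈ F.carrier x) := by
    rintro y rfl w h
    rw [eq_of_heq h]
  exact key _ (σ.involutive x) _ (τ.conj_conj_heq x v)

theorem conjSub_mono {F G : E.Subbundle} (h : F.carrier ≤ G.carrier) :
    (τ.conjSub F).carrier ≤ (τ.conjSub G).carrier := fun x _ hv => h (σ x) hv

theorem preserves_iff_le (F : E.Subbundle) :
    τ.Preserves F ↔ F.carrier ≤ (τ.conjSub F).carrier := Iff.rfl

theorem preserves_iff_eq (F : E.Subbundle) :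
    τ.Preserves F ↔ (τ.conjSub F).carrier = F.carrier := by
  rw [preserves_iff_le]
  refine ⟨fun h => le_antisymm ?_ h, fun h => h.ge⟩
  have := τ.conjSub_mono h
  rwa [conjSub_conjSub] at this

variable [IsManifold 𝓘(ℂ) ω M] [CompactSpace M] [T2Space M]

theorem degree_conjSub (F : E.Subbundle) :
    (τ.conjSub F).toBundle.degree = F.toBundle.degree :=
  AntiHom.degree_eq (σ := σ)
    { toFun := fun x =>
        { toFun := fun v => ⟨τ.conj x v.1, v.2⟩
          map_add' := fun v w => Subtype.ext (map_add (τ.conj x) v.1 w.1)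
          map_smul' := fun a v => Subtype.ext ((τ.conj x).map_smulₛₗ a v.1) }
      injective := fun x _ _ h =>
        Subtype.ext (τ.conj_injective x (congrArg (F.carrier (σ x)).subtype h))
      antihol := fun s t x hst hs =>
        τ.antihol (fun y => (s y).1) (fun y => (t y).1) x
          (fun y => congrArg (F.carrier (σ y)).subtype (hst y)) hs } rfl

end RealStructure

variable [IsManifold 𝓘(ℂ) ω M] [CompactSpace M] [T2Space M] [ConnectedSpace M]

theorem degree_eq_slope_mul (E : HolBundle.{u} M) : E.degree = E.slope * E.rk := by
  rcases Nat.eq_zero_or_pos E.rk with h | h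
  · rw [degree_eq_zero_of_rk h, h, Nat.cast_zero, mul_zero]
  · rw [slope, div_mul_cancel₀]
    exact_mod_cast h.ne'

theorem IsSemistable.degree_le (hE : E.IsSemistable) (F : E.Subbundle) :
    F.toBundle.degree ≤ E.slope * F.rk := by
  by_cases h0 : F.carrier = ⊥
  · rw [Subbundle.degree_of_eq_bot h0, F.rk_eq_zero_iff.2 h0, Nat.cast_zero, mul_zero]
  by_cases h1 : F.carrier = ⊤
  · rw [Subbundle.degree_of_eq_top h1, F.rk_eq_iff.2 h1, ← degree_eq_slope_mul]
  have h2 := hE F h0 h1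
  have h3 : 0 < F.rk := Nat.pos_of_ne_zero fun h => h0 (F.rk_eq_zero_iff.1 h)
  rwa [slope, div_le_iff₀ (by exact_mod_cast h3)] at h2

/-- The intersection and the sum of two subbundles of maximal slope are subbundles, and again of
maximal slope. -/
theorem IsSemistable.exists_inf_sup (hE : E.IsSemistable) {F G : E.Subbundle}
    (hF : F.toBundle.degree = E.slope * F.rk) (hG : G.toBundle.degree = E.slope * G.rk) :
    (∃ S : E.Subbundle, S.toBundle.degree = E.slope * S.rk ∧
      S.carrier = F.carrier ⊓ G.carrier) ∧
    (∃ T : E.Subbundle, T.toBundle.degree = E.slope * T.rk ∧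
      T.carrier = F.carrier ⊔ G.carrier) := by
  let f : Hom F.toBundle G.quotient := G.proj.comp F.incl
  obtain ⟨K, I, hrk, hK, hI, hKle, hIle, hdeg, heq⟩ := f.exists_kernel_image_degree
  obtain ⟨S, hS, hSrk, hSd⟩ := (F.incl.comp K.incl).exists_image fun x =>
    (F.incl_injective x).comp (K.incl_injective x)
  obtain ⟨T, hT, hTrk, hTd⟩ := (I.proj.comp G.proj).exists_kernel fun x =>
    (I.proj_surjective x).comp (G.proj_surjective x)
  have hSle := hE.degree_le S
  have hTle := hE.degree_le T
  have hTd' : T.toBundle.degree = G.toBundle.degree + I.toBundle.degree := by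
    rw [hTd, I.degree_quotient, G.degree_quotient]
    ring
  have hrk' : (S.rk : ℝ) + T.rk = F.rk + G.rk := by
    have h1 : K.rk + I.rk = F.rk := hrk
    have h2 : T.rk + (G.quotient.rk - I.rk) = E.rk := hTrk
    have h3 : G.quotient.rk = E.rk - G.rk := rfl
    have h4 : I.rk ≤ G.quotient.rk := I.rk_le
    have h5 : G.rk ≤ E.rk := G.rk_le
    have h6 : S.rk = K.rk := hSrk
    have : S.rk + T.rk = F.rk + G.rk := by omega
    exact_mod_cast this
  have hsum : E.slope * (S.rk : ℝ) + E.slope * T.rk = E.slope * F.rk + E.slope * G.rk := by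
    rw [← mul_add, hrk', mul_add]
  have heq' := heq (by linarith)
  refine ⟨⟨S, by linarith, ?_⟩, ⟨T, by linarith, ?_⟩⟩
  · funext x
    have h1 : S.carrier x = (K.carrier x).map (F.carrier x).subtype := by
      rw [hS, ← K.range_incl]
      exact LinearMap.range_comp _ _
    rw [h1, (heq' x).1]
    have h2 : LinearMap.ker (f.toFun x) = (G.carrier x).comap (F.carrier x).subtype := by
      change LinearMap.ker ((G.carrier x).mkQ ∘ₗ (F.carrier x).subtype) = _
      rw [LinearMap.ker_comp, Submodule.ker_mkQ]
    rw [h2]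
    exact Submodule.map_comap_subtype _ _
  · funext x
    have h1 : T.carrier x = (I.carrier x).comap (G.carrier x).mkQ := by
      rw [hT, ← I.ker_proj]
      exact LinearMap.ker_comp _ _
    rw [h1, (heq' x).2]
    have h2 : LinearMap.range (f.toFun x) = (F.carrier x).map (G.carrier x).mkQ := by
      change LinearMap.range ((G.carrier x).mkQ ∘ₗ (F.carrier x).subtype) = _
      rw [LinearMap.range_comp, Submodule.range_subtype]
    rw [h2]
    change Submodule.comap (G.carrier x).mkQ (Submodule.map (G.carrier x).mkQ (F.carrier x)) = _
    rw [Submodule.comap_map_mkQ, sup_comm]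
    rfl

/-- The subbundles of a semistable bundle that have the same slope as the bundle, and the zero
subbundle. They form a modular lattice of finite length, whose operations are the fibrewise ones. -/
structure MaxSlope (hE : E.IsSemistable) where
  /-- The underlying subbundle. -/
  toSubbundle : E.Subbundle
  degree_eq : toSubbundle.toBundle.degree = E.slope * toSubbundle.rk

namespace MaxSlope

variable {hE : E.IsSemistable}

/-- The fibres of a subbundle of maximal slope. -/
def carrier (F : MaxSlope hE) : ∀ x, Submodule ℂ (E.Fib x) := F.1.carrier

theorem carrier_injective : Function.Injective (carrier (hE := hE)) := by
  rintro ⟨F, hF⟩ ⟨G, hG⟩ h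
  obtain rfl : F = G := Subbundle.carrier_injective h
  rfl

instance : PartialOrder (MaxSlope hE) := PartialOrder.lift carrier carrier_injective

theorem le_def {F G : MaxSlope hE} : F ≤ G ↔ F.1.carrier ≤ G.1.carrier := Iff.rfl

theorem exists_inf (F G : MaxSlope hE) :
    ∃ S : MaxSlope hE, S.carrier = F.carrier ⊓ G.carrier := by
  obtain ⟨S, h1, h2⟩ := (hE.exists_inf_sup F.2 G.2).1
  exact ⟨⟨S, h1⟩, h2⟩

theorem exists_sup (F G : MaxSlope hE) :
    ∃ S : MaxSlope hE, S.carrier = F.carrier ⊔ G.carrier := by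
  obtain ⟨S, h1, h2⟩ := (hE.exists_inf_sup F.2 G.2).2
  exact ⟨⟨S, h1⟩, h2⟩

instance : Lattice (MaxSlope hE) where
  sup F G := (exists_sup F G).choose
  inf F G := (exists_inf F G).choose
  le_sup_left F G := by
    change F.carrier ≤ (exists_sup F G).choose.carrier
    rw [(exists_sup F G).choose_spec]
    exact le_sup_left
  le_sup_right F G := by
    change G.carrier ≤ (exists_sup F G).choose.carrier
    rw [(exists_sup F G).choose_spec]
    exact le_sup_right
  sup_le F G H h1 h2 := by
    change (exists_sup F G).choose.carrier ≤ H.carrier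
    rw [(exists_sup F G).choose_spec]
    exact sup_le h1 h2
  inf_le_left F G := by
    change (exists_inf F G).choose.carrier ≤ F.carrier
    rw [(exists_inf F G).choose_spec]
    exact inf_le_left
  inf_le_right F G := by
    change (exists_inf F G).choose.carrier ≤ G.carrier
    rw [(exists_inf F G).choose_spec]
    exact inf_le_right
  le_inf F G H h1 h2 := by
    change F.carrier ≤ (exists_inf G H).choose.carrier
    rw [(exists_inf G H).choose_spec]
    exact le_inf h1 h2

theorem carrier_sup (F G : MaxSlope hE) : (F ⊔ G).1.carrier = F.1.carrier ⊔ G.1.carrier :=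
  (exists_sup F G).choose_spec

theorem carrier_inf (F G : MaxSlope hE) : (F ⊓ G).1.carrier = F.1.carrier ⊓ G.1.carrier :=
  (exists_inf F G).choose_spec

instance : IsModularLattice (MaxSlope hE) where
  sup_inf_le_assoc_of_le {F} G H h := by
    rw [le_def, carrier_inf, carrier_sup, carrier_sup, carrier_inf]
    intro x
    exact IsModularLattice.sup_inf_le_assoc_of_le (G.1.carrier x) (h x)

instance : BoundedOrder (MaxSlope hE) where
  bot := ⟨Subbundle.zero E, by
    rw [Subbundle.degree_of_eq_bot rfl]
    simp [Subbundle.zero]⟩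
  top := ⟨Subbundle.whole E, by
    rw [Subbundle.degree_of_eq_top rfl, degree_eq_slope_mul]
    rfl⟩
  bot_le F := (bot_le : (⊥ : ∀ x, Submodule ℂ (E.Fib x)) ≤ F.carrier)
  le_top F := (le_top : F.carrier ≤ ⊤)

theorem eq_bot_iff_carrier {F : MaxSlope hE} : F = ⊥ ↔ F.1.carrier = ⊥ :=
  carrier_injective.eq_iff.symm

theorem eq_top_iff_carrier {F : MaxSlope hE} : F = ⊤ ↔ F.1.carrier = ⊤ :=
  carrier_injective.eq_iff.symm

theorem rk_strictMono : StrictMono fun F : MaxSlope hE => F.1.rk := by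
  intro F G h
  refine lt_of_le_of_ne (Subbundle.rk_mono h.le) fun h0 => h.ne ?_
  exact carrier_injective (Subbundle.carrier_eq_of_rk_le h.le h0.ge)

instance : WellFoundedLT (MaxSlope hE) := rk_strictMono.wellFoundedLT

instance : WellFoundedGT (MaxSlope hE) := by
  have h : StrictAnti fun F : MaxSlope hE => E.rk - F.1.rk := by
    intro F G h
    have h1 := rk_strictMono h
    have h2 := G.1.rk_le
    simp only at h1 ⊢
    omega
  exact h.wellFoundedGT

/-- The action of a real structure on the subbundles of maximal slope. -/
def conj (τ : RealStructure σ E) (F : MaxSlope hE) : MaxSlope hE :=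
  ⟨τ.conjSub F.1, by rw [τ.degree_conjSub]; exact F.2⟩

theorem conj_conj (τ : RealStructure σ E) (F : MaxSlope hE) : conj τ (conj τ F) = F :=
  carrier_injective (τ.conjSub_conjSub F.1)

theorem conj_mono (τ : RealStructure σ E) {F G : MaxSlope hE} (h : F ≤ G) :
    conj τ F ≤ conj τ G := τ.conjSub_mono h

theorem preserves_iff (τ : RealStructure σ E) (F : MaxSlope hE) :
    τ.Preserves F.1 ↔ conj τ F = F := by
  rw [τ.preserves_iff_eq]
  exact (carrier_injective (hE := hE)).eq_iff (a := conj τ F) (b := F)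

end MaxSlope

end HolBundle

end

/-! ### Weights on modular lattices -/

noncomputable section

section ModularLattice

variable {X : Type*} [Lattice X] [IsModularLattice X] [WellFoundedLT X]

/-- `w` is the sum of the weights `wt x y` of the steps of a maximal chain from `a` to the given
element. -/
inductive ChainWeight (wt : X → X → ℕ) (a : X) : X → ℕ → Prop
  | refl : ChainWeight wt a a 0
  | step {x y : X} {w : ℕ} : ChainWeight wt a x w → x ⋖ y → ChainWeight wt a y (w + wt x y)

theorem ChainWeight.le {X : Type*} [Lattice X] {wt : X → X → ℕ} {a x : X} {w : ℕ}
    (h : ChainWeight wt a x w) : a ≤ x := by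
  induction h with
  | refl => exact le_rfl
  | step _ h ih => exact ih.trans h.le

variable [WellFoundedGT X]

theorem exists_chainWeight (wt : X → X → ℕ) {a : X} (x : X) (h : a ≤ x) :
    ∃ w, ChainWeight wt a x w := by
  induction x using WellFoundedLT.induction with
  | ind x ih =>
    rcases h.eq_or_lt with rfl | h
    · exact ⟨0, .refl⟩
    · obtain ⟨y, hy, hyx⟩ := exists_le_covBy_of_lt h
      obtain ⟨w, hw⟩ := ih y hyx.lt hy
      exact ⟨_, hw.step hyx⟩

/-- The Jordan–Hölder theorem for weights: if transposed prime quotients have the same weight, then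
the total weight of a maximal chain only depends on its end points. -/
theorem ChainWeight.unique {wt : X → X → ℕ}
    (hwt : ∀ x y : X, x ⊓ y ⋖ x → x ⊓ y ⋖ y → wt x (x ⊔ y) = wt (x ⊓ y) y) {a : X} (x : X)
    {w w' : ℕ}
    (h : ChainWeight wt a x w) (h' : ChainWeight wt a x w') : w = w' := by
  induction x using WellFoundedLT.induction generalizing w w' with
  | ind x ih =>
    cases h with
    | refl =>
      cases h' with
      | refl => rfl
      | step h1 h2 => exact absurd h2.lt h1.le.not_gt
    | @step y _ v h1 h2 =>
      cases h' with
      | refl => exact absurd h2.lt h1.le.not_gt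
      | @step z _ v' h3 h4 =>
        by_cases hyz : y = z
        · subst hyz
          rw [ih y h2.lt h1 h3]
        have hsup : y ⊔ z = x := h2.wcovBy.sup_eq h4.wcovBy hyz
        have h5 : y ⊓ z ⋖ y := inf_covBy_of_covBy_sup_right (by rwa [hsup])
        have h6 : y ⊓ z ⋖ z := inf_covBy_of_covBy_sup_left (by rwa [hsup])
        obtain ⟨u, hu⟩ := exists_chainWeight wt (y ⊓ z) (le_inf h1.le h3.le)
        have h7 := ih y h2.lt h1 (hu.step h5)
        have h8 := ih z h4.lt h3 (hu.step h6)
        have h9 := hwt y z h5 h6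
        have h10 := hwt z y (by rwa [inf_comm]) (by rwa [inf_comm])
        rw [hsup] at h9
        rw [sup_comm, hsup, inf_comm] at h10
        omega

/-- The total weight of the maximal chains from `⊥`, as a function of the end point. -/
theorem exists_weight [OrderBot X] {wt : X → X → ℕ}
    (hwt : ∀ x y : X, x ⊓ y ⋖ x → x ⊓ y ⋖ y → wt x (x ⊔ y) = wt (x ⊓ y) y) :
    ∃ W : X → ℕ, W ⊥ = 0 ∧ ∀ x y, x ⋖ y → W y = W x + wt x y := by
  choose W hW using fun x : X => exists_chainWeight wt x bot_le
  exact ⟨W, ChainWeight.unique hwt ⊥ (hW ⊥) .refl, fun x y h =>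
    ChainWeight.unique hwt y (hW y) ((hW x).step h)⟩

end ModularLattice

theorem Fin.eq_sum_of_succ {n : ℕ} {a : Fin (n + 1) → ℕ} {d : Fin n → ℕ} (h0 : a 0 = 0)
    (h : ∀ i : Fin n, a i.succ = a i.castSucc + d i) : a (Fin.last n) = ∑ i, d i := by
  induction n with
  | zero => simpa using h0
  | succ n ih =>
    rw [Fin.sum_univ_castSucc, ← ih (a := fun i => a i.castSucc) h0 fun i => h i.castSucc]
    exact h (Fin.last n)

/-- Two finite families with the same number of members in every class are equal up to order. -/
theorem exists_equiv_of_card_fiber_eq {α β Q : Type*} [Finite α] [Finite β] {f : α → Q} {g : β → Q}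
    (hf : ∀ a, Nat.card {b // g b = f a} = Nat.card {a' // f a' = f a})
    (hg : ∀ b, Nat.card {b' // g b' = g b} = Nat.card {a // f a = g b}) :
    ∃ e : α ≃ β, ∀ a, g (e a) = f a := by
  have h : ∀ q, Nonempty ({a // f a = q} ≃ {b // g b = q}) := by
    intro q
    apply (Finite.card_eq (α := {a // f a = q}) (β := {b // g b = q})).1
    by_cases h1 : ∃ a, f a = q
    · obtain ⟨a, rfl⟩ := h1
      exact (hf a).symm
    by_cases h2 : ∃ b, g b = q
    · obtain ⟨b, rfl⟩ := h2
      exact (hg b).symm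
    have : IsEmpty {a // f a = q} := ⟨fun a => h1 ⟨a.1, a.2⟩⟩
    have : IsEmpty {b // g b = q} := ⟨fun b => h2 ⟨b.1, b.2⟩⟩
    simp
  have e := fun q => (h q).some
  exact ⟨Equiv.ofFiberEquiv e, fun a => Equiv.ofFiberEquiv_map e a⟩

end

/-! ### Quotients in the lattice -/

noncomputable section

namespace HolBundle

variable {M : Type v} [TopologicalSpace M] [ChartedSpace ℂ M] {σ : AntiholInvolution M}

/-- There is a non-zero homomorphism. -/
def HasHom (E E' : HolBundle.{u} M) : Prop := ∃ f : Hom E E', f.IsNonzero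

theorem HasHom.comp_surjective {E E' G : HolBundle.{u} M} (h : HasHom E' G) (p : Hom E E')
    (hp : ∀ x, Function.Surjective (p.toFun x)) : HasHom E G := by
  obtain ⟨f, x, v, hv⟩ := h
  obtain ⟨w, rfl⟩ := hp x v
  exact ⟨f.comp p, x, w, hv⟩

theorem Iso.hasHom_iff {E E' G : HolBundle.{u} M} (f : Iso E E') :
    HasHom E G ↔ HasHom E' G :=
  ⟨fun h => h.comp_surjective f.invHom fun x => (f.toEquiv x).symm.surjective,
    fun h => h.comp_surjective f.toHom fun x => (f.toEquiv x).surjective⟩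

theorem hasHom_of_injective [Nonempty M] {E G : HolBundle.{u} M} (h : 0 < E.rk) (f : Hom E G)
    (hf : ∀ x, Function.Injective (f.toFun x)) : HasHom E G := by
  obtain ⟨x⟩ := ‹Nonempty M›
  have : Nontrivial (E.Fib x) := Module.nontrivial_of_finrank_pos (R := ℂ) (by rwa [E.finrank_fib])
  obtain ⟨v, hv⟩ := exists_ne (0 : E.Fib x)
  exact ⟨f, x, v, (map_ne_zero_iff _ (hf x)).2 hv⟩

theorem Iso.rk_eq [Nonempty M] {E E' : HolBundle.{u} M} (f : Iso E E') : E.rk = E'.rk := by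
  obtain ⟨x⟩ := ‹Nonempty M›
  have := (f.toEquiv x).finrank_eq
  rwa [E.finrank_fib, E'.finrank_fib] at this

variable [IsManifold 𝓘(ℂ) ω M] [CompactSpace M] [T2Space M] [ConnectedSpace M]
  {E : HolBundle.{u} M}

namespace MaxSlope

variable {hE : E.IsSemistable}

open Classical in
/-- The weight of the quotient `B / A` with respect to `G`: its rank if it has a non-zero
homomorphism to `G`, and zero otherwise. -/
def weight (G : HolBundle.{u} M) (A B : MaxSlope hE) : ℕ :=
  if ∃ h : A ≤ B, HasHom (A.1.subquotient B.1 (le_def.1 h)) G then B.1.rk - A.1.rk else 0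

open Classical in
theorem weight_of_le (G : HolBundle.{u} M) {A B : MaxSlope hE} (h : A ≤ B) :
    weight G A B = if HasHom (A.1.subquotient B.1 (le_def.1 h)) G then B.1.rk - A.1.rk else 0 := by
  simp only [weight, h, exists_true_left]

/-- The isomorphism `B / (A ⊓ B) ≅ (A ⊔ B) / A`. -/
def isoOfTransposed {A B C D : MaxSlope hE} (hCB : C ≤ B) (hAD : A ≤ D) (hC : C = A ⊓ B)
    (hD : D = A ⊔ B) : Iso (C.1.subquotient B.1 (le_def.1 hCB))
      (A.1.subquotient D.1 (le_def.1 hAD)) :=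
  (Subbundle.subquotientMap (le_def.1 hCB) (le_def.1 hAD) (le_def.1 (hC ▸ inf_le_left))
    (le_def.1 (hD ▸ le_sup_right))).toIso fun x =>
      ⟨Subbundle.subquotientMap_injective _ _ _ _ (by rw [hC, carrier_inf]) x,
        Subbundle.subquotientMap_surjective _ _ _ _ (by rw [hD, carrier_sup]) x⟩

/-- Transposed quotients are isomorphic, so they have the same weight. -/
theorem weight_transposed (G : HolBundle.{u} M) (A B : MaxSlope hE) :
    weight G A (A ⊔ B) = weight G (A ⊓ B) B := by
  let f := isoOfTransposed (A := A) (B := B) inf_le_right le_sup_left rfl rfl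
  have hrk := f.rk_eq
  rw [Subbundle.rk_subquotient, Subbundle.rk_subquotient] at hrk
  rw [weight_of_le G le_sup_left, weight_of_le G inf_le_right, hrk]
  classical exact if_congr f.hasHom_iff.symm rfl rfl

theorem rk_subquotient_pos {A B : MaxSlope hE} (h : A < B) :
    0 < (A.1.subquotient B.1 (le_def.1 h.le)).rk := by
  have := rk_strictMono h
  rw [Subbundle.rk_subquotient]
  simp only at this
  omega

theorem degree_subquotient {A B : MaxSlope hE} (h : A ≤ B) :
    (A.1.subquotient B.1 (le_def.1 h)).degree =
      E.slope * (A.1.subquotient B.1 (le_def.1 h)).rk := by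
  rw [Subbundle.degree_subquotient, Subbundle.rk_subquotient, A.2, B.2,
    Nat.cast_sub (Subbundle.rk_mono (le_def.1 h))]
  ring

theorem slope_subquotient {A B : MaxSlope hE} (h : A < B) :
    (A.1.subquotient B.1 (le_def.1 h.le)).slope = E.slope := by
  have := rk_subquotient_pos h
  rw [slope, degree_subquotient h.le, mul_div_cancel_right₀]
  exact_mod_cast this.ne'

/-- An intermediate element `A < C < B`, as a subbundle of `B / A` with the same slope. -/
theorem exists_subbundle_subquotient {A B C : MaxSlope hE} (hAC : A < C) (hCB : C < B) :
    ∃ F : (A.1.subquotient B.1 (le_def.1 (hAC.trans hCB).le)).Subbundle,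
      F.carrier ≠ ⊥ ∧ F.carrier ≠ ⊤ ∧
      F.toBundle.slope = (A.1.subquotient B.1 (le_def.1 (hAC.trans hCB).le)).slope ∧
      ∀ x, F.carrier x = LinearMap.range ((Subbundle.subquotientMap (le_def.1 hAC.le)
        (le_def.1 (hAC.trans hCB).le) le_rfl (le_def.1 hCB.le)).toFun x) := by
  obtain ⟨F, hF, hFrk, hFd⟩ := (Subbundle.subquotientMap (le_def.1 hAC.le)
    (le_def.1 (hAC.trans hCB).le) le_rfl (le_def.1 hCB.le)).exists_image
      (Subbundle.subquotientMap_injective _ _ _ _ inf_le_left)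
  have h1 := rk_subquotient_pos hAC
  have h2 := rk_strictMono hCB
  have h3 := rk_strictMono hAC
  simp only at h2 h3
  refine ⟨F, fun h => ?_, fun h => ?_, ?_, hF⟩
  · have := F.rk_eq_zero_iff.2 h
    omega
  · have := F.rk_eq_iff.2 h
    rw [hFrk, Subbundle.rk_subquotient, Subbundle.rk_subquotient] at this
    omega
  · have h4 : F.toBundle.rk = (A.1.subquotient C.1 (le_def.1 hAC.le)).rk := hFrk
    rw [slope_subquotient (hAC.trans hCB), ← slope_subquotient hAC, slope, hFd, h4, slope]

/-- A step with stable quotient is prime: an intermediate element would give a subbundle of the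
quotient of the same slope. -/
theorem covBy_of_isStable {A B : MaxSlope hE} (h : A ≤ B)
    (hs : (A.1.subquotient B.1 (le_def.1 h)).IsStable) : A ⋖ B := by
  refine ⟨lt_of_le_of_ne h fun h0 => ?_, fun C hAC hCB => ?_⟩
  · have := hs.1
    rw [Subbundle.rk_subquotient, h0] at this
    omega
  · obtain ⟨F, h0, h1, h2, -⟩ := exists_subbundle_subquotient hAC hCB
    exact (hs.2 F h0 h1).ne h2

/-- A step whose quotient is stable as a real bundle is prime among the real elements. -/
theorem eq_or_eq_of_isRealStable {τ : RealStructure σ E} {A B : MaxSlope hE} (h : A ≤ B)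
    (hA : τ.Preserves A.1) (hB : τ.Preserves B.1)
    (hs : (τ.subquotient A.1 B.1 (le_def.1 h) hA hB).IsRealStable) {C : MaxSlope hE}
    (hC : τ.Preserves C.1)
    (hAC : A ≤ C) (hCB : C ≤ B) : C = A ∨ C = B := by
  by_contra! hcon
  obtain ⟨F, h0, h1, h2, h3⟩ := exists_subbundle_subquotient (lt_of_le_of_ne hAC hcon.1.symm)
    (lt_of_le_of_ne hCB hcon.2)
  refine (hs.2 F ?_ h0 h1).ne h2
  intro x v hv
  rw [h3] at hv ⊢
  obtain ⟨w, rfl⟩ := hv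
  obtain ⟨w, rfl⟩ := Submodule.Quotient.mk_surjective _ w
  exact ⟨Submodule.Quotient.mk ⟨τ.conj x w.1, hC x _ w.2⟩, rfl⟩

/-- A subbundle `F` of `B / A` comes from a subbundle between `A` and `B`. -/
theorem exists_subbundle_between {A B : E.Subbundle} (h : A.carrier ≤ B.carrier)
    (F : (A.subquotient B h).Subbundle) : ∃ C : E.Subbundle, A.carrier ≤ C.carrier ∧
      C.carrier ≤ B.carrier ∧ C.rk = A.rk + F.rk ∧
      C.toBundle.degree = A.toBundle.degree + F.toBundle.degree ∧
      ∀ x (v : E.Fib x), v ∈ C.carrier x ↔ ∃ hv : v ∈ B.carrier x,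
        (A.restrict B h).proj.toFun x ⟨v, hv⟩ ∈ F.carrier x := by
  obtain ⟨K, hK, hKrk, hKd⟩ := (F.proj.comp (A.restrict B h).proj).exists_kernel fun x =>
    (F.proj_surjective x).comp ((A.restrict B h).proj_surjective x)
  obtain ⟨C, hC, hCrk, hCd⟩ := (B.incl.comp K.incl).exists_image fun x =>
    (B.incl_injective x).comp (K.incl_injective x)
  have hmem : ∀ x (v : E.Fib x), v ∈ C.carrier x ↔ ∃ hv : v ∈ B.carrier x,
        (A.restrict B h).proj.toFun x ⟨v, hv⟩ ∈ F.carrier x := by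
    intro x v
    have hKm : ∀ w, w ∈ K.carrier x ↔ (A.restrict B h).proj.toFun x w ∈ F.carrier x := by
      intro w
      rw [hK, ← F.ker_proj]
      rfl
    rw [hC]
    constructor
    · rintro ⟨w, rfl⟩
      exact ⟨w.1.2, (hKm _).1 w.2⟩
    · rintro ⟨hv, h1⟩
      exact ⟨⟨⟨v, hv⟩, (hKm _).2 h1⟩, rfl⟩
  have h1 : C.rk = K.rk := hCrk
  have h2 : K.rk + ((A.subquotient B h).rk - F.rk) = B.rk := hKrk
  have h3 := Subbundle.rk_subquotient h
  have h4 := Subbundle.rk_mono h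
  have h5 := F.rk_le
  refine ⟨C, fun x v hv => ?_, fun x v hv => ((hmem x v).1 hv).1, by omega, ?_, hmem⟩
  · refine (hmem x v).2 ⟨h x hv, ?_⟩
    have : (A.restrict B h).proj.toFun x ⟨v, h x hv⟩ = 0 :=
      (Submodule.Quotient.mk_eq_zero _).2 hv
    rw [this]
    exact Submodule.zero_mem _
  · rw [hCd, hKd, F.degree_quotient, Subbundle.degree_subquotient]
    ring

/-- If a step is prime among the real elements, then its quotient is stable as a real bundle: a
real subbundle of the quotient with the same slope would give an intermediate real element. -/
theorem isRealStable_of_covBy {τ : RealStructure σ E} {A B : MaxSlope hE} (h : A < B)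
    (hA : τ.Preserves A.1) (hB : τ.Preserves B.1)
    (hcov : ∀ C : MaxSlope hE, τ.Preserves C.1 → A ≤ C → C ≤ B → C = A ∨ C = B) :
    (τ.subquotient A.1 B.1 (le_def.1 h.le) hA hB).IsRealStable := by
  refine ⟨rk_subquotient_pos h, fun F hF h0 h1 => ?_⟩
  obtain ⟨C, hAC, hCB, hrk, hdeg, hmem⟩ := exists_subbundle_between (le_def.1 h.le) F
  have hFrk : 0 < F.rk := Nat.pos_of_ne_zero fun h => h0 (F.rk_eq_zero_iff.1 h)
  have hFrk' : F.rk ≠ (A.1.subquotient B.1 (le_def.1 h.le)).rk := fun h => h1 (F.rk_eq_iff.1 h)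
  have hle := hE.degree_le C
  have hrk' : (C.rk : ℝ) = A.1.rk + F.rk := by exact_mod_cast hrk
  rw [hrk', hdeg, A.2, mul_add] at hle
  rw [slope_subquotient h, slope, div_lt_iff₀ (by exact_mod_cast hFrk)]
  refine lt_of_le_of_ne (by simpa using! hle) fun heq => ?_
  have hCd : C.toBundle.degree = E.slope * C.rk := by
    rw [hdeg, hrk', A.2, mul_add, heq]
    rfl
  have hCτ : τ.Preserves C := by
    intro x v hv
    obtain ⟨hvB, hv⟩ := (hmem x v).1 hv
    exact (hmem _ _).2 ⟨hB x v hvB, hF x _ hv⟩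
  rcases hcov ⟨C, hCd⟩ hCτ hAC hCB with h2 | h2
  · have h3 : C = A.1 := congrArg MaxSlope.toSubbundle h2
    rw [h3] at hrk
    omega
  · have h3 : C = B.1 := congrArg MaxSlope.toSubbundle h2
    rw [h3] at hrk
    rw [Subbundle.rk_subquotient] at hFrk'
    omega

end MaxSlope

end HolBundle

end

/-! ### Real Jordan–Hölder filtrations -/

noncomputable section

namespace HolBundle

variable {M : Type v} [TopologicalSpace M] [ChartedSpace ℂ M] {σ : AntiholInvolution M}

namespace RealIso

variable {E E' E'' : HolBundle.{u} M} {τ : RealStructure σ E} {τ' : RealStructure σ E'}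
  {τ'' : RealStructure σ E''}

/-- The identity of a real bundle. -/
def refl (τ : RealStructure σ E) : RealIso τ τ where
  toEquiv _ := LinearEquiv.refl ℂ _
  hol _ _ := Iff.rfl
  comm _ _ := rfl

/-- The inverse of an isomorphism of real bundles. -/
def symm (f : RealIso τ τ') : RealIso τ' τ where
  toEquiv x := (f.toEquiv x).symm
  hol s x := by
    rw [f.hol]
    simp
  comm x v := by
    rw [LinearEquiv.symm_apply_eq, f.comm, LinearEquiv.apply_symm_apply]

/-- The composition of isomorphisms of real bundles. -/
def trans (f : RealIso τ τ') (g : RealIso τ' τ'') : RealIso τ τ'' where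
  toEquiv x := (f.toEquiv x).trans (g.toEquiv x)
  hol s x := by
    rw [f.hol, g.hol]
    rfl
  comm x v := by
    simp only [LinearEquiv.trans_apply, f.comm, g.comm]

end RealIso

/-- Isomorphism of real bundles, as an equivalence relation. -/
def realSetoid (σ : AntiholInvolution M) :
    Setoid (Σ G : HolBundle.{u} M, RealStructure σ G) where
  r a b := Nonempty (RealIso a.2 b.2)
  iseqv :=
    { refl := fun a => ⟨.refl a.2⟩
      symm := fun ⟨f⟩ => ⟨f.symm⟩
      trans := fun ⟨f⟩ ⟨g⟩ => ⟨f.trans g⟩ }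

variable [IsManifold 𝓘(ℂ) ω M] [CompactSpace M] [T2Space M] [ConnectedSpace M]
  {E : HolBundle.{u} M}

theorem RealStructure.IsRealStable.hasHom_iff {G G' : HolBundle.{u} M} {τ : RealStructure σ G}
    {τ' : RealStructure σ G'} (h : τ.IsRealStable) (h' : τ'.IsRealStable)
    (hs : G.slope = G'.slope) : HasHom G G' ↔ Nonempty (RealIso τ τ') := by
  refine ⟨fun ⟨f, hf⟩ => h.nonempty_realIso h' hs f hf, fun ⟨f⟩ => ?_⟩
  exact hasHom_of_injective h.1 f.toHom fun x => (f.toEquiv x).injective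

namespace MaxSlope

variable {hE : E.IsSemistable} {τ : RealStructure σ E}

theorem conj_le_iff {F G : MaxSlope hE} : conj τ F ≤ G ↔ F ≤ conj τ G := by
  refine ⟨fun h => ?_, fun h => ?_⟩
  · simpa only [conj_conj] using conj_mono τ h
  · simpa only [conj_conj] using conj_mono τ h

theorem conj_inf (F G : MaxSlope hE) : conj τ (F ⊓ G) = conj τ F ⊓ conj τ G := by
  apply le_antisymm
  · exact le_inf (conj_mono τ inf_le_left) (conj_mono τ inf_le_right)
  · rw [← conj_le_iff]
    refine le_inf ?_ ?_ <;> rw [conj_le_iff]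
    exacts [inf_le_left, inf_le_right]

theorem conj_sup (F G : MaxSlope hE) : conj τ (F ⊔ G) = conj τ F ⊔ conj τ G := by
  apply le_antisymm
  · rw [conj_le_iff]
    refine sup_le ?_ ?_ <;> rw [← conj_le_iff]
    exacts [le_sup_left, le_sup_right]
  · exact sup_le (conj_mono τ le_sup_left) (conj_mono τ le_sup_right)

theorem conj_covBy {F G : MaxSlope hE} (h : F ⋖ G) : conj τ F ⋖ conj τ G := by
  have hinj : Function.Injective (conj τ : MaxSlope hE → _) := fun A B h => by
    rw [← conj_conj τ A, h, conj_conj]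
  refine ⟨lt_of_le_of_ne (conj_mono τ h.le) fun h0 => h.ne (hinj h0), fun C h1 h2 => ?_⟩
  refine h.2 (c := conj τ C) (lt_of_le_of_ne (conj_le_iff.1 h1.le) fun h0 => ?_)
    (lt_of_le_of_ne (conj_le_iff.2 h2.le) fun h0 => ?_)
  · rw [h0, conj_conj] at h1
    exact h1.ne rfl
  · rw [← h0, conj_conj] at h2
    exact h2.ne rfl

/-- A step of a real Jordan–Hölder filtration is either prime, or it is the sum of two conjugate
prime steps. -/
theorem exists_conj_of_real {A B : MaxSlope hE} (h : A < B) (hA : conj τ A = A) (hB : conj τ B = B)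
    (hcov : ∀ C : MaxSlope hE, conj τ C = C → A ≤ C → C ≤ B → C = A ∨ C = B) :
    A ⋖ B ∨ ∃ C, A ⋖ C ∧ C ⋖ B ∧ A = C ⊓ conj τ C ∧ B = C ⊔ conj τ C := by
  obtain ⟨C, hAC, hCB⟩ := exists_covBy_le_of_lt h
  rcases hCB.eq_or_lt with rfl | hCB
  · exact Or.inl hAC
  right
  have hAC' : A ⋖ conj τ C := by
    have := conj_covBy (τ := τ) hAC
    rwa [hA] at this
  have hCB' : conj τ C ≤ B := by rw [conj_le_iff, hB]; exact hCB.le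
  have hinf : C ⊓ conj τ C = A := by
    refine (hcov (C ⊓ conj τ C) ?_ (le_inf hAC.le hAC'.le) (inf_le_left.trans hCB.le)).resolve_right
      fun h0 => ?_
    · rw [conj_inf, conj_conj, inf_comm]
    · exact hCB.not_ge (h0 ▸ inf_le_left)
  have hsup : C ⊔ conj τ C = B := by
    refine (hcov (C ⊔ conj τ C) ?_ (hAC.le.trans le_sup_left)
      (sup_le hCB.le hCB')).resolve_left fun h0 => ?_
    · rw [conj_sup, conj_conj, sup_comm]
    · exact hAC.lt.not_ge (h0 ▸ le_sup_left)
  refine ⟨C, hAC, ?_, hinf.symm, hsup.symm⟩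
  have h1 : C ⋖ C ⊔ conj τ C := covBy_sup_of_inf_covBy_right (by rwa [hinf])
  rwa [hsup] at h1

open Classical in
/-- The weight of a step of a real Jordan–Hölder filtration, with respect to a stable real bundle
`(G, θ)`: its rank if it is isomorphic to `(G, θ)`, and zero otherwise. -/
theorem weight_real_step {G : HolBundle.{u} M} {θ : RealStructure σ G} (hθ : θ.IsRealStable)
    (hG : G.slope = E.slope) {W : MaxSlope hE → ℕ}
    (hW : ∀ x y, x ⋖ y → W y = W x + weight G x y) {A B : MaxSlope hE} (h : A < B)
    (hA : τ.Preserves A.1) (hB : τ.Preserves B.1)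
    (hs : (τ.subquotient A.1 B.1 (le_def.1 h.le) hA hB).IsRealStable) :
    W B = W A + if Nonempty (RealIso (τ.subquotient A.1 B.1 (le_def.1 h.le) hA hB) θ) then
      (A.1.subquotient B.1 (le_def.1 h.le)).rk else 0 := by
  have hiff := hs.hasHom_iff hθ ((slope_subquotient h).trans hG.symm)
  rcases exists_conj_of_real (τ := τ) h ((preserves_iff τ A).1 hA) ((preserves_iff τ B).1 hB)
    (fun C hC => eq_or_eq_of_isRealStable h.le hA hB hs ((preserves_iff τ C).2 hC)) with
    h1 | ⟨C, hAC, hCB, hinf, hsup⟩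
  · rw [hW A B h1, weight_of_le G h.le, Subbundle.rk_subquotient]
    simp only [hiff]
  · have hAC' : A ≤ conj τ C := hinf ▸ inf_le_right
    have hCB' : conj τ C ≤ B := hsup ▸ le_sup_right
    have hrkA := rk_strictMono hAC.lt
    have hrkB := rk_strictMono hCB.lt
    simp only at hrkA hrkB
    -- The bundles `C / A ≅ B / conj C` and `B / C ≅ conj C / A` are both subbundles and quotients
    -- of `B / A`. Homomorphisms to `G` are pulled back to `B / A` along the quotient maps;
    -- conversely, an isomorphism `B / A ≅ G` is restricted to the subbundles.
    have h1 : HasHom (A.1.subquotient C.1 (le_def.1 hAC.le)) G ↔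
        HasHom (A.1.subquotient B.1 (le_def.1 h.le)) G := by
      constructor
      · intro h2
        have f := isoOfTransposed hAC.le hCB' (hinf.trans (inf_comm _ _))
          (hsup.trans (sup_comm _ _))
        refine (f.hasHom_iff.1 h2).comp_surjective (Subbundle.subquotientMap (le_def.1 h.le)
          (le_def.1 hCB') (le_def.1 hAC') le_rfl)
          (Subbundle.subquotientMap_surjective _ _ _ _ le_sup_right)
      · rw [hiff]
        rintro ⟨f⟩
        exact hasHom_of_injective (rk_subquotient_pos hAC.lt) (f.toHom.comp
          (Subbundle.subquotientMap (le_def.1 hAC.le) (le_def.1 h.le) le_rfl (le_def.1 hCB.le)))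
          fun x => (f.toEquiv x).injective.comp
            (Subbundle.subquotientMap_injective _ _ _ _ inf_le_left x)
    have h2 : HasHom (C.1.subquotient B.1 (le_def.1 hCB.le)) G ↔
        HasHom (A.1.subquotient B.1 (le_def.1 h.le)) G := by
      constructor
      · intro h2
        exact h2.comp_surjective (Subbundle.subquotientMap (le_def.1 h.le)
          (le_def.1 hCB.le) (le_def.1 hAC.le) le_rfl)
          (Subbundle.subquotientMap_surjective _ _ _ _ le_sup_right)
      · rw [hiff]
        rintro ⟨f⟩
        have g := isoOfTransposed hAC' hCB.le hinf hsup
        have hlt : A < conj τ C := by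
          have := conj_covBy (τ := τ) hAC
          rw [(preserves_iff τ A).1 hA] at this
          exact this.lt
        rw [← g.hasHom_iff]
        exact hasHom_of_injective (rk_subquotient_pos hlt) (f.toHom.comp
          (Subbundle.subquotientMap (le_def.1 hAC') (le_def.1 h.le) le_rfl (le_def.1 hCB')))
          fun x => (f.toEquiv x).injective.comp
            (Subbundle.subquotientMap_injective _ _ _ _ inf_le_left x)
    rw [hW C B hCB, hW A C hAC, weight_of_le G hCB.le, weight_of_le G hAC.le,
      Subbundle.rk_subquotient]
    simp only [h1, h2, hiff]
    split_ifs <;> omega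

end MaxSlope

/-! ### Filtrations -/

namespace Filtration

variable (P : E.Filtration)

theorem degree_step (hs : ∀ i, (P.gr i).slope = E.slope)
    (i : Fin (P.len + 1)) : (P.step i).toBundle.degree = E.slope * (P.step i).rk := by
  induction i using Fin.induction with
  | zero =>
    rw [Subbundle.degree_of_eq_bot P.bot, (P.step 0).rk_eq_zero_iff.2 P.bot, Nat.cast_zero,
      mul_zero]
  | succ i ih =>
    have h1 := degree_eq_slope_mul (P.gr i)
    have h2 : (P.gr i).degree = (P.step i.succ).toBundle.degree -
        (P.step i.castSucc).toBundle.degree := Subbundle.degree_subquotient _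
    have h3 : (P.gr i).rk = (P.step i.succ).rk - (P.step i.castSucc).rk := rfl
    rw [h2, h3, hs, ih, Nat.cast_sub (Subbundle.rk_mono (P.mono i))] at h1
    linarith

/-- The steps of a filtration as subbundles of maximal slope. -/
def maxSlopeStep (hE : E.IsSemistable)
    (hs : ∀ i, (P.gr i).slope = E.slope) (i : Fin (P.len + 1)) : MaxSlope hE :=
  ⟨P.step i, P.degree_step hs i⟩

theorem maxSlopeStep_zero (hE : E.IsSemistable)
    (hs : ∀ i, (P.gr i).slope = E.slope) : P.maxSlopeStep hE hs 0 = ⊥ :=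
  MaxSlope.eq_bot_iff_carrier.2 P.bot

theorem maxSlopeStep_last (hE : E.IsSemistable)
    (hs : ∀ i, (P.gr i).slope = E.slope) : P.maxSlopeStep hE hs (Fin.last _) = ⊤ :=
  MaxSlope.eq_top_iff_carrier.2 P.top

end Filtration

open Classical in
/-- A Jordan–Hölder filtration is a maximal chain, along which the total weight can be computed. -/
theorem Filtration.IsJordanHolder.weight_top {hE : E.IsSemistable} {P : E.Filtration}
    (hP : P.IsJordanHolder) {G : HolBundle.{u} M} {W : MaxSlope hE → ℕ} (h0 : W ⊥ = 0)
    (hW : ∀ x y, x ⋖ y → W y = W x + MaxSlope.weight G x y) :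
    W ⊤ = ∑ i, if HasHom (P.gr i) G then (P.gr i).rk else 0 := by
  have hs := fun i => (hP i).2
  rw [← P.maxSlopeStep_last hE hs]
  refine Fin.eq_sum_of_succ (a := fun i => W (P.maxSlopeStep hE hs i)) ?_ fun i => ?_
  · rw [P.maxSlopeStep_zero hE hs, h0]
  · have hle : P.maxSlopeStep hE hs i.castSucc ≤ P.maxSlopeStep hE hs i.succ := P.mono i
    rw [hW _ _ (MaxSlope.covBy_of_isStable hle (hP i).1), MaxSlope.weight_of_le G hle]
    rfl

open Classical in
/-- The total weight with respect to a stable real bundle is its multiplicity in a real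
Jordan–Hölder filtration times its rank. -/
theorem RealJordanHolder.weight_top {hE : E.IsSemistable} {τ : RealStructure σ E}
    (R : RealJordanHolder τ) {G : HolBundle.{u} M} {θ : RealStructure σ G} (hθ : θ.IsRealStable)
    (hG : G.slope = E.slope) {W : MaxSlope hE → ℕ} (h0 : W ⊥ = 0)
    (hW : ∀ x y, x ⋖ y → W y = W x + MaxSlope.weight G x y) :
    W ⊤ = Nat.card {i // Nonempty (RealIso (R.grReal i) θ)} * G.rk := by
  have hrk := fun i => (R.stable i).1
  have hs := R.slope_eq
  have h1 : W ⊤ = ∑ i, if Nonempty (RealIso (R.grReal i) θ) then (R.gr i).rk else 0 := by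
    rw [← R.maxSlopeStep_last hE hs]
    refine Fin.eq_sum_of_succ (a := fun i => W (R.maxSlopeStep hE hs i)) ?_ fun i => ?_
    · rw [R.maxSlopeStep_zero hE hs, h0]
    · have hle : R.maxSlopeStep hE hs i.castSucc ≤ R.maxSlopeStep hE hs i.succ := R.mono i
      have hlt : R.maxSlopeStep hE hs i.castSucc < R.maxSlopeStep hE hs i.succ := by
        refine lt_of_le_of_ne hle fun h => ?_
        have h2 : (R.gr i).rk = (R.step i.succ).rk - (R.step i.castSucc).rk := rfl
        have h3 : R.step i.castSucc = R.step i.succ := congrArg MaxSlope.toSubbundle h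
        have h4 := hrk i
        rw [h2, h3] at h4
        omega
      exact MaxSlope.weight_real_step hθ hG hW hlt (R.isReal _) (R.isReal _) (R.stable i)
  have h2 : ∀ i, (if Nonempty (RealIso (R.grReal i) θ) then (R.gr i).rk else 0) =
      if Nonempty (RealIso (R.grReal i) θ) then G.rk else 0 := by
    intro i
    refine if_ctx_congr Iff.rfl (fun ⟨f⟩ => f.toIso.rk_eq) fun _ => rfl
  rw [h1, Finset.sum_congr rfl fun i _ => h2 i, ← Finset.sum_filter, Finset.sum_const,
    smul_eq_mul, Nat.card_eq_fintype_card, Fintype.card_subtype]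

/-- A maximal chain of real subbundles of maximal slope is a real Jordan–Hölder filtration. -/
theorem IsSemistable.nonempty_realJordanHolder (hE : E.IsSemistable) (τ : RealStructure σ E) :
    Nonempty (RealJordanHolder τ) := by
  let X := {F : MaxSlope hE // τ.Preserves F.1}
  have hbot : τ.Preserves (⊥ : MaxSlope hE).1 := by
    intro x v hv
    have hv' : v = 0 := hv
    rw [hv', map_zero]
    exact Submodule.zero_mem _
  have htop : τ.Preserves (⊤ : MaxSlope hE).1 := fun x v _ => trivial
  obtain ⟨a, h0, n, hn, hcov⟩ := exists_covBy_seq_of_wellFoundedLT_wellFoundedGT_of_le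
    (α := X) (x := ⟨⊥, hbot⟩) (y := ⟨⊤, htop⟩) (bot_le (α := MaxSlope hE))
  have hlt : ∀ i : Fin n, (a i).1 < (a (i + 1)).1 := fun i => (hcov i i.2).lt
  let P : E.Filtration :=
    { len := n
      step := fun i => (a i).1.1
      bot := by
        change (a 0).1.1.carrier = ⊥
        rw [h0]
        rfl
      top := by
        change (a n).1.1.carrier = ⊤
        rw [hn]
        rfl
      mono := fun i => MaxSlope.le_def.1 (hlt i).le }
  exact ⟨{
    toFiltration := P
    isReal := fun i => (a i).2
    stable := fun i => MaxSlope.isRealStable_of_covBy (hlt i) (a i).2 (a (i + 1)).2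
      fun C hC h1 h2 => by
        rcases (hcov i i.2).eq_or_eq (c := ⟨C, hC⟩) h1 h2 with h | h
        · exact Or.inl (congrArg Subtype.val h)
        · exact Or.inr (congrArg Subtype.val h)
    slope_eq := fun i => MaxSlope.slope_subquotient (hlt i) }⟩

theorem Iso.degree_eq {E E' : HolBundle.{u} M} (f : Iso E E') : E.degree = E'.degree :=
  (degree_eq_of_bijective f.toHom fun x => (f.toEquiv x).bijective).2

theorem Iso.slope_eq {E E' : HolBundle.{u} M} (f : Iso E E') : E.slope = E'.slope := by
  rw [slope, slope, f.degree_eq, f.rk_eq]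

theorem Filtration.rk_eq_zero_of_len (P : E.Filtration) (h : P.len = 0) : E.rk = 0 := by
  have h1 : (P.step 0).carrier = ⊤ := by
    have : (0 : Fin (P.len + 1)) = Fin.last P.len := by
      apply Fin.ext
      simp [h]
    rw [this]
    exact P.top
  rw [← (P.step 0).rk_eq_iff.2 h1]
  exact (P.step 0).rk_eq_zero_iff.2 P.bot

/-- In the absence of pieces both slopes have the value `0 / 0 = 0`. -/
theorem slope_eq_of_gradedIso {E' : HolBundle.{u} M} {P : E.Filtration} {P' : E'.Filtration}
    (hP : P.IsJordanHolder) (hP' : P'.IsJordanHolder) (h : GradedIso P.gr P'.gr) :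
    E.slope = E'.slope := by
  obtain ⟨e, he⟩ := h
  have hlen : P.len = P'.len := by simpa using Fintype.card_congr e
  rcases Nat.eq_zero_or_pos P.len with h0 | h0
  · rw [slope, slope, P.rk_eq_zero_of_len h0, P'.rk_eq_zero_of_len (hlen ▸ h0)]
    simp
  · obtain ⟨f⟩ := he ⟨0, h0⟩
    rw [← (hP _).2, f.slope_eq, (hP' _).2]

/-- A stable real bundle occurs equally often in two real Jordan–Hölder filtrations. -/
theorem RealJordanHolder.card_eq {E' : HolBundle.{u} M} {τ : RealStructure σ E}
    {τ' : RealStructure σ E'} (hE : E.IsSemistable) (hE' : E'.IsSemistable) {P : E.Filtration}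
    {P' : E'.Filtration} (hP : P.IsJordanHolder) (hP' : P'.IsJordanHolder)
    (h : GradedIso P.gr P'.gr) (R : RealJordanHolder τ) (R' : RealJordanHolder τ')
    {G : HolBundle.{u} M} {θ : RealStructure σ G} (hθ : θ.IsRealStable) (hG : G.slope = E.slope) :
    Nat.card {i // Nonempty (RealIso (R.grReal i) θ)} =
      Nat.card {i // Nonempty (RealIso (R'.grReal i) θ)} := by
  classical
  obtain ⟨W, hW0, hW⟩ := exists_weight (X := MaxSlope hE) (wt := MaxSlope.weight G)
    fun A B _ _ => MaxSlope.weight_transposed G A B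
  obtain ⟨W', hW0', hW'⟩ := exists_weight (X := MaxSlope hE') (wt := MaxSlope.weight G)
    fun A B _ _ => MaxSlope.weight_transposed G A B
  have h1 := R.weight_top hθ hG hW0 hW
  have h2 := R'.weight_top hθ (hG.trans (slope_eq_of_gradedIso hP hP' h)) hW0' hW'
  rw [hP.weight_top hW0 hW] at h1
  rw [hP'.weight_top hW0' hW'] at h2
  obtain ⟨e, he⟩ := h
  have h3 := Fintype.sum_equiv e (fun i => if HasHom (P.gr i) G then (P.gr i).rk else 0)
    (fun i => if HasHom (P'.gr i) G then (P'.gr i).rk else 0) fun i => by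
      obtain ⟨f⟩ := he i
      rw [f.rk_eq]
      exact if_congr f.hasHom_iff rfl rfl
  rw [h1, h2] at h3
  exact Nat.eq_of_mul_eq_mul_right hθ.1 h3

end HolBundle

end

theorem mainTheorem4 {M : Type v} [TopologicalSpace M] [ChartedSpace ℂ M] [IsManifold 𝓘(ℂ) ω M]
    [CompactSpace M] [T2Space M] [ConnectedSpace M] (σ : AntiholInvolution M)
    (E E' : HolBundle.{u} M) (τ : HolBundle.RealStructure σ E) (τ' : HolBundle.RealStructure σ E')
    (hE : E.IsSemistable) (hE' : E'.IsSemistable)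
    (hgr : ∃ (P : E.Filtration) (P' : E'.Filtration), P.IsJordanHolder ∧ P'.IsJordanHolder ∧
      HolBundle.GradedIso P.gr P'.gr) :
    Nonempty (HolBundle.RealJordanHolder τ) ∧ Nonempty (HolBundle.RealJordanHolder τ') ∧
    ∀ (R : HolBundle.RealJordanHolder τ) (R' : HolBundle.RealJordanHolder τ'),
      HolBundle.GradedRealIso R.grReal R'.grReal ∧
      ∀ e : Fin R.len ≃ Fin R'.len, (∀ i, Nonempty (HolBundle.Iso (R.gr i) (R'.gr (e i)))) →
        ∀ i, Nonempty (HolBundle.RealIso (R.grReal i) (R'.grReal (e i))) := by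
  obtain ⟨P, P', hP, hP', h⟩ := hgr
  have hslope := HolBundle.slope_eq_of_gradedIso hP hP' h
  refine ⟨hE.nonempty_realJordanHolder τ, hE'.nonempty_realJordanHolder τ', fun R R' => ⟨?_, ?_⟩⟩
  · let f : Fin R.len → Quotient (HolBundle.realSetoid.{u} σ) := fun i => ⟦⟨R.gr i, R.grReal i⟩⟧
    let g : Fin R'.len → Quotient (HolBundle.realSetoid.{u} σ) := fun i =>
      ⟦⟨R'.gr i, R'.grReal i⟩⟧
    have hf : ∀ (G : HolBundle.{u} M) (θ : HolBundle.RealStructure σ G),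
        Nat.card {i // f i = ⟦⟨G, θ⟩⟧} =
          Nat.card {i // Nonempty (HolBundle.RealIso (R.grReal i) θ)} :=
      fun G θ => Nat.card_congr (Equiv.subtypeEquivRight fun i => Quotient.eq)
    have hg : ∀ (G : HolBundle.{u} M) (θ : HolBundle.RealStructure σ G),
        Nat.card {i // g i = ⟦⟨G, θ⟩⟧} =
          Nat.card {i // Nonempty (HolBundle.RealIso (R'.grReal i) θ)} :=
      fun G θ => Nat.card_congr (Equiv.subtypeEquivRight fun i => Quotient.eq)
    have hcard : ∀ (G : HolBundle.{u} M) (θ : HolBundle.RealStructure σ G), θ.IsRealStable →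
        G.slope = E.slope → Nat.card {i // f i = ⟦⟨G, θ⟩⟧} = Nat.card {i // g i = ⟦⟨G, θ⟩⟧} :=
      fun G θ hθ hG => by
        rw [hf, hg, R.card_eq hE hE' hP hP' h R' hθ hG]
    obtain ⟨e, he⟩ := exists_equiv_of_card_fiber_eq (f := f) (g := g)
      (fun i => (hcard _ _ (R.stable i) (R.slope_eq i)).symm)
      (fun i => (hcard _ _ (R'.stable i) ((R'.slope_eq i).trans hslope.symm)).symm)
    exact ⟨e, fun i => Quotient.exact (he i).symm⟩
  · rintro e he i
    obtain ⟨f⟩ := he i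
    exact ((R.stable i).hasHom_iff (R'.stable (e i))
      (by rw [R.slope_eq, R'.slope_eq, hslope])).1
      (HolBundle.hasHom_of_injective (R.stable i).1 f.toHom fun x => (f.toEquiv x).injective)
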